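/- Let $\Omega\subseteq\mathbb R^n$ be open with $0\in\Omega$ and let $f\in C^4(\Omega;\mathbb R^n)$ be such that the system $\partial_t u+\partial_x f(u)=0$ is strictly hyperbolic, i.e. $Df(u)$ has $n$ real distinct eigenvalues $\lambda_1(u)<\dots<\lambda_n(u)$ for every $u\in\Omega$, and each characteristic field is either genuinely nonlinear or linearly degenerate. Fix $k_1,\dots,k_n>0$ and right eigenvectors $r_j(u)$ of $Df(u)$ for $\lambda_j(u)$, normalized by $D\lambda_j\, r_j=k_j$ if the $j$-th field is genuinely nonlinear and by $|r_j|=1$ if it is linearly degenerate (with the sign chosen continuously near $0$). For $\sigma\ge 0$ let $\psi_j(\sigma)(u)$ be the state reached at parameter $\sigma$ by the $j$-th rarefaction curve exiting $u$ (the integral curve of $r_j$); for $\sigma<0$ let it be the state reached at parameter $\sigma$ by the $j$-th shock curve exiting $u$ (the $C^1$ curve of states satisfying the Rankine–Hugoniot conditions with $u$ and tangent to $r_j(u)$ at $u$, parametrized so that $\lambda_j$ has derivative $k_j$ along it in the genuinely nonlinear case, and by arc-length in the linearly degenerate case). For $\varepsilon>0$ and states $u^-,u^+$, let $E(u^-,u^+)=(\sigma_1,\dots,\sigma_n)$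 be such that $u^+=\psi_n(\sigma_n)\circ\dots\circ\psi_1(\sigma_1)(u^-)$, where all the curves involved are required to lie in the neighbourhood $\Omega\cap B(0,\varepsilon)$ of the origin; the map $E$ is defined on the pairs $(u^-,u^+)$ for which such $\sigma_i$ exist (they are unique when $\varepsilon$ is small). Let $u=\sum_{\alpha=1}^N u_\alpha\chi_{[x_\alpha,x_{\alpha+1}[}$ be piecewise constant and such that $(u(x-),u(x+))$ is in the domain of $E$ for all $x$. Let $\mathcal I(u)$ be the set of its jump points and let $(\sigma_{x,1},\dots,\sigma_{x,n})=E(u(x-),u(x+))$. Let $\mathcal A(u)$ be the set of pairs $((x,i),(y,j))\in(\mathcal I(u)\times\{1,\dots,n\})^2$ such that $x<y$ and either $i>j$, or $i=j$, the $i$-th field is genuinely nonlinear and $\min\{\sigma_{x,i},\sigma_{y,j}\}<0$. For $C_0>0$ set $$\mathbf V(u)=\sum_{x\in\mathcal I(u)}\sum_{i=1}^n|\sigma_{x,i}|,\qquad \mathbf Q(u)=\sum_{((x,i),(y,j))\in\mathcal A(u)}|\sigma_{x,i}\sigma_{y,j}|,\qquad \mathbf\Upsilon(u)=\mathbf V(u)+C_0\,\mathbf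 Q(u).$$ For $\delta>0$ let $\mathcal D^*_\delta$ be the set of the piecewise constant functions $v=\sum_{\alpha=1}^N v_\alpha\chi_{[x_\alpha,x_{\alpha+1}[}$ with values in $\Omega$ for which $(v(x-),v(x+))$ is in the domain of $E$ for all $x$ and $\mathbf\Upsilon(v)<\delta$. For $\eta>0$ let $B_\eta(u)=\{v\in\mathcal D^*_\delta:\ \|v-u\|_{L^1}<\eta\}$, and let $$\bar{\mathbf Q}(u)=\lim_{\eta\to0+}\ \inf_{v\in B_\eta(u)}\mathbf Q(v),\qquad \bar{\mathbf\Upsilon}(u)=\lim_{\eta\to0+}\ \inf_{v\in B_\eta(u)}\mathbf\Upsilon(v).$$ Then there exist $\varepsilon_0>0$ and $\bar C>0$ such that for every $\varepsilon\in\,]0,\varepsilon_0[$ and every $C_0\ge\bar C$ there exists $\delta_0>0$ such that, for every $\delta\in\,]0,\delta_0[$ and every $u\in\mathcal D^*_\delta$, the two limits above exist and $$\bar{\mathbf Q}(u)=\mathbf Q(u)\qquad\text{and}\qquad\bar{\mathbf\Upsilon}(u)=\mathbf\Upsilon(u).$$ -/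

import Mathlib

open Filter Topology MeasureTheory

noncomputable section

namespace Glimm

/-- The space of states `ℝⁿ`, with its Euclidean norm. -/
abbrev State (n : ℕ) : Type := EuclideanSpace ℝ (Fin n)

/-! ### The system of conservation laws -/

/-- `l` lists `n` real distinct eigenvalues of `A`, in increasing order. -/
def IsSpectrum {n : ℕ} (A : State n →L[ℝ] State n) (l : Fin n → ℝ) : Prop :=
  StrictMono l ∧ ∀ j, ∃ v : State n, v ≠ 0 ∧ A v = l j • v

/-- The Jacobian of the flux has `n` real distinct eigenvalues at every state of `Ω`. -/
def StrictlyHyperbolic {n : ℕ} (Ω : Set (State n)) (f : State n → State n) : Prop :=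
  ∀ u ∈ Ω, ∃ l : Fin n → ℝ, IsSpectrum (fderiv ℝ f u) l

open Classical in
/-- The `j`-th eigenvalue of `Df(u)`, in increasing order (`0` if `Df(u)` does not have
`n` real distinct eigenvalues). -/
def speed {n : ℕ} (f : State n → State n) (j : Fin n) (u : State n) : ℝ :=
  if h : ∃ l : Fin n → ℝ, IsSpectrum (fderiv ℝ f u) l then h.choose j else 0

/-- The `j`-th characteristic field is genuinely nonlinear: the derivative of the `j`-th
eigenvalue along every `j`-th eigenvector is different from zero. -/
def GenuinelyNonlinear {n : ℕ} (Ω : Set (State n)) (f : State n → State n) (j : Fin n) : Prop :=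
  ∀ u ∈ Ω, ∀ v : State n, v ≠ 0 → fderiv ℝ f u v = speed f j u • v →
    fderiv ℝ (speed f j) u v ≠ 0

/-- The `j`-th characteristic field is linearly degenerate: the derivative of the `j`-th
eigenvalue along every `j`-th eigenvector vanishes. -/
def LinearlyDegenerate {n : ℕ} (Ω : Set (State n)) (f : State n → State n) (j : Fin n) : Prop :=
  ∀ u ∈ Ω, ∀ v : State n, fderiv ℝ f u v = speed f j u • v →
    fderiv ℝ (speed f j) u v = 0

/-- The standing assumption on the flux: `f` is of class `C⁴` on `Ω`, the system is strictly
hyperbolic, and each characteristic field is genuinely nonlinear or linearly degenerate. -/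
structure ConditionF {n : ℕ} (Ω : Set (State n)) (f : State n → State n) : Prop where
  contDiffOn : ContDiffOn ℝ 4 f Ω
  strictlyHyperbolic : StrictlyHyperbolic Ω f
  fields : ∀ j, GenuinelyNonlinear Ω f j ∨ LinearlyDegenerate Ω f j

/-- `r j u` is the `j`-th right eigenvector of `Df(u)`, normalized by `Dλ_j(u) r_j(u) = k_j` if the
`j`-th field is genuinely nonlinear, and by `|r_j(u)| = 1` if it is linearly degenerate. In the
latter case the sign remains free; it is chosen continuously near the origin. -/
structure IsNormalizedFrame {n : ℕ} (Ω : Set (State n)) (f : State n → State n) (k : Fin n → ℝ)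
    (r : Fin n → State n → State n) : Prop where
  eigen : ∀ j, ∀ u ∈ Ω, fderiv ℝ f u (r j u) = speed f j u • r j u
  normalized_gnl : ∀ j, GenuinelyNonlinear Ω f j →
    ∀ u ∈ Ω, fderiv ℝ (speed f j) u (r j u) = k j
  normalized_ld : ∀ j, LinearlyDegenerate Ω f j → ∀ u ∈ Ω, ‖r j u‖ = 1
  continuous_near : ∀ j, ∀ᶠ u in 𝓝 (0 : State n), ContinuousAt (r j) u

/-- The data fixed throughout: the domain `Ω`, the flux `f`, the constants `k_j` and the
eigenvectors `r_j`. All assumptions on them are hypotheses where they are used. -/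
structure System (n : ℕ) where
  Ω : Set (State n)
  f : State n → State n
  k : Fin n → ℝ
  r : Fin n → State n → State n

namespace System

variable {n : ℕ} (P : System n)

/-! ### Lax curves and Riemann problems

States near the origin are needed only. The number `ε` is the size of the neighbourhood
`Ω ∩ B(0, ε)` of the origin in which all the curves below are considered. -/

/-- The neighbourhood of the origin in which Riemann problems are solved. -/
def nbhd (ε : ℝ) : Set (State n) := P.Ω ∩ Metric.ball 0 ε

/-- `w = R_j(σ)(u)`, for `σ ≥ 0`: the integral curve of `r_j` exiting `u` at parameter `0` reaches
`w` at parameter `σ`. -/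
def Rarefaction (ε : ℝ) (j : Fin n) (σ : ℝ) (u w : State n) : Prop :=
  ∃ γ : ℝ → State n, γ 0 = u ∧ γ σ = w ∧
    ∀ s ∈ Set.Icc 0 σ, γ s ∈ P.nbhd ε ∧ HasDerivWithinAt γ (P.r j (γ s)) (Set.Icc 0 σ) s

/-- `w = S_j(σ)(u)`, for `σ < 0`: the `C¹` curve `c` of states satisfying the Rankine–Hugoniot
conditions with `u`, exiting `u` with tangent `r_j(u)`, reaches `w` at parameter `σ`. The parameter
is such that `dλ_j/dσ = k_j` along the curve if the field is genuinely nonlinear, and is the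
arc-length if the field is linearly degenerate. -/
def Shock (ε : ℝ) (j : Fin n) (σ : ℝ) (u w : State n) : Prop :=
  ∃ c c' : ℝ → State n, c 0 = u ∧ c σ = w ∧ c' 0 = P.r j u ∧ ContinuousOn c' (Set.Icc σ 0) ∧
    ∀ τ ∈ Set.Icc σ 0, c τ ∈ P.nbhd ε ∧ HasDerivWithinAt c (c' τ) (Set.Icc σ 0) τ ∧
      (∃ s : ℝ, P.f (c τ) - P.f u = s • (c τ - u)) ∧
      (GenuinelyNonlinear P.Ω P.f j → speed P.f j (c τ) = speed P.f j u + P.k j * τ) ∧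
      (LinearlyDegenerate P.Ω P.f j → ‖c' τ‖ = 1)

/-- `w = ψ_j(σ)(u)`, where `ψ_j` is the `j`-th Lax curve. -/
def Lax (ε : ℝ) (j : Fin n) (σ : ℝ) (u w : State n) : Prop :=
  (0 ≤ σ ∧ P.Rarefaction ε j σ u w) ∨ (σ < 0 ∧ P.Shock ε j σ u w)

/-- `u⁺ = Ψ(σ)(u⁻)`, where `Ψ(σ) = ψ_n(σ_n) ∘ … ∘ ψ_1(σ_1)`; `ω` lists the intermediate states. -/
def WaveFan (ε : ℝ) (σ : Fin n → ℝ) (um up : State n) : Prop :=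
  ∃ ω : Fin (n + 1) → State n, ω 0 = um ∧ ω (Fin.last n) = up ∧
    ∀ j : Fin n, P.Lax ε j (σ j) (ω j.castSucc) (ω j.succ)

/-- The pair of states `(u⁻, u⁺)` belongs to the domain of the map `E`. -/
def Solvable (ε : ℝ) (um up : State n) : Prop :=
  ∃ σ : Fin n → ℝ, P.WaveFan ε σ um up

open Classical in
/-- The map `E`: the sizes `(σ_1, …, σ_n)` of the waves in the solution of the Riemann problem with
data `u⁻, u⁺`, that is `u⁺ = Ψ(σ)(u⁻)`. -/
def E (ε : ℝ) (um up : State n) : Fin n → ℝ :=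
  if h : P.Solvable ε um up then h.choose else 0

/-! ### The Glimm functionals on piecewise constant functions -/

/-- `σ_{x,i}`, the size of the `i`-th wave at the point `x` of `u`. -/
def waveSize (ε : ℝ) (u : ℝ → State n) (x : ℝ) (i : Fin n) : ℝ :=
  P.E ε (Function.leftLim u x) (Function.rightLim u x) i

/-- `𝓘(u)`, the set of points where `u` has a jump. -/
def jumps (u : ℝ → State n) : Set ℝ :=
  {x | Function.leftLim u x ≠ Function.rightLim u x}

/-- `𝓐(u)`, the set of approaching waves. -/
def approaching (ε : ℝ) (u : ℝ → State n) : Set ((ℝ × Fin n) × (ℝ × Fin n)) :=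
  {p | p.1.1 ∈ jumps u ∧ p.2.1 ∈ jumps u ∧ p.1.1 < p.2.1 ∧
    (p.2.2 < p.1.2 ∨
      (p.1.2 = p.2.2 ∧ GenuinelyNonlinear P.Ω P.f p.1.2 ∧
        min (P.waveSize ε u p.1.1 p.1.2) (P.waveSize ε u p.2.1 p.2.2) < 0))}

/-- The linear potential `V`. -/
def V (ε : ℝ) (u : ℝ → State n) : ℝ :=
  ∑ᶠ x ∈ jumps u, ∑ i : Fin n, |P.waveSize ε u x i|

/-- The interaction potential `Q`. -/
def Q (ε : ℝ) (u : ℝ → State n) : ℝ :=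
  ∑ᶠ p ∈ P.approaching ε u, |P.waveSize ε u p.1.1 p.1.2 * P.waveSize ε u p.2.1 p.2.2|

/-- The functional `Υ = V + C₀ Q`. -/
def Upsilon (ε C₀ : ℝ) (u : ℝ → State n) : ℝ :=
  P.V ε u + C₀ * P.Q ε u

/-- `u = ∑_α u_α χ_{[x_α, x_{α+1}[}` for finitely many `x_1 < … < x_{N+1}`: the right continuous
representatives of the piecewise constant functions in `L¹(ℝ; ℝⁿ)`. -/
def _root_.Glimm.IsPiecewiseConstant (u : ℝ → State n) : Prop :=
  ∃ (N : ℕ) (x : Fin (N + 1) → ℝ) (a : Fin N → State n), StrictMono x ∧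
    u = ∑ α : Fin N, (Set.Ico (x α.castSucc) (x α.succ)).indicator (fun _ => a α)

/-- `𝓓*_δ`: the piecewise constant functions in `L¹(ℝ; Ω)` for which `Υ` is defined, i.e. all of
whose jumps belong to the domain of `E`, and is smaller than `δ`. -/
def Dstar (ε C₀ δ : ℝ) : Set (ℝ → State n) :=
  {v | IsPiecewiseConstant v ∧ (∀ x, v x ∈ P.Ω) ∧
    (∀ x, P.Solvable ε (Function.leftLim v x) (Function.rightLim v x)) ∧
    P.Upsilon ε C₀ v < δ}

/-- `B_η(u)`: the functions of `𝓓*_δ` whose `L¹` distance from `u` is smaller than `η`. -/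
def B (ε C₀ δ η : ℝ) (u : ℝ → State n) : Set (ℝ → State n) :=
  {v | v ∈ P.Dstar ε C₀ δ ∧ eLpNorm (v - u) 1 volume < ENNReal.ofReal η}

/-- The infimum of the functional `F` over `B_η(u)`. -/
def infOn (ε C₀ δ : ℝ) (F : (ℝ → State n) → ℝ) (u : ℝ → State n) (η : ℝ) : ℝ :=
  sInf (F '' P.B ε C₀ δ η u)

/-- The relaxed interaction potential, `lim_{η → 0+} inf_{v ∈ B_η(u)} Q(v)`. -/
def Qbar (ε C₀ δ : ℝ) (u : ℝ → State n) : ℝ :=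
  limUnder (𝓝[>] (0 : ℝ)) (P.infOn ε C₀ δ (P.Q ε) u)

/-- The relaxed Glimm functional, `lim_{η → 0+} inf_{v ∈ B_η(u)} Υ(v)`. -/
def UpsilonBar (ε C₀ δ : ℝ) (u : ℝ → State n) : ℝ :=
  limUnder (𝓝[>] (0 : ℝ)) (P.infOn ε C₀ δ (P.Upsilon ε C₀) u)

end System

end Glimm

end

/-! The statement is lower semicontinuity in `L¹`. Since `u` lies in every `B_η(u)`, the infima
never exceed the value at `u`. What must be shown is that `α V + β Q`, for `(α, β) = (0, 1)` and
`(1, C₀)`, is larger than its value at `u` minus `κ` at every `v` close enough to `u`.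

Just to the right of each break point `p` of `u`, the function `v` takes a value close to `u p`,
because the `L¹` distance is small. The values so sampled form a subsequence of the sequence of
values of `v`, and `α V + β Q` is continuous on sequences of fixed length. So it suffices that
deleting states from a sequence does not increase `α V + β Q` (`RiemannSolver.glimm_sublist_le`).
Deleting one state merges two adjacent Riemann problems. By the interaction estimate
(`exists_interaction_estimate`) the new waves differ from the sums of the old ones by at most `K`
times the amount of interaction of the two. `Q` loses this interaction, gains at most half of it
back because the total strength is small, and what remains pays for the growth of `V` as soon as `β
≥ 2 K α`.

The interaction estimate is a bound on a second difference: the outgoing waves are compared with an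
exact superposition obtained when all approaching waves are removed (`exists_norm_add_wave_le`). The
Lax curves need not be smooth across `σ = 0`, so regularity is expressed by `FourPointAt`, which
holds for `C²` maps and flows and survives composition, local inversion and the gluing of two
branches that agree up to `O(σ²)` (`FourPointAt.comp_min`).

Rarefaction, shock and contact curves are given only as relations. The Hugoniot curves come from the
implicit function theorem (`exists_hugoniot`) and the flows from Picard–Lindelöf. In a small ball
every curve allowed by the definitions is one of these (`LaxCurve.unique`), so that `E` agrees there
with one continuous solver `S`, a local inverse of the composed Lax curves. -/

/-! ### Maps with bounded second differences -/

namespace Glimm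

variable {X Y Z : Type*} [NormedAddCommGroup X] [NormedAddCommGroup Y] [NormedAddCommGroup Z]

/-- Near `p`, the second differences of `φ` are bounded. This is a substitute for the class
`C^{1,1}`, stable under composition and inversion. -/
def FourPointAt (φ : X → Y) (p : X) : Prop :=
  ∃ C, 0 ≤ C ∧ ∃ r, 0 < r ∧ ∀ a ∈ Metric.ball p r, ∀ b ∈ Metric.ball p r,
    ∀ c ∈ Metric.ball p r, ∀ d ∈ Metric.ball p r,
      ‖φ d - φ b - φ c + φ a‖ ≤ C * (‖d - b - c + a‖ + ‖b - a‖ * ‖c - a‖)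

/-- With three of the four points equal, the product term vanishes and the second difference is a
first difference. -/
theorem FourPointAt.lipschitz {φ : X → Y} {p : X} (h : FourPointAt φ p) :
    ∃ C, 0 ≤ C ∧ ∃ r, 0 < r ∧ ∀ x ∈ Metric.ball p r, ∀ y ∈ Metric.ball p r,
      ‖φ x - φ y‖ ≤ C * ‖x - y‖ := by
  obtain ⟨C, hC, r, hr, H⟩ := h
  refine ⟨C, hC, r, hr, fun x hx y hy => ?_⟩
  simpa [norm_sub_rev, ← sub_eq_neg_add] using H x hx x hx y hy x hx

theorem FourPointAt.continuousAt {φ : X → Y} {p : X} (h : FourPointAt φ p) :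
    ContinuousAt φ p := by
  obtain ⟨C, hC, r, hr, H⟩ := h.lipschitz
  have : LipschitzOnWith C.toNNReal φ (Metric.ball p r) := by
    refine LipschitzOnWith.of_dist_le_mul fun x hx y hy => ?_
    rw [dist_eq_norm, dist_eq_norm, Real.coe_toNNReal _ hC]
    exact H x hx y hy
  exact this.continuousOn.continuousAt (Metric.ball_mem_nhds p hr)

theorem FourPointAt.eventually_continuousAt {φ : X → Y} {p : X} (h : FourPointAt φ p) :
    ∀ᶠ x in 𝓝 p, ContinuousAt φ x := by
  obtain ⟨C, hC, r, hr, H⟩ := h.lipschitz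
  have : LipschitzOnWith C.toNNReal φ (Metric.ball p r) := by
    refine LipschitzOnWith.of_dist_le_mul fun x hx y hy => ?_
    rw [dist_eq_norm, dist_eq_norm, Real.coe_toNNReal _ hC]
    exact H x hx y hy
  filter_upwards [Metric.ball_mem_nhds p hr] with x hx
  exact this.continuousOn.continuousAt (Metric.isOpen_ball.mem_nhds hx)

theorem FourPointAt.congr {φ χ : X → Y} {p : X} (h : FourPointAt φ p) (e : φ =ᶠ[𝓝 p] χ) :
    FourPointAt χ p := by
  obtain ⟨C, hC, r, hr, H⟩ := h
  obtain ⟨s, hs, hse⟩ := Metric.eventually_nhds_iff_ball.1 e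
  refine ⟨C, hC, min r s, lt_min hr hs, fun a ha b hb c hc d hd => ?_⟩
  have i1 := Metric.ball_subset_ball (x := p) (min_le_left r s)
  have i2 := Metric.ball_subset_ball (x := p) (min_le_right r s)
  rw [← hse a (i2 ha), ← hse b (i2 hb), ← hse c (i2 hc), ← hse d (i2 hd)]
  exact H a (i1 ha) b (i1 hb) c (i1 hc) d (i1 hd)

theorem FourPointAt.prodMk {φ : X → Y} {χ : X → Z} {p : X} (h : FourPointAt φ p)
    (h' : FourPointAt χ p) : FourPointAt (fun x => (φ x, χ x)) p := by
  obtain ⟨C, hC, r, hr, H⟩ := h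
  obtain ⟨D, hD, s, hs, K⟩ := h'
  have i1 := Metric.ball_subset_ball (x := p) (min_le_left r s)
  have i2 := Metric.ball_subset_ball (x := p) (min_le_right r s)
  refine ⟨max C D, le_max_of_le_left hC, min r s, lt_min hr hs, fun a ha b hb c hc d hd => ?_⟩
  rw [Prod.norm_def]
  refine max_le ((H a (i1 ha) b (i1 hb) c (i1 hc) d (i1 hd)).trans ?_)
    ((K a (i2 ha) b (i2 hb) c (i2 hc) d (i2 hd)).trans ?_)
  · gcongr; exact le_max_left _ _
  · gcongr; exact le_max_right _ _

/-- The second difference of `χ` enters the linear term of the bound for `φ`, while the Lipschitz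
constant of `χ` controls the product of the two sides. -/
theorem FourPointAt.comp {φ : Y → Z} {χ : X → Y} {p : X} (h : FourPointAt φ (χ p))
    (h' : FourPointAt χ p) : FourPointAt (fun x => φ (χ x)) p := by
  obtain ⟨C, hC, r, hr, H⟩ := h
  obtain ⟨L, hL, t, ht, hLip⟩ := h'.lipschitz
  obtain ⟨u, hu, hcont⟩ := Metric.continuousAt_iff.1 h'.continuousAt r hr
  obtain ⟨D, hD, s, hs, K⟩ := h'
  refine ⟨C * (D + L * L), by positivity, min s (min t u), by positivity,
    fun a ha b hb c hc d hd => ?_⟩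
  have i1 := Metric.ball_subset_ball (x := p) (min_le_left s (min t u))
  have i2 := Metric.ball_subset_ball (x := p) ((min_le_right s (min t u)).trans (min_le_left _ _))
  have i3 := Metric.ball_subset_ball (x := p) ((min_le_right s (min t u)).trans (min_le_right _ _))
  have e1 := H (χ a) (hcont (i3 ha)) (χ b) (hcont (i3 hb)) (χ c) (hcont (i3 hc)) (χ d)
    (hcont (i3 hd))
  have e2 := K a (i1 ha) b (i1 hb) c (i1 hc) d (i1 hd)
  have e3 := hLip b (i2 hb) a (i2 ha)
  have e4 := hLip c (i2 hc) a (i2 ha)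
  calc _ ≤ _ := e1
    _ ≤ C * (D * (‖d - b - c + a‖ + ‖b - a‖ * ‖c - a‖) + (L * ‖b - a‖) * (L * ‖c - a‖)) := by
        gcongr
    _ ≤ C * (D + L * L) * (‖d - b - c + a‖ + ‖b - a‖ * ‖c - a‖) := by
        have : 0 ≤ L * L * ‖d - b - c + a‖ := by positivity
        rw [mul_assoc C]
        refine mul_le_mul_of_nonneg_left ?_ hC
        linarith

/-- A continuous right inverse of an antilipschitz map with bounded second differences has bounded
second differences. -/
theorem FourPointAt.rightInverse {Θ : X → Y} {g : Y → X} {q : Y} (h : FourPointAt Θ (g q))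
    (hg : ContinuousAt g q) (hinv : ∀ᶠ y in 𝓝 q, Θ (g y) = y) {K : ℝ}
    (hK : ∃ r > 0, ∀ x ∈ Metric.ball (g q) r, ∀ y ∈ Metric.ball (g q) r,
      ‖x - y‖ ≤ K * ‖Θ x - Θ y‖) : FourPointAt g q := by
  obtain ⟨C, hC, r, hr, H⟩ := h
  obtain ⟨s, hs, hlo⟩ := hK
  wlog hK0 : 0 ≤ K generalizing K
  · refine this (K := max K 0) (fun x hx y hy => (hlo x hx y hy).trans ?_) (le_max_right _ _)
    gcongr
    exact le_max_left _ _
  set m := min r s with hm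
  have hm0 : 0 < m := lt_min hr hs
  obtain ⟨t, ht, hcont⟩ := Metric.continuousAt_iff.1 hg (m / 3) (by positivity)
  obtain ⟨t', ht', hinv⟩ := Metric.eventually_nhds_iff_ball.1 hinv
  refine ⟨K * (1 + C * (K * K)), by positivity, min t t', lt_min ht ht', fun a ha b hb c hc d hd => ?_⟩
  have i1 := Metric.ball_subset_ball (x := q) (min_le_left t t')
  have i2 := Metric.ball_subset_ball (x := q) (min_le_right t t')
  have hA := hcont (i1 ha)
  have hB := hcont (i1 hb)
  have hC' := hcont (i1 hc)
  have hD := hcont (i1 hd)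
  have ea := hinv a (i2 ha)
  have eb := hinv b (i2 hb)
  have ec := hinv c (i2 hc)
  have ed := hinv d (i2 hd)
  set A := g a
  set B := g b
  set D := g d
  set G := g c
  have hP : dist (B + G - A) (g q) < m := by
    rw [dist_eq_norm] at *
    have : B + G - A - g q = (B - g q) + (G - g q) - (A - g q) := by abel
    rw [this]
    have := norm_sub_le ((B - g q) + (G - g q)) (A - g q)
    have := norm_add_le (B - g q) (G - g q)
    linarith
  have big : ∀ {z : X}, dist z (g q) < m / 3 → dist z (g q) < m := fun h => by linarith
  have tr : ∀ {z : X}, dist z (g q) < m → z ∈ Metric.ball (g q) r := fun h =>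
    h.trans_le (min_le_left _ _)
  have ts : ∀ {z : X}, dist z (g q) < m → z ∈ Metric.ball (g q) s := fun h =>
    h.trans_le (min_le_right _ _)
  -- On the exact parallelogram with fourth vertex `B + G - A` only the product term remains. The
  -- antilipschitz bound then measures how far `g d` is from that vertex. The radius `m / 3` above
  -- keeps the vertex, a sum of three displacements, in the ball.
  have h4 := H A (tr (big hA)) B (tr (big hB)) G (tr (big hC')) (B + G - A) (tr hP)
  have z : B + G - A - B - G + A = 0 := by abel
  rw [z, norm_zero, zero_add, eb, ec, ea] at h4
  have l1 := hlo D (ts (big hD)) (B + G - A) (ts hP)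
  rw [ed] at l1
  have l2 := hlo B (ts (big hB)) A (ts (big hA))
  rw [eb, ea] at l2
  have l3 := hlo G (ts (big hC')) A (ts (big hA))
  rw [ec, ea] at l3
  have e1 : D - B - G + A = D - (B + G - A) := by abel
  rw [e1]
  have e2 : d - Θ (B + G - A) = (d - b - c + a) - (Θ (B + G - A) - b - c + a) := by abel
  calc _ ≤ K * ‖d - Θ (B + G - A)‖ := l1
    _ ≤ K * (‖d - b - c + a‖ + C * ((K * ‖b - a‖) * (K * ‖c - a‖))) := by
      rw [e2]
      gcongr
      refine (norm_sub_le _ _).trans ?_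
      gcongr
      refine h4.trans ?_
      gcongr
    _ ≤ _ := by
      rw [mul_assoc K (1 + _)]
      refine mul_le_mul_of_nonneg_left ?_ hK0
      have : 0 ≤ C * (K * K) * ‖d - b - c + a‖ := by positivity
      have : 0 ≤ ‖b - a‖ * ‖c - a‖ := by positivity
      linarith

variable [NormedSpace ℝ Y]

/-- A function of class `C²` has bounded second differences. -/
theorem FourPointAt.of_contDiffAt [NormedSpace ℝ X] {φ : X → Y} {p : X} (h : ContDiffAt ℝ 2 φ p) :
    FourPointAt φ p := by
  have h1 : ContDiffAt ℝ 1 (fderiv ℝ φ) p := h.fderiv_right (by norm_num)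
  obtain ⟨K, s, hs, hK⟩ := h1.exists_lipschitzOnWith
  obtain ⟨L, s', hs', hL⟩ := (h.of_le (by norm_num : (1 : WithTop ℕ∞) ≤ 2)).exists_lipschitzOnWith
  have hd : ∀ᶠ x in 𝓝 p, DifferentiableAt ℝ φ x := by
    filter_upwards [h.eventually (by simp)] with x hx
    exact hx.differentiableAt (by norm_num)
  obtain ⟨r, hr, hball⟩ := Metric.eventually_nhds_iff_ball.1
    ((eventually_mem_set.2 hs).and ((eventually_mem_set.2 hs').and hd))
  refine ⟨L + K, by positivity, r / 3, by positivity, fun a ha b hb c hc d hd => ?_⟩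
  have hsub := Metric.ball_subset_ball (x := p) (show r / 3 ≤ r by linarith)
  have key : ∀ t ∈ Set.Icc (0 : ℝ) 1, ‖a + t • (c - a) + (b - a) - p‖ < r ∧
      ‖a + t • (c - a) - p‖ < r := by
    intro t ht
    rw [Metric.mem_ball, dist_eq_norm] at ha hb hc
    have e1 : ‖a + t • (c - a) - p‖ < r / 3 := by
      have := (convex_ball p (r/3)).add_smul_sub_mem (x := a) (y := c)
        (by simpa [dist_eq_norm] using ha) (by simpa [dist_eq_norm] using hc) ht
      simpa [dist_eq_norm] using this
    refine ⟨?_, by linarith⟩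
    have : a + t • (c - a) + (b - a) - p = (a + t • (c - a) - p) + (b - p) - (a - p) := by abel
    rw [this]
    have := norm_sub_le ((a + t • (c - a) - p) + (b - p)) (a - p)
    have := norm_add_le (a + t • (c - a) - p) (b - p)
    linarith
  have key' : ∀ t ∈ Set.Icc (0 : ℝ) 1, a + t • (c - a) + (b - a) ∈ Metric.ball p r ∧
      a + t • (c - a) ∈ Metric.ball p r := by
    intro t ht
    simpa [dist_eq_norm] using key t ht
  -- The side `b - a` is carried along the segment from `a` to `c`. The increment of `g` is the
  -- second difference on an exact parallelogram, and its derivative involves the difference of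
  -- `fderiv ℝ φ` at points `b - a` apart. The distance from `d` to `b + c - a` only costs a
  -- Lipschitz constant.
  let g : ℝ → Y := fun t => φ (a + t • (c - a) + (b - a)) - φ (a + t • (c - a))
  let g' : ℝ → Y := fun t => (fderiv ℝ φ (a + t • (c - a) + (b - a)) -
    fderiv ℝ φ (a + t • (c - a))) (c - a)
  have hg : ∀ t ∈ Set.Icc (0 : ℝ) 1, HasDerivWithinAt g (g' t) (Set.Icc 0 1) t := by
    intro t ht
    have hl : HasDerivAt (fun t : ℝ => a + t • (c - a)) (c - a) t := by
      simpa using ((hasDerivAt_id t).smul_const (c - a)).const_add a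
    have d1 := (hball _ (key' t ht).1).2.2.hasFDerivAt.comp_hasDerivAt t (hl.add_const (b - a))
    have d2 := (hball _ (key' t ht).2).2.2.hasFDerivAt.comp_hasDerivAt t hl
    exact (d1.sub d2).hasDerivWithinAt
  have hb' : ∀ t ∈ Set.Ico (0 : ℝ) 1, ‖g' t‖ ≤ K * ‖b - a‖ * ‖c - a‖ := by
    intro t ht
    have ht' := Set.Ico_subset_Icc_self ht
    refine (ContinuousLinearMap.le_opNorm _ _).trans ?_
    gcongr
    have := hK.dist_le_mul _ (hball _ (key' t ht').1).1 _ (hball _ (key' t ht').2).1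
    simpa [dist_eq_norm] using this
  have hmv := norm_image_sub_le_of_norm_deriv_le_segment_01' hg hb'
  have hd' : φ (a + (1:ℝ) • (c - a) + (b - a)) = φ (b + c - a) := by congr 1; rw [one_smul]; abel
  have hmem := (key' 1 (by simp)).1
  have hmem' : b + c - a ∈ Metric.ball p r := by
    convert hmem using 1; rw [one_smul]; abel
  have h2 := hL.dist_le_mul d (hball d (hsub hd)).2.1 (b + c - a) (hball _ hmem').2.1
  rw [dist_eq_norm, dist_eq_norm] at h2
  have e0 : φ d - φ b - φ c + φ a = (φ d - φ (b + c - a)) + (g 1 - g 0) := by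
    simp only [g, hd']
    simp
    abel
  have e1 : d - (b + c - a) = d - b - c + a := by abel
  rw [e1] at h2
  rw [e0]
  calc _ ≤ L * ‖d - b - c + a‖ + K * ‖b - a‖ * ‖c - a‖ := (norm_add_le _ _).trans (add_le_add h2 hmv)
    _ ≤ _ := by
      have : 0 ≤ (K : ℝ) * ‖d - b - c + a‖ := by positivity
      have : 0 ≤ (L : ℝ) * (‖b - a‖ * ‖c - a‖) := by positivity
      linarith

theorem FourPointAt.add {φ χ : X → Y} {p : X} (h : FourPointAt φ p) (h' : FourPointAt χ p) :
    FourPointAt (fun x => φ x + χ x) p :=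
  FourPointAt.comp (φ := fun y : Y × Y => y.1 + y.2) (.of_contDiffAt (by fun_prop)) (h.prodMk h')

theorem FourPointAt.sub {φ χ : X → Y} {p : X} (h : FourPointAt φ p) (h' : FourPointAt χ p) :
    FourPointAt (fun x => φ x - χ x) p :=
  FourPointAt.comp (φ := fun y : Y × Y => y.1 - y.2) (.of_contDiffAt (by fun_prop)) (h.prodMk h')

end Glimm

namespace Glimm

/-! ### Local inverses. -/

section Inverse

variable {X Y : Type*} [NormedAddCommGroup X] [NormedSpace ℝ X] [CompleteSpace X]
  [NormedAddCommGroup Y] [NormedSpace ℝ Y]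

/-- The local inverse is strictly differentiable, hence Lipschitz, and this is the antilipschitz
bound for `Θ` that `FourPointAt.rightInverse` asks for. -/
theorem FourPointAt.localInverse {Θ : X → Y} {p : X} {L : X ≃L[ℝ] Y} (h : FourPointAt Θ p)
    (hs : HasStrictFDerivAt Θ (L : X →L[ℝ] Y) p) :
    FourPointAt (hs.localInverse Θ L p) (Θ p) := by
  have hg : HasStrictFDerivAt (hs.localInverse Θ L p) (L.symm : Y →L[ℝ] X) (Θ p) :=
    hs.to_localInverse
  have hp : hs.localInverse Θ L p (Θ p) = p := hs.localInverse_apply_image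
  obtain ⟨K, s, hs', hK⟩ := hg.exists_lipschitzOnWith
  refine FourPointAt.rightInverse (Θ := Θ) (by rwa [hp]) hs.localInverse_continuousAt
    hs.eventually_right_inverse (K := K) ?_
  rw [hp]
  obtain ⟨r, hr, hball⟩ := Metric.eventually_nhds_iff_ball.1
    (hs.eventually_left_inverse.and (hs.continuousAt.eventually (eventually_mem_set.2 hs')))
  refine ⟨r, hr, fun x hx y hy => ?_⟩
  have := hK.dist_le_mul _ (hball x hx).2 _ (hball y hy).2
  rwa [(hball x hx).1, (hball y hy).1, dist_eq_norm, dist_eq_norm] at this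

end Inverse

/-! ### Gluing two branches at the value `0` of the parameter. -/

section Glue

variable {E F : Type*} [NormedAddCommGroup E] [NormedAddCommGroup F]

/-- The second difference of `min · 0` is at most `|h|` and at most `|k|`, and it vanishes unless
`|a| ≤ |h| + |k|`. In that case the weight is `O(|h| + |k|)`, which turns the kink into an
admissible product. The weight is what a map quadratically small at `0` supplies. -/
theorem abs_min_second_difference_mul_le (a h k : ℝ) :
    |min (a + h + k) 0 - min (a + h) 0 - min (a + k) 0 + min a 0| *
      (|min (a + h + k) 0| + |min (a + h) 0 + min (a + k) 0 - min a 0|) ≤ 20 * (|h| * |k|) := by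
  have lip : ∀ x y : ℝ, |min x 0 - min y 0| ≤ |x - y| := fun x y => by
    simpa using abs_min_sub_min_le_max x 0 y 0
  set μ := min (a + h + k) 0 - min (a + h) 0 - min (a + k) 0 + min a 0 with hμ
  have mono : ∀ x t : ℝ, (0 ≤ t → 0 ≤ min (x + t) 0 - min x 0 ∧ min (x + t) 0 - min x 0 ≤ t) ∧
      (t ≤ 0 → min (x + t) 0 - min x 0 ≤ 0 ∧ t ≤ min (x + t) 0 - min x 0) := by
    intro x t
    refine ⟨fun ht => ⟨?_, ?_⟩, fun ht => ⟨?_, ?_⟩⟩ <;>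
    rcases min_cases (x + t) 0 with h1 | h1 <;> rcases min_cases x 0 with h2 | h2 <;> linarith
  have step : ∀ x y t : ℝ, |(min (x + t) 0 - min x 0) - (min (y + t) 0 - min y 0)| ≤ |t| := by
    intro x y t
    obtain ⟨p1, p2⟩ := mono x t
    obtain ⟨q1, q2⟩ := mono y t
    rcases le_total 0 t with ht | ht
    · rw [abs_of_nonneg ht, abs_le]
      have := p1 ht; have := q1 ht
      constructor <;> linarith
    · rw [abs_of_nonpos ht, abs_le]
      have := p2 ht; have := q2 ht
      constructor <;> linarith
  have m1 : |μ| ≤ |h| := by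
    have := step (a + k) a h
    have e : μ = (min (a + k + h) 0 - min (a + k) 0) - (min (a + h) 0 - min a 0) := by
      rw [hμ, add_right_comm]; ring
    rwa [e]
  have m2 : |μ| ≤ |k| := by
    have := step (a + h) a k
    have e : μ = (min (a + h + k) 0 - min (a + h) 0) - (min (a + k) 0 - min a 0) := by
      rw [hμ]; ring
    rwa [e]
  by_cases hz : μ = 0
  · rw [hz]; simp; positivity
  have ha : |a| ≤ |h| + |k| := by
    by_contra hcon
    push Not at hcon
    apply hz
    have := neg_abs_le h
    have := le_abs_self h
    have := neg_abs_le k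
    have := le_abs_self k
    rcases le_total 0 a with h0 | h0
    · rw [abs_of_nonneg h0] at hcon
      rw [hμ, min_eq_right, min_eq_right, min_eq_right, min_eq_right] <;> linarith [abs_nonneg h, abs_nonneg k]
    · rw [abs_of_nonpos h0] at hcon
      rw [hμ, min_eq_left, min_eq_left, min_eq_left, min_eq_left] <;> linarith [abs_nonneg h, abs_nonneg k]
  have l0 : ∀ x : ℝ, |min x 0| ≤ |x| := fun x => by simpa using lip x 0
  have b1 : |min (a + h + k) 0| ≤ 2 * (|h| + |k|) := by
    refine (l0 _).trans ?_
    have := abs_add_three a h k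
    linarith
  have b2 : |min (a + h) 0 + min (a + k) 0 - min a 0| ≤ 3 * (|h| + |k|) := by
    have e : min (a + h) 0 + min (a + k) 0 - min a 0 =
      (min (a + h) 0) + (min (a + k) 0 - min a 0) := by ring
    rw [e]
    refine (abs_add_le _ _).trans ?_
    have := l0 (a + h)
    have := abs_add_le a h
    have h1 := lip (a + k) a
    rw [add_sub_cancel_left] at h1
    linarith [abs_nonneg h, abs_nonneg k]
  calc _ ≤ |μ| * (2 * (|h| + |k|) + 3 * (|h| + |k|)) := by gcongr
    _ = 5 * (|μ| * |h| + |μ| * |k|) := by ring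
    _ ≤ 5 * (|k| * |h| + |h| * |k|) := by gcongr
    _ ≤ _ := by nlinarith [mul_nonneg (abs_nonneg h) (abs_nonneg k)]

/-- Cutting a map that is quadratically small in its first variable at the value `0` of that
variable preserves the boundedness of second differences. -/
theorem FourPointAt.comp_min {D : ℝ × E → F} (h : FourPointAt D 0) {C : ℝ}
    (hC : ∀ᶠ x in 𝓝 (0 : ℝ × E), ‖D x‖ ≤ C * x.1 ^ 2) :
    FourPointAt (fun x : ℝ × E => D (min x.1 0, x.2)) 0 := by
  obtain ⟨K, hK, r, hr, H⟩ := h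
  wlog hC0 : 0 ≤ C generalizing C
  · refine this (C := max C 0) (hC.mono fun x hx => hx.trans ?_) (le_max_right _ _)
    gcongr
    exact le_max_left _ _
  obtain ⟨s, hs, hC⟩ := Metric.eventually_nhds_iff_ball.1 hC
  set ρ := min (min r s) 1 with hρ
  have hρ0 : 0 < ρ := by positivity
  have hρ1 : ρ ≤ 1 := min_le_right _ _
  have tr : ∀ {x : ℝ} {y : E}, |x| < ρ → ‖y‖ < ρ → (x, y) ∈ Metric.ball (0 : ℝ × E) r := by
    intro x y hx hy
    rw [mem_ball_zero_iff, Prod.norm_def]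
    exact (max_lt hx hy).trans_le ((min_le_left _ _).trans (min_le_left _ _))
  have ts : ∀ {x : ℝ} {y : E}, |x| < ρ → ‖y‖ < ρ → (x, y) ∈ Metric.ball (0 : ℝ × E) s := by
    intro x y hx hy
    rw [mem_ball_zero_iff, Prod.norm_def]
    exact (max_lt hx hy).trans_le ((min_le_left _ _).trans (min_le_right _ _))
  -- The four points with parameters `0`, `p - q`, `q`, `p` form a parallelogram, `D` vanishes at
  -- the first and is quadratically small at the second. So the Lipschitz constant of `D` in its
  -- first variable is proportional to the distance from `0`.
  have hdiff : ∀ p q : ℝ, ∀ u : E, |p| < ρ → |q| < ρ → |p - q| < ρ → ‖u‖ < ρ →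
      ‖D (p, u) - D (q, u)‖ ≤ (C + K) * (|p - q| * (|p| + |q|)) := by
    intro p q u hp hq hpq hu
    have h0 : D (0, u) = 0 := by
      have := hC (0, u) (ts (by simpa using hρ0) hu)
      simpa using this
    have h4 := H (0, u) (tr (by simpa using hρ0) hu) (p - q, u) (tr hpq hu) (q, u) (tr hq hu)
      (p, u) (tr hp hu)
    have e : D (p, u) - D (q, u) = (D (p, u) - D (p - q, u) - D (q, u) + D (0, u)) + D (p - q, u) := by
      rw [h0]; abel
    rw [e]
    refine (norm_add_le _ _).trans ?_
    have h5 := hC (p - q, u) (ts hpq hu)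
    have e2 : (p, u) - (p - q, u) - (q, u) + ((0 : ℝ), u) = 0 := by
      ext <;> simp
    rw [e2, norm_zero, zero_add] at h4
    simp only [Prod.mk_sub_mk, sub_self, sub_zero, Prod.norm_mk,
      Real.norm_eq_abs, norm_zero] at h4
    rw [max_eq_left (abs_nonneg (p - q)), max_eq_left (abs_nonneg q)] at h4
    have h6 : |p - q| ≤ |p| + |q| := abs_sub _ _
    have h7 : (p - q) ^ 2 ≤ |p - q| * (|p| + |q|) := by
      rw [← sq_abs, sq]; gcongr
    have h8 : K * (|p - q| * |q|) ≤ K * (|p - q| * (|p| + |q|)) := by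
      gcongr; linarith [abs_nonneg p]
    have h9 : C * (p - q) ^ 2 ≤ C * (|p - q| * (|p| + |q|)) := by gcongr
    simp only at h5
    linarith
  refine ⟨K + (C + K) * 22, by positivity, ρ / 6, by positivity, fun a ha b hb c hc d hd => ?_⟩
  have nb : ∀ {x : ℝ × E}, x ∈ Metric.ball (0 : ℝ × E) (ρ / 6) → |x.1| < ρ / 6 ∧ ‖x.2‖ < ρ / 6 := by
    intro x hx
    rw [mem_ball_zero_iff, Prod.norm_def, max_lt_iff] at hx
    exact hx
  obtain ⟨a1, a2⟩ := nb ha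
  obtain ⟨b1, b2⟩ := nb hb
  obtain ⟨c1, c2⟩ := nb hc
  obtain ⟨d1, d2⟩ := nb hd
  have lip : ∀ x y : ℝ, |min x 0 - min y 0| ≤ |x - y| := fun x y => by
    simpa using abs_min_sub_min_le_max x 0 y 0
  have l0 : ∀ x : ℝ, |min x 0| ≤ |x| := fun x => by simpa using lip x 0
  set q := min b.1 0 + min c.1 0 - min a.1 0 with hq
  have hqρ : |q| < ρ / 2 := by
    rw [hq]
    have := abs_sub (min b.1 0 + min c.1 0) (min a.1 0)
    have := abs_add_le (min b.1 0) (min c.1 0)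
    have := l0 a.1; have := l0 b.1; have := l0 c.1
    linarith
  set μ := min d.1 0 - q with hμ
  -- the point `d` moved to complete the parallelogram
  have h4 := H (min a.1 0, a.2) (tr (by linarith [l0 a.1]) (by linarith))
    (min b.1 0, b.2) (tr (by linarith [l0 b.1]) (by linarith))
    (min c.1 0, c.2) (tr (by linarith [l0 c.1]) (by linarith))
    (q, d.2) (tr (by linarith) (by linarith))
  set N := ‖d - b - c + a‖ + ‖b - a‖ * ‖c - a‖ with hN
  have hN1 : ‖d - b - c + a‖ ≤ N := by rw [hN]; linarith [mul_nonneg (norm_nonneg (b - a)) (norm_nonneg (c - a))]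
  have fstle : ∀ x : ℝ × E, |x.1| ≤ ‖x‖ := fun x => norm_fst_le x
  have sndle : ∀ x : ℝ × E, ‖x.2‖ ≤ ‖x‖ := fun x => norm_snd_le x
  have h4' : ‖D (q, d.2) - D (min b.1 0, b.2) - D (min c.1 0, c.2) + D (min a.1 0, a.2)‖ ≤ K * N := by
    refine h4.trans ?_
    rw [hN]
    have key : ∀ x y : ℝ × E, ‖(min x.1 0, x.2) - (min y.1 0, y.2)‖ ≤ ‖x - y‖ := by
      intro x y
      rw [Prod.mk_sub_mk, Prod.norm_def]
      exact max_le ((lip _ _).trans (fstle (x - y))) (sndle (x - y))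
    gcongr
    · have : (q, d.2) - (min b.1 0, b.2) - (min c.1 0, c.2) + (min a.1 0, a.2) =
        ((0 : ℝ), (d - b - c + a).2) := by
        ext
        · simp [hq]; ring
        · simp
      rw [this, Prod.norm_def]
      simpa using sndle (d - b - c + a)
    · exact key _ _
    · exact key _ _
  -- The value `m` at the exact fourth vertex separates two errors: `min d.1 0 - m` comes from the
  -- defect of the parallelogram, `m - q` is the second difference of `min · 0`.
  have hmid : |μ| * (|min d.1 0| + |q|) ≤ 22 * N := by
    set m := min (b.1 + c.1 - a.1) 0 with hm
    have e1 : |min d.1 0 - m| ≤ ‖d - b - c + a‖ := by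
      refine (lip _ _).trans ?_
      have e : d.1 - (b.1 + c.1 - a.1) = (d - b - c + a).1 := by simp; ring
      rw [e]
      exact fstle _
    have e2 := abs_min_second_difference_mul_le a.1 (b.1 - a.1) (c.1 - a.1)
    have r1 : a.1 + (b.1 - a.1) + (c.1 - a.1) = b.1 + c.1 - a.1 := by ring
    have r2 : a.1 + (b.1 - a.1) = b.1 := by ring
    have r3 : a.1 + (c.1 - a.1) = c.1 := by ring
    rw [r1, r2, r3, ← hm, ← hq] at e2
    have r4 : m - min b.1 0 - min c.1 0 + min a.1 0 = m - q := by rw [hq]; ring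
    rw [r4] at e2
    have e3 : |b.1 - a.1| * |c.1 - a.1| ≤ ‖b - a‖ * ‖c - a‖ :=
      mul_le_mul (fstle (b - a)) (fstle (c - a)) (abs_nonneg _) (norm_nonneg _)
    have e4 : |μ| ≤ |min d.1 0 - m| + |m - q| := abs_sub_le _ _ _
    have e5 : |min d.1 0| + |q| ≤ 2 := by linarith [l0 d.1]
    have e6 : |min d.1 0| ≤ |min d.1 0 - m| + |m| := by
      simpa using abs_add_le (min d.1 0 - m) m
    have e7 : |m - q| ≤ 4 * ρ / 3 := by
      have t1 : |m| ≤ |b.1 + c.1 - a.1| := l0 _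
      have t2 : |m - q| ≤ |m - min b.1 0| + |min c.1 0 - min a.1 0| := by
        have : m - q = (m - min b.1 0) - (min c.1 0 - min a.1 0) := by rw [hq]; ring
        rw [this]; exact abs_sub _ _
      have t3 := lip (b.1 + c.1 - a.1) b.1
      have t4 := lip c.1 a.1
      have t5 : b.1 + c.1 - a.1 - b.1 = c.1 - a.1 := by ring
      rw [t5, ← hm] at t3
      have t6 := abs_sub c.1 a.1
      linarith
    calc |μ| * (|min d.1 0| + |q|) ≤ (|min d.1 0 - m| + |m - q|) * (|min d.1 0| + |q|) := by gcongr
      _ = |min d.1 0 - m| * (|min d.1 0| + |q|) + |m - q| * (|min d.1 0| + |q|) := by ring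
      _ ≤ |min d.1 0 - m| * 2 + |m - q| * ((|min d.1 0 - m| + |m|) + |q|) := by gcongr
      _ = |min d.1 0 - m| * (2 + |m - q|) + |m - q| * (|m| + |q|) := by ring
      _ ≤ ‖d - b - c + a‖ * (2 + 4 * ρ / 3) + 20 * (‖b - a‖ * ‖c - a‖) := by
        refine add_le_add (by gcongr) (e2.trans (by gcongr))
      _ ≤ 22 * N := by
        rw [hN]
        have : ‖d - b - c + a‖ * (2 + 4 * ρ / 3) ≤ ‖d - b - c + a‖ * 22 := by
          gcongr; linarith
        have : 0 ≤ ‖b - a‖ * ‖c - a‖ := by positivity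
        linarith
  have h5 := hdiff (min d.1 0) q d.2 (by linarith [l0 d.1]) (by linarith) ?_ (by linarith)
  · have e : D (min d.1 0, d.2) - D (min b.1 0, b.2) - D (min c.1 0, c.2) + D (min a.1 0, a.2) =
      (D (min d.1 0, d.2) - D (q, d.2)) +
        (D (q, d.2) - D (min b.1 0, b.2) - D (min c.1 0, c.2) + D (min a.1 0, a.2)) := by abel
    rw [e]
    refine (norm_add_le _ _).trans ((add_le_add h5 h4').trans ?_)
    have : (C + K) * (|μ| * (|min d.1 0| + |q|)) ≤ (C + K) * (22 * N) := by gcongr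
    rw [hμ] at this
    linarith
  · have t2 : |min d.1 0 - q| ≤ |min d.1 0| + |q| := abs_sub _ _
    linarith [l0 d.1]

end Glue
end Glimm

/-! ### The flow of a vector field of class `C²` -/

namespace Glimm

variable {E : Type*} [NormedAddCommGroup E] [NormedSpace ℝ E]

theorem norm_le_exp_of_norm_deriv_le {z z' : ℝ → E} {C δ κ : ℝ} (hC : 1 ≤ C) (hδ : ‖z 0‖ ≤ δ)
    (hκ : 0 ≤ κ) (hz : ∀ s ∈ Set.Icc (0 : ℝ) 1, HasDerivAt z (z' s) s)
    (hb : ∀ s ∈ Set.Icc (0 : ℝ) 1, ‖z' s‖ ≤ C * ‖z s‖ + κ) {s : ℝ} (hs : s ∈ Set.Icc (0 : ℝ) 1) :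
    ‖z s‖ ≤ Real.exp C * (δ + κ) := by
  have hδ0 : 0 ≤ δ := (norm_nonneg _).trans hδ
  have := norm_le_gronwallBound_of_norm_deriv_right_le (f := z) (f' := z') (a := 0) (b := 1)
    (fun s hs => (hz s hs).continuousAt.continuousWithinAt)
    (fun s hs => (hz s (Set.Ico_subset_Icc_self hs)).hasDerivWithinAt) hδ
    (fun s hs => hb s (Set.Ico_subset_Icc_self hs)) s hs
  rw [sub_zero, gronwallBound_of_K_ne_0 (by linarith)] at this
  have h1 : Real.exp (C * s) ≤ Real.exp C := Real.exp_le_exp.2 (by nlinarith [hs.1, hs.2])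
  have h2 : κ / C ≤ κ := div_le_self hκ hC
  have h3 : κ / C * (Real.exp (C * s) - 1) ≤ κ * Real.exp C := by
    refine mul_le_mul h2 (by linarith) ?_ hκ
    have : 0 ≤ C * s := mul_nonneg (by linarith) hs.1
    linarith [Real.one_le_exp this]
  have h4 : δ * Real.exp (C * s) ≤ δ * Real.exp C := by gcongr
  linarith

/-- Two integral curves of a vector field that issue from the same point agree. -/
theorem integralCurve_unique {r : E → E} {K : NNReal} {ρ : ℝ}
    (hr : LipschitzOnWith K r (Metric.ball 0 ρ)) {γ χ : ℝ → E} {σ : ℝ}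
    (hγ : ∀ s ∈ Set.uIcc 0 σ, γ s ∈ Metric.ball 0 ρ ∧
      HasDerivWithinAt γ (r (γ s)) (Set.uIcc 0 σ) s)
    (hχ : ∀ s ∈ Set.uIcc 0 σ, χ s ∈ Metric.ball 0 ρ ∧
      HasDerivWithinAt χ (r (χ s)) (Set.uIcc 0 σ) s)
    (h0 : γ 0 = χ 0) : γ σ = χ σ := by
  rcases le_total 0 σ with hσ | hσ
  · rw [Set.uIcc_of_le hσ] at *
    refine ODE_solution_unique_of_mem_Icc_right (v := fun _ => r) (s := fun _ => Metric.ball 0 ρ)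
      (a := 0) (b := σ) (K := K) (fun _ _ => hr)
      (fun s hs => (hγ s hs).2.continuousWithinAt) (fun s hs => ?_)
      (fun s hs => (hγ s (Set.Ico_subset_Icc_self hs)).1)
      (fun s hs => (hχ s hs).2.continuousWithinAt) (fun s hs => ?_)
      (fun s hs => (hχ s (Set.Ico_subset_Icc_self hs)).1) h0 (Set.right_mem_Icc.2 hσ)
    · exact (hγ s (Set.Ico_subset_Icc_self hs)).2.mono_of_mem_nhdsWithin
        (Icc_mem_nhdsGE_of_mem hs)
    · exact (hχ s (Set.Ico_subset_Icc_self hs)).2.mono_of_mem_nhdsWithin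
        (Icc_mem_nhdsGE_of_mem hs)
  · rw [Set.uIcc_of_ge hσ] at *
    refine ODE_solution_unique_of_mem_Icc_left (v := fun _ => r) (s := fun _ => Metric.ball 0 ρ)
      (a := σ) (b := 0) (K := K) (fun _ _ => hr)
      (fun s hs => (hγ s hs).2.continuousWithinAt) (fun s hs => ?_)
      (fun s hs => (hγ s (Set.Ioc_subset_Icc_self hs)).1)
      (fun s hs => (hχ s hs).2.continuousWithinAt) (fun s hs => ?_)
      (fun s hs => (hχ s (Set.Ioc_subset_Icc_self hs)).1) h0 (Set.left_mem_Icc.2 hσ)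
    · exact (hγ s (Set.Ioc_subset_Icc_self hs)).2.mono_of_mem_nhdsWithin
        (Icc_mem_nhdsLE_of_mem hs)
    · exact (hχ s (Set.Ioc_subset_Icc_self hs)).2.mono_of_mem_nhdsWithin
        (Icc_mem_nhdsLE_of_mem hs)

/-- `R` is the flow of `r` near the origin: for `|t| < a` and `|u| < a`, the point `R (t, u)` is
reached at time `t` by the integral curve of `r` that exits `u`, and this curve remains in the ball
of radius `ρ`. -/
structure IsLocalFlow (r : E → E) (R : ℝ × E → E) (ρ a : ℝ) : Prop where
  pos : 0 < a
  zero : ∀ u ∈ Metric.ball (0 : E) a, R (0, u) = u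
  mem : ∀ u ∈ Metric.ball (0 : E) a, ∀ t, |t| < a → R (t, u) ∈ Metric.ball 0 ρ
  deriv : ∀ u ∈ Metric.ball (0 : E) a, ∀ t, |t| < a →
    HasDerivAt (fun t => R (t, u)) (r (R (t, u))) t

/-- Grönwall's inequality is used twice, first for the difference of two integral curves and then
for the second difference of four. The input is that `(t, w) ↦ t • r w` is of class `C²`. -/
theorem IsLocalFlow.fourPointAt {r : E → E} (hr : ContDiffAt ℝ 2 r 0) :
    ∃ ρ₀ > 0, ∀ ρ ≤ ρ₀, ∀ (R : ℝ × E → E) (a : ℝ), IsLocalFlow r R ρ a → FourPointAt R 0 := by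
  have hG : FourPointAt (fun x : ℝ × E => x.1 • r x.2) 0 := by
    refine FourPointAt.of_contDiffAt ?_
    exact contDiffAt_fst.smul (ContDiffAt.comp (0 : ℝ × E) (g := r) (f := Prod.snd) (by simpa using hr)
      contDiffAt_snd)
  obtain ⟨C₀, hC₀, ρ₀, hρ₀, H⟩ := hG
  refine ⟨ρ₀, hρ₀, fun ρ hρ R a h => ?_⟩
  set C := max C₀ 1 with hC
  have hC1 : 1 ≤ C := le_max_right _ _
  have H : ∀ a ∈ Metric.ball (0 : ℝ × E) ρ₀, ∀ b ∈ Metric.ball (0 : ℝ × E) ρ₀,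
      ∀ c ∈ Metric.ball (0 : ℝ × E) ρ₀, ∀ d ∈ Metric.ball (0 : ℝ × E) ρ₀,
      ‖d.1 • r d.2 - b.1 • r b.2 - c.1 • r c.2 + a.1 • r a.2‖ ≤
        C * (‖d - b - c + a‖ + ‖b - a‖ * ‖c - a‖) := by
    intro a ha b hb c hc d hd
    refine (H a ha b hb c hc d hd).trans ?_
    gcongr
    exact le_max_left _ _
  set m := min a ρ₀ with hm
  have hm0 : 0 < m := lt_min h.pos hρ₀
  have bd : ∀ x ∈ Metric.ball (0 : ℝ × E) m, |x.1| < a ∧ ‖x.2‖ < a ∧ |x.1| < ρ₀ := by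
    intro x hx
    rw [mem_ball_zero_iff, Prod.norm_def, max_lt_iff] at hx
    exact ⟨hx.1.trans_le (min_le_left _ _), hx.2.trans_le (min_le_left _ _),
      hx.1.trans_le (min_le_right _ _)⟩
  -- Rescaling time puts curves with different final times on the common interval `[0, 1]`. The time
  -- becomes a parameter of the vector field.
  let y : ℝ × E → ℝ → E := fun x s => R (s * x.1, x.2)
  have sm : ∀ x ∈ Metric.ball (0 : ℝ × E) m, ∀ s ∈ Set.Icc (0 : ℝ) 1, |s * x.1| < a := by
    intro x hx s hs
    rw [abs_mul, abs_of_nonneg hs.1]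
    nlinarith [(bd x hx).1, hs.2, abs_nonneg x.1, hs.1]
  have hy : ∀ x ∈ Metric.ball (0 : ℝ × E) m, ∀ s ∈ Set.Icc (0 : ℝ) 1,
      HasDerivAt (y x) (x.1 • r (y x s)) s := by
    intro x hx s hs
    have h1 := h.deriv x.2 (by simpa using (bd x hx).2.1) (s * x.1) (sm x hx s hs)
    have h2 : HasDerivAt (fun s : ℝ => s * x.1) x.1 s := by
      simpa using (hasDerivAt_id s).mul_const x.1
    exact h1.scomp s h2
  have hmem : ∀ x ∈ Metric.ball (0 : ℝ × E) m, ∀ s ∈ Set.Icc (0 : ℝ) 1,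
      (x.1, y x s) ∈ Metric.ball (0 : ℝ × E) ρ₀ := by
    intro x hx s hs
    have := h.mem x.2 (by simpa using (bd x hx).2.1) (s * x.1) (sm x hx s hs)
    rw [mem_ball_zero_iff] at this
    rw [mem_ball_zero_iff, Prod.norm_def]
    exact max_lt (bd x hx).2.2 (this.trans_le hρ)
  have hy0 : ∀ x ∈ Metric.ball (0 : ℝ × E) m, y x 0 = x.2 := by
    intro x hx
    simp only [y, zero_mul]
    exact h.zero x.2 (by simpa using (bd x hx).2.1)
  have hy1 : ∀ x, y x 1 = R x := fun x => by simp [y]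
  set M := 2 * Real.exp C with hM
  have hM1 : 1 ≤ M := by
    have : 1 ≤ Real.exp C := Real.one_le_exp (by linarith)
    linarith
  have lip : ∀ x ∈ Metric.ball (0 : ℝ × E) m, ∀ x' ∈ Metric.ball (0 : ℝ × E) m,
      ∀ s ∈ Set.Icc (0 : ℝ) 1, ‖y x s - y x' s‖ ≤ M * C * ‖x - x'‖ := by
    intro x hx x' hx' s hs
    have := norm_le_exp_of_norm_deriv_le (z := fun s => y x s - y x' s) (C := C) (δ := ‖x - x'‖)
      (κ := C * ‖x - x'‖) hC1 ?_ (by positivity) (fun s hs => (hy x hx s hs).sub (hy x' hx' s hs))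
      ?_ hs
    · refine this.trans ?_
      rw [hM]
      have : ‖x - x'‖ ≤ C * ‖x - x'‖ := le_mul_of_one_le_left (norm_nonneg _) hC1
      calc Real.exp C * (‖x - x'‖ + C * ‖x - x'‖) ≤ Real.exp C * (C * ‖x - x'‖ + C * ‖x - x'‖) := by gcongr
        _ = _ := by ring
    · rw [hy0 x hx, hy0 x' hx']
      exact norm_snd_le (x - x')
    · intro s hs
      have h4 := H (x.1, y x s) (hmem x hx s hs) (x.1, y x s) (hmem x hx s hs) (x'.1, y x' s)
        (hmem x' hx' s hs) (x.1, y x s) (hmem x hx s hs)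
      simp only [sub_self, zero_sub, norm_zero, zero_mul, add_zero, ← sub_eq_neg_add] at h4
      refine h4.trans ?_
      rw [← mul_add]
      refine mul_le_mul_of_nonneg_left ?_ (by linarith)
      rw [Prod.mk_sub_mk, Prod.norm_mk, add_comm]
      exact (max_le_add_of_nonneg (norm_nonneg _) (norm_nonneg _)).trans
        (add_le_add_left (norm_fst_le (x - x')) _)
  refine ⟨M * C * ((M * C) * (M * C)), by positivity, m, hm0, fun a ha b hb c hc d hd => ?_⟩
  rw [← hy1, ← hy1, ← hy1, ← hy1]
  have hMC : 1 ≤ M * C := one_le_mul_of_one_le_of_one_le hM1 hC1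
  set N := ‖d - b - c + a‖ + ((M * C) * ‖b - a‖) * ((M * C) * ‖c - a‖) with hN
  have := norm_le_exp_of_norm_deriv_le (z := fun s => y d s - y b s - y c s + y a s) (C := C)
    (δ := N) (κ := C * N) hC1 ?_ (by positivity)
    (fun s hs => (((hy d hd s hs).sub (hy b hb s hs)).sub (hy c hc s hs)).add (hy a ha s hs))
    ?_ (s := 1) (by simp)
  · refine this.trans ?_
    have h1 : N ≤ C * N := le_mul_of_one_le_left (by positivity) hC1
    have h2 : N ≤ (M * C) * (M * C) * (‖d - b - c + a‖ + ‖b - a‖ * ‖c - a‖) := by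
      have : ‖d - b - c + a‖ ≤ (M * C) * (M * C) * ‖d - b - c + a‖ :=
        le_mul_of_one_le_left (norm_nonneg _) (one_le_mul_of_one_le_of_one_le hMC hMC)
      rw [hN]
      linarith
    calc Real.exp C * (N + C * N) ≤ Real.exp C * (C * N + C * N) := by gcongr
      _ = M * C * N := by rw [hM]; ring
      _ ≤ M * C * ((M * C) * (M * C) * (‖d - b - c + a‖ + ‖b - a‖ * ‖c - a‖)) := by gcongr
      _ = _ := by ring
  · rw [hy0 a ha, hy0 b hb, hy0 c hc, hy0 d hd]
    refine (norm_snd_le (d - b - c + a)).trans ?_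
    rw [hN]
    have : 0 ≤ ((M * C) * ‖b - a‖) * ((M * C) * ‖c - a‖) := by positivity
    linarith
  · intro s hs
    have h4 := H (a.1, y a s) (hmem a ha s hs) (b.1, y b s) (hmem b hb s hs) (c.1, y c s)
        (hmem c hc s hs) (d.1, y d s) (hmem d hd s hs)
    have fs : ∀ x ∈ Metric.ball (0 : ℝ × E) m, ∀ x' ∈ Metric.ball (0 : ℝ × E) m,
        ‖(x.1, y x s) - (x'.1, y x' s)‖ ≤ M * C * ‖x - x'‖ := by
      intro x hx x' hx'
      rw [Prod.mk_sub_mk, Prod.norm_mk]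
      exact max_le ((norm_fst_le (x - x')).trans (le_mul_of_one_le_left (norm_nonneg _) hMC))
        (lip x hx x' hx' s hs)
    refine h4.trans ?_
    rw [← mul_add]
    refine mul_le_mul_of_nonneg_left ?_ (by linarith)
    have e1 := mul_le_mul (fs b hb a ha) (fs c hc a ha) (norm_nonneg _) (by positivity)
    have e2 : ‖(d.1, y d s) - (b.1, y b s) - (c.1, y c s) + (a.1, y a s)‖ ≤
        ‖y d s - y b s - y c s + y a s‖ + ‖d - b - c + a‖ := by
      rw [Prod.mk_sub_mk, Prod.mk_sub_mk, Prod.mk_add_mk, Prod.norm_mk, add_comm ‖_‖]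
      exact (max_le_add_of_nonneg (norm_nonneg _) (norm_nonneg _)).trans
        (add_le_add_left (norm_fst_le (d - b - c + a)) _)
    rw [hN]
    linarith

theorem exists_isLocalFlow [CompleteSpace E] {r : E → E} (hr : ContDiffAt ℝ 1 r 0) {ρ : ℝ}
    (hρ : 0 < ρ) : ∃ R : ℝ × E → E, ∃ a, IsLocalFlow r R ρ a := by
  obtain ⟨ε, hε, a, r', L, K, hr', hpl⟩ := IsPicardLindelof.of_contDiffAt_one hr
  obtain ⟨α, hα, hcont⟩ := (hpl 0).exists_forall_mem_closedBall_eq_hasDerivWithinAt_continuousOn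
  simp only [zero_sub, zero_add] at hα hcont
  have hr0 : (0 : ℝ) < r' := hr'
  have hc : ContinuousAt α (0, 0) := by
    refine hcont.continuousAt (prod_mem_nhds (Metric.closedBall_mem_nhds _ hr0)
      (Icc_mem_nhds (by linarith) hε))
  have h00 : α (0, 0) = 0 := (hα 0 (by simp)).1
  obtain ⟨s, hs, hs'⟩ := Metric.continuousAt_iff.1 hc ρ hρ
  rw [h00] at hs'
  have hpos : 0 < min s (min r' ε) := by positivity
  have m1 : min s (min (r' : ℝ) ε) ≤ s := min_le_left _ _
  have m2 : min s (min (r' : ℝ) ε) ≤ r' := (min_le_right _ _).trans (min_le_left _ _)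
  have m3 : min s (min (r' : ℝ) ε) ≤ ε := (min_le_right _ _).trans (min_le_right _ _)
  refine ⟨fun x => α (x.2, x.1), min s (min r' ε), hpos, fun u hu => ?_, fun u hu t ht => ?_,
    fun u hu t ht => ?_⟩
  · exact (hα u (Metric.ball_subset_closedBall (Metric.ball_subset_ball m2 hu))).1
  · refine hs' ?_
    rw [dist_eq_norm]
    simp only [Prod.mk_sub_mk, sub_zero, Prod.norm_mk]
    rw [mem_ball_zero_iff] at hu
    exact max_lt (hu.trans_le m1) (ht.trans_le m1)
  · have h1 := (hα u (Metric.ball_subset_closedBall (Metric.ball_subset_ball m2 hu))).2 t ?_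
    · refine h1.hasDerivAt (Icc_mem_nhds ?_ ?_) <;> linarith [abs_lt.1 ht]
    · constructor <;> linarith [abs_lt.1 ht]

end Glimm

/-! ### Smoothness of integrals depending on a parameter -/

namespace Glimm

section Parametric

universe u

variable {P : Type u} [NormedAddCommGroup P]

/-- Compactness of `[0, 1]` makes the bound uniform in `θ`. It is the dominating constant for the
integrals below. -/
theorem eventually_forall_norm_le {F : Type*} [NormedAddCommGroup F] {g : P × ℝ → F} {p : P}
    (hg : ∀ θ ∈ Set.Icc (0 : ℝ) 1, ContinuousAt g (p, θ)) :
    ∃ C, ∀ᶠ q in 𝓝 p, ∀ θ ∈ Set.Icc (0 : ℝ) 1, ‖g (q, θ)‖ ≤ C := by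
  have hc : ContinuousOn (fun θ : ℝ => g (p, θ)) (Set.Icc 0 1) := fun θ hθ =>
    ((hg θ hθ).comp (f := fun θ : ℝ => (p, θ)) (by fun_prop)).continuousWithinAt
  obtain ⟨C, hC⟩ := isCompact_Icc.exists_bound_of_continuousOn hc
  refine ⟨C + 1, isCompact_Icc.eventually_forall_of_forall_eventually fun θ hθ => ?_⟩
  have h1 : ‖g (p, θ)‖ < C + 1 := (hC θ hθ).trans_lt (by linarith)
  exact ((hg θ hθ).norm.eventually_lt continuousAt_const h1).mono fun z hz => hz.le

theorem continuousAt_parametric_integral {F : Type*} [NormedAddCommGroup F] [NormedSpace ℝ F]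
    {g : P × ℝ → F} {p : P} (hg : ∀ θ ∈ Set.Icc (0 : ℝ) 1, ∀ᶠ z in 𝓝 (p, θ), ContinuousAt g z) :
    ContinuousAt (fun q => ∫ θ in (0 : ℝ)..1, g (q, θ)) p := by
  obtain ⟨C, hC⟩ := eventually_forall_norm_le fun θ hθ => (hg θ hθ).self_of_nhds
  have hev : ∀ᶠ q in 𝓝 p, ∀ θ ∈ Set.Icc (0 : ℝ) 1, ContinuousAt g (q, θ) :=
    isCompact_Icc.eventually_forall_of_forall_eventually hg
  have hu : Set.uIoc (0 : ℝ) 1 ⊆ Set.Icc 0 1 := by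
    rw [Set.uIoc_of_le zero_le_one]; exact Set.Ioc_subset_Icc_self
  refine intervalIntegral.continuousAt_of_dominated_interval (bound := fun _ => C) ?_ ?_
    intervalIntegrable_const ?_
  · filter_upwards [hev] with q hq
    refine ContinuousOn.aestronglyMeasurable (fun θ hθ => ?_) measurableSet_uIoc
    exact ((hq θ (hu hθ)).comp (f := fun θ : ℝ => (q, θ)) (by fun_prop)).continuousWithinAt
  · filter_upwards [hC] with q hq
    exact Eventually.of_forall fun θ hθ => hq θ (hu hθ)
  · refine Eventually.of_forall fun θ hθ => ?_
    exact (hg θ (hu hθ)).self_of_nhds.comp (f := fun q : P => (q, θ)) (by fun_prop)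

variable [NormedSpace ℝ P]

theorem hasFDerivAt_parametric_integral {F : Type*} [NormedAddCommGroup F] [NormedSpace ℝ F]
    [CompleteSpace F] {g : P × ℝ → F} {p : P}
    (hg : ∀ θ ∈ Set.Icc (0 : ℝ) 1, ContDiffAt ℝ 1 g (p, θ)) :
    HasFDerivAt (fun q => ∫ θ in (0 : ℝ)..1, g (q, θ))
      (∫ θ in (0 : ℝ)..1, (fderiv ℝ g (p, θ)).comp (.inl ℝ P ℝ)) p := by
  have hu : Set.uIoc (0 : ℝ) 1 ⊆ Set.Icc 0 1 := by
    rw [Set.uIoc_of_le zero_le_one]; exact Set.Ioc_subset_Icc_self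
  have hev : ∀ᶠ q in 𝓝 p, ∀ θ ∈ Set.Icc (0 : ℝ) 1, ContDiffAt ℝ 1 g (q, θ) :=
    isCompact_Icc.eventually_forall_of_forall_eventually fun θ hθ => (hg θ hθ).eventually (by simp)
  set g' : P × ℝ → P →L[ℝ] F := fun z => (fderiv ℝ g z).comp (.inl ℝ P ℝ) with hg'
  have hcont : ∀ z, ContDiffAt ℝ 1 g z → ContinuousAt g' z := by
    intro z hz
    have h1 : ContinuousAt (fderiv ℝ g) z :=
      (hz.fderiv_right (m := 0) (by norm_num)).continuousAt
    exact (h1.clm_comp continuousAt_const)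
  obtain ⟨C, hC⟩ := eventually_forall_norm_le (g := g') fun θ hθ => hcont _ (hg θ hθ)
  obtain ⟨s, hs, hsub⟩ := Metric.eventually_nhds_iff_ball.1 (hev.and hC)
  have hcg : ∀ q ∈ Metric.ball p s, ContinuousOn (fun θ : ℝ => g (q, θ)) (Set.Icc 0 1) := by
    intro q hq θ hθ
    exact (((hsub q hq).1 θ hθ).continuousAt.comp
      (f := fun θ : ℝ => (q, θ)) (by fun_prop)).continuousWithinAt
  have hp := Metric.mem_ball_self (x := p) hs
  refine intervalIntegral.hasFDerivAt_integral_of_dominated_of_fderiv_le (s := Metric.ball p s)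
    (F' := fun q θ => g' (q, θ)) (bound := fun _ => C) (Metric.ball_mem_nhds p hs) ?_ ?_ ?_ ?_
    intervalIntegrable_const ?_
  · filter_upwards [Metric.ball_mem_nhds p hs] with q hq
    exact ((hcg q hq).mono hu).aestronglyMeasurable measurableSet_uIoc
  · refine ContinuousOn.intervalIntegrable ?_
    rw [Set.uIcc_of_le zero_le_one]
    exact hcg p hp
  · refine ContinuousOn.aestronglyMeasurable (fun θ hθ => ?_) measurableSet_uIoc
    exact ((hcont _ (hg θ (hu hθ))).comp (f := fun θ : ℝ => (p, θ))
      (by fun_prop)).continuousWithinAt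
  · exact Eventually.of_forall fun θ hθ q hq => (hsub q hq).2 θ (hu hθ)
  · refine Eventually.of_forall fun θ hθ q hq => ?_
    have h1 := (((hsub q hq).1 θ (hu hθ)).differentiableAt (by norm_num)).hasFDerivAt
    exact h1.comp q (hasFDerivAt_prodMk_left q θ)

/-- Induction on the order, differentiating under the integral sign. Each step replaces `F` by `P
→L[ℝ] F`, which is why `P` and `F` share a universe. -/
theorem contDiffAt_parametric_integral (n : ℕ) {F : Type u} [NormedAddCommGroup F]
    [NormedSpace ℝ F] [CompleteSpace F] {g : P × ℝ → F} {p : P}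
    (hg : ∀ θ ∈ Set.Icc (0 : ℝ) 1, ContDiffAt ℝ n g (p, θ)) :
    ContDiffAt ℝ n (fun q => ∫ θ in (0 : ℝ)..1, g (q, θ)) p := by
  induction n generalizing F g p with
  | zero =>
    have hev : ∀ᶠ q in 𝓝 p, ∀ θ ∈ Set.Icc (0 : ℝ) 1, ContDiffAt ℝ (0 : ℕ) g (q, θ) :=
      isCompact_Icc.eventually_forall_of_forall_eventually fun θ hθ =>
        (hg θ hθ).eventually (by simp)
    refine contDiffAt_zero.2 ⟨_, hev, fun q hq => ContinuousAt.continuousWithinAt ?_⟩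
    refine continuousAt_parametric_integral fun θ hθ => ?_
    exact ((hq θ hθ).eventually (by simp)).mono fun z hz => hz.continuousAt
  | succ n ih =>
    have hev : ∀ᶠ q in 𝓝 p, ∀ θ ∈ Set.Icc (0 : ℝ) 1, ContDiffAt ℝ (n + 1 : ℕ) g (q, θ) :=
      isCompact_Icc.eventually_forall_of_forall_eventually fun θ hθ =>
        (hg θ hθ).eventually (by simp)
    refine contDiffAt_succ_iff_hasFDerivAt.2
      ⟨fun q => ∫ θ in (0 : ℝ)..1, (fderiv ℝ g (q, θ)).comp (.inl ℝ P ℝ),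
        ⟨_, hev, fun q hq => hasFDerivAt_parametric_integral fun θ hθ =>
          (hq θ hθ).of_le (by simp)⟩, ?_⟩
    refine ih (g := fun z => (fderiv ℝ g z).comp (.inl ℝ P ℝ)) fun θ hθ => ?_
    exact ((hg θ hθ).fderiv_right (m := n) (by simp)).clm_comp contDiffAt_const

end Parametric

/-! ### Eigenvectors and Hugoniot curves -/

section Eigen

variable {E : Type*} [NormedAddCommGroup E] [NormedSpace ℝ E] [CompleteSpace E]

/-- The mean of `Df` over the segment with end points `u` and `u + t v`, applied to `v`. -/
noncomputable def meanDeriv (f : E → E) (y : (ℝ × E) × E) : E :=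
  ∫ θ in (0 : ℝ)..1, fderiv ℝ f (y.1.2 + (θ * y.1.1) • y.2) y.2

theorem meanDeriv_zero (f : E → E) (u v : E) : meanDeriv f ((0, u), v) = fderiv ℝ f u v := by
  simp [meanDeriv]

theorem contDiffAt_meanDeriv {f : E → E} (hf : ContDiffAt ℝ 4 f 0) (v : E) :
    ContDiffAt ℝ 3 (meanDeriv f) ((0, 0), v) := by
  refine contDiffAt_parametric_integral 3
    (g := fun z : ((ℝ × E) × E) × ℝ => fderiv ℝ f (z.1.1.2 + (z.2 * z.1.1.1) • z.1.2) z.1.2)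
    fun θ _ => ?_
  have h1 : ContDiffAt ℝ 3 (fderiv ℝ f) 0 := hf.fderiv_right (by norm_num)
  refine ContDiffAt.clm_apply ?_ (by fun_prop)
  refine ContDiffAt.comp (g := fderiv ℝ f) (((0, 0), v), θ) (by simpa using h1) (by fun_prop)

/-- The fundamental theorem of calculus on the chord. It allows division of the Rankine–Hugoniot
condition by `t`, leaving an equation that is still `C³` at `t = 0`. -/
theorem eventually_smul_meanDeriv {f : E → E} (hf : ContDiffAt ℝ 4 f 0) (v : E) :
    ∀ᶠ y in 𝓝 (((0, 0), v) : (ℝ × E) × E),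
      y.1.1 • meanDeriv f y = f (y.1.2 + y.1.1 • y.2) - f y.1.2 := by
  have hev : ∀ᶠ y in 𝓝 (((0, 0), v) : (ℝ × E) × E), ∀ θ ∈ Set.Icc (0 : ℝ) 1,
      ContDiffAt ℝ 4 f (y.1.2 + (θ * y.1.1) • y.2) := by
    refine isCompact_Icc.eventually_forall_of_forall_eventually fun θ _ => ?_
    have : ContinuousAt (fun z : ((ℝ × E) × E) × ℝ => z.1.1.2 + (z.2 * z.1.1.1) • z.1.2)
      (((0, 0), v), θ) := by fun_prop
    refine this.eventually ?_
    simpa using hf.eventually (by simp)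
  filter_upwards [hev] with y hy
  have hd : ∀ θ ∈ Set.uIcc (0 : ℝ) 1, HasDerivAt (fun θ : ℝ => f (y.1.2 + (θ * y.1.1) • y.2))
      (y.1.1 • fderiv ℝ f (y.1.2 + (θ * y.1.1) • y.2) y.2) θ := by
    intro θ hθ
    rw [Set.uIcc_of_le zero_le_one] at hθ
    have h1 := ((hy θ hθ).differentiableAt (by norm_num)).hasFDerivAt
    have h2 : HasDerivAt (fun θ : ℝ => y.1.2 + (θ * y.1.1) • y.2) (y.1.1 • y.2) θ := by
      simpa using (((hasDerivAt_id θ).mul_const y.1.1).smul_const y.2).const_add y.1.2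
    simpa [Function.comp_def] using h1.comp_hasDerivAt θ h2
  have hc : ContinuousOn (fun θ : ℝ => y.1.1 • fderiv ℝ f (y.1.2 + (θ * y.1.1) • y.2) y.2)
      (Set.uIcc 0 1) := by
    intro θ hθ
    rw [Set.uIcc_of_le zero_le_one] at hθ
    have h1 : ContinuousAt (fderiv ℝ f) (y.1.2 + (θ * y.1.1) • y.2) :=
      ((hy θ hθ).fderiv_right (m := 0) (by norm_num)).continuousAt
    have h2 : ContinuousAt (fun θ : ℝ => fderiv ℝ f (y.1.2 + (θ * y.1.1) • y.2)) θ :=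
      h1.comp (f := fun θ : ℝ => y.1.2 + (θ * y.1.1) • y.2) (by fun_prop)
    exact (continuousAt_const.smul (h2.clm_apply continuousAt_const)).continuousWithinAt
  have := intervalIntegral.integral_eq_sub_of_hasDerivAt hd hc.intervalIntegrable
  rw [intervalIntegral.integral_smul] at this
  simpa [meanDeriv] using this

variable [FiniteDimensional ℝ E]

/-- The `C³` families of vectors `v (t, u)` and speeds `s (t, u)` that describe the Hugoniot curve
`t ↦ u + t v (t, u)` issuing from `u`. At `t = 0` they are an eigenvector and an eigenvalue. -/
theorem exists_hugoniot {f : E → E} (hf : ContDiffAt ℝ 4 f 0) {e : E} {lam : ℝ} {l : E →L[ℝ] ℝ}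
    (he : fderiv ℝ f 0 e = lam • e) (hle : l e = 1)
    (hsimple : ∀ x : E, ∀ c : ℝ, fderiv ℝ f 0 x - lam • x = c • e → l x = 0 → x = 0) :
    ∃ (v : ℝ × E → E) (s : ℝ × E → ℝ), ContDiffAt ℝ 3 v 0 ∧ ContDiffAt ℝ 3 s 0 ∧ v 0 = e ∧
      s 0 = lam ∧
      (∀ᶠ x in 𝓝 (0 : ℝ × E), f (x.2 + x.1 • v x) - f x.2 = (x.1 * s x) • v x ∧ l (v x) = 1) ∧
      (∀ᶠ u in 𝓝 (0 : E), fderiv ℝ f u (v (0, u)) = s (0, u) • v (0, u)) ∧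
      ∀ᶠ y in 𝓝 ((0, (e, lam)) : (ℝ × E) × (E × ℝ)), y.1.1 ≠ 0 → l y.2.1 = 1 →
        f (y.1.2 + y.1.1 • y.2.1) - f y.1.2 = (y.1.1 * y.2.2) • y.2.1 → y.2.1 = v y.1 := by
  -- The Rankine–Hugoniot condition divided by `t`, together with the normalization `l v = 1`. At `t
  -- = 0` it is the eigenvalue problem, and its linearization in `(v, s)` is invertible because the
  -- eigenvalue is simple.
  let Φ : (ℝ × E) × (E × ℝ) → E × ℝ := fun y =>
    (meanDeriv f (y.1, y.2.1) - y.2.2 • y.2.1, l y.2.1)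
  have hΦ : ContDiffAt ℝ 3 Φ (0, (e, lam)) := by
    refine ContDiffAt.prodMk ?_ (by fun_prop)
    refine ContDiffAt.sub ?_ (by fun_prop)
    exact ContDiffAt.comp (g := meanDeriv f) (f := fun y : (ℝ × E) × (E × ℝ) => (y.1, y.2.1))
      (0, (e, lam)) (contDiffAt_meanDeriv hf e) (by fun_prop)
  have hΦ0 : Φ (0, (e, lam)) = (0, 1) := by
    have := meanDeriv_zero f 0 e
    simp only [Φ, hle]
    rw [show (0 : ℝ × E) = (0, 0) from rfl, this, he, sub_self]
  have hinv : (fderiv ℝ Φ (0, (e, lam)) ∘L .inr ℝ (ℝ × E) (E × ℝ)).IsInvertible := by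
    have hd1 : HasFDerivAt (fun z : E × ℝ => Φ (0, z))
        (fderiv ℝ Φ (0, (e, lam)) ∘L .inr ℝ (ℝ × E) (E × ℝ)) (e, lam) := by
      have h1 := (hΦ.differentiableAt (by norm_num)).hasFDerivAt
      exact h1.comp (e, lam) (hasFDerivAt_prodMk_right (0 : ℝ × E) (e, lam))
    have hfun : (fun z : E × ℝ => Φ (0, z)) = fun z => (fderiv ℝ f 0 z.1 - z.2 • z.1, l z.1) := by
      funext z
      have := meanDeriv_zero f 0 z.1
      simp only [Φ]
      rw [show (0 : ℝ × E) = (0, 0) from rfl, this]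
    rw [hfun] at hd1
    have hd2 : HasFDerivAt (fun z : E × ℝ => (fderiv ℝ f 0 z.1 - z.2 • z.1, l z.1))
        (((fderiv ℝ f 0).comp (.fst ℝ E ℝ) - (lam • (ContinuousLinearMap.fst ℝ E ℝ) +
          (ContinuousLinearMap.snd ℝ E ℝ).smulRight e)).prod (l.comp (.fst ℝ E ℝ))) (e, lam) := by
      refine HasFDerivAt.prodMk (HasFDerivAt.sub ?_ ?_) ?_
      · exact ((fderiv ℝ f 0).comp (.fst ℝ E ℝ)).hasFDerivAt
      · exact (hasFDerivAt_snd (𝕜 := ℝ) (p := (e, lam))).smul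
          (hasFDerivAt_fst (𝕜 := ℝ) (p := (e, lam)))
      · exact (l.comp (.fst ℝ E ℝ)).hasFDerivAt
    rw [hd1.unique hd2]
    set T := (((fderiv ℝ f 0).comp (.fst ℝ E ℝ) - (lam • (ContinuousLinearMap.fst ℝ E ℝ) +
          (ContinuousLinearMap.snd ℝ E ℝ).smulRight e)).prod (l.comp (.fst ℝ E ℝ))) with hT
    have hinj : Function.Injective (T : (E × ℝ) →ₗ[ℝ] (E × ℝ)) := by
      rw [← LinearMap.ker_eq_bot, LinearMap.ker_eq_bot']
      rintro ⟨x, c⟩ hx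
      simp only [hT, ContinuousLinearMap.coe_coe, ContinuousLinearMap.prod_apply, Prod.mk_eq_zero]
        at hx
      simp at hx
      have h1 : fderiv ℝ f 0 x - lam • x = c • e := by
        have := hx.1
        rw [← sub_sub, sub_eq_zero] at this
        exact this
      have hx0 := hsimple x c h1 hx.2
      subst hx0
      have hce : c • e = 0 := by simpa using h1.symm
      have := congrArg l hce
      simp [hle] at this
      simp [this]
    exact ⟨(LinearEquiv.ofInjectiveEndo _ hinj).toContinuousLinearEquiv, by ext <;> rfl⟩
  have h3 : (3 : WithTop ℕ∞) ≠ 0 := by norm_num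
  set ψ := hΦ.implicitFunction h3 hinv with hψ
  have hψC : ContDiffAt ℝ 3 ψ 0 := hΦ.contDiffAt_implicitFunction h3 hinv
  have hψ0 : ψ 0 = (e, lam) := hΦ.implicitFunction_apply_self h3 hinv
  have hψev := hΦ.eventually_apply_implicitFunction h3 hinv
  have hψiff := hΦ.eventually_apply_eq_iff_implicitFunction h3 hinv
  rw [← hψ, hΦ0] at hψev hψiff
  have hsm := eventually_smul_meanDeriv hf e
  have hcont : ContinuousAt (fun x : ℝ × E => (x, (ψ x).1)) 0 :=
    continuousAt_id.prodMk hψC.continuousAt.fst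
  refine ⟨fun x => (ψ x).1, fun x => (ψ x).2, hψC.fst, hψC.snd, by simp [hψ0], by simp [hψ0],
    ?_, ?_, ?_⟩
  · have h4 : ∀ᶠ x in 𝓝 (0 : ℝ × E), x.1 • meanDeriv f (x, (ψ x).1) =
        f (x.2 + x.1 • (ψ x).1) - f x.2 := by
      refine hcont.eventually (p := fun y => y.1.1 • meanDeriv f y =
        f (y.1.2 + y.1.1 • y.2) - f y.1.2) ?_
      simp only [hψ0]
      exact hsm
    filter_upwards [hψev, h4] with x hx hx4
    simp only [Φ, Prod.mk.injEq] at hx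
    refine ⟨?_, hx.2⟩
    rw [← hx4, sub_eq_zero.1 hx.1, smul_smul]
  · have h5 : ContinuousAt (fun u : E => ((0 : ℝ), u)) 0 := by fun_prop
    filter_upwards [h5.eventually (p := fun x => Φ (x, ψ x) = (0, 1)) hψev] with u hu
    simp only [Φ, Prod.mk.injEq] at hu
    rw [← meanDeriv_zero, sub_eq_zero.1 hu.1]
  · have h6 : ContinuousAt (fun y : (ℝ × E) × (E × ℝ) => (y.1, y.2.1)) (0, (e, lam)) := by fun_prop
    have h7 := h6.eventually (p := fun y => y.1.1 • meanDeriv f y =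
        f (y.1.2 + y.1.1 • y.2) - f y.1.2) hsm
    filter_upwards [hψiff, h7] with y hy hy7 hy1 hy2 hy3
    rw [← hy.1 ?_]
    simp only [Φ, Prod.mk.injEq]
    refine ⟨?_, hy2⟩
    rw [hy3, mul_smul] at hy7
    rw [smul_right_injective E hy1 hy7, sub_self]

end Eigen
end Glimm

/-! ### The characteristic fields near the origin -/

namespace Glimm

section Spectrum

variable {n : ℕ} {A : State n →L[ℝ] State n} {l l' : Fin n → ℝ}

theorem IsSpectrum.exists_basis (h : IsSpectrum A l) {e : Fin n → State n} (he : ∀ j, e j ≠ 0)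
    (hA : ∀ j, A (e j) = l j • e j) :
    ∃ b : Module.Basis (Fin n) ℝ (State n), ⇑b = e := by
  have hli : LinearIndependent ℝ e := by
    refine Module.End.eigenvectors_linearIndependent' (A : State n →ₗ[ℝ] State n) l h.1.injective e
      fun j => ?_
    rw [Module.End.hasEigenvector_iff, Module.End.mem_eigenspace_iff]
    exact ⟨hA j, he j⟩
  exact ⟨Module.Basis.mk hli (hli.span_eq_top_of_card_eq_finrank' (by simp)).ge, by simp⟩

/-- The dual basis of an eigenbasis consists of left eigenvectors. -/
theorem coord_apply_of_eigenbasis {b : Module.Basis (Fin n) ℝ (State n)}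
    (hb : ∀ j, A (b j) = l j • b j) (j : Fin n) (x : State n) :
    b.coord j (A x) = l j * b.coord j x := by
  have : (b.coord j).comp (A : State n →ₗ[ℝ] State n) = l j • b.coord j := by
    refine b.ext fun i => ?_
    simp only [LinearMap.comp_apply, ContinuousLinearMap.coe_coe, hb, map_smul, LinearMap.smul_apply,
      Module.Basis.coord_apply, Module.Basis.repr_self, smul_eq_mul]
    by_cases hij : i = j
    · rw [hij]
    · simp [hij]
  exact congrArg (fun φ => φ x) this

theorem IsSpectrum.exists_eigenbasis (h : IsSpectrum A l) :
    ∃ b : Module.Basis (Fin n) ℝ (State n), ∀ j, A (b j) = l j • b j := by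
  choose e he hA using h.2
  obtain ⟨b, rfl⟩ := h.exists_basis he hA
  exact ⟨b, hA⟩

/-- Some coordinate of an eigenvector is nonzero, so its eigenvalue is in the other list, and
strictly monotone lists with the same range agree. Thus the choice made in `speed` is immaterial. -/
theorem IsSpectrum.unique (h : IsSpectrum A l) (h' : IsSpectrum A l') : l = l' := by
  have key : ∀ {l l' : Fin n → ℝ}, IsSpectrum A l → IsSpectrum A l' →
      Set.range l' ⊆ Set.range l := by
    rintro l l' h h' _ ⟨j, rfl⟩
    obtain ⟨b, hb⟩ := h.exists_eigenbasis
    obtain ⟨v, hv, hAv⟩ := h'.2 j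
    have : ∃ i, b.coord i v ≠ 0 := by
      by_contra hcon
      push Not at hcon
      exact hv (b.forall_coord_eq_zero_iff.1 hcon)
    obtain ⟨i, hi⟩ := this
    have h1 := coord_apply_of_eigenbasis hb i v
    rw [hAv, map_smul, smul_eq_mul] at h1
    exact ⟨i, (mul_right_cancel₀ hi h1).symm⟩
  exact (StrictMono.range_inj h.1 h'.1).1 (Set.Subset.antisymm (key h' h) (key h h'))

theorem IsSpectrum.speed_eq {f : State n → State n} {u : State n} (h : IsSpectrum (fderiv ℝ f u) l)
    (j : Fin n) : speed f j u = l j := by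
  have hex : ∃ l : Fin n → ℝ, IsSpectrum (fderiv ℝ f u) l := ⟨l, h⟩
  rw [speed, dif_pos hex]
  exact congrFun (hex.choose_spec.unique h) j

/-- The eigenspace is a line, since the coordinates belonging to other eigenvalues vanish. The form
`φ` determines the factor. -/
theorem IsSpectrum.eq_smul (h : IsSpectrum A l) {j : Fin n} {x v : State n} {φ : State n →L[ℝ] ℝ}
    (hx : A x = l j • x) (hv : A v = l j • v) (hφ : φ v = 1) : x = φ x • v := by
  obtain ⟨b, hb⟩ := h.exists_eigenbasis
  have key : ∀ y, A y = l j • y → y = b.coord j y • b j := by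
    intro y hy
    have hz : ∀ i, i ≠ j → b.coord i y = 0 := by
      intro i hij
      have h1 := coord_apply_of_eigenbasis hb i y
      rw [hy, map_smul, smul_eq_mul] at h1
      by_contra hne
      exact hij (h.1.injective (mul_right_cancel₀ hne h1).symm)
    conv_lhs => rw [← b.sum_repr y]
    rw [Finset.sum_eq_single j]
    · rfl
    · intro i _ hij
      have := hz i hij
      rw [Module.Basis.coord_apply] at this
      rw [this, zero_smul]
    · simp
  have h1 := key x hx
  have h2 := key v hv
  set c := b.coord j v with hc
  set d := b.coord j x with hd
  have h3 : c * φ (b j) = 1 := by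
    rw [h2, map_smul] at hφ; simpa using hφ
  have h4 : φ x = d * φ (b j) := by rw [h1, map_smul, smul_eq_mul]
  rw [h4, h2, smul_smul, mul_assoc, mul_comm _ c, h3, mul_one, ← h1]

end Spectrum

/-- The properties of one characteristic field near the origin: the eigenvalue `lam`, the
eigenvectors `r`, a linear form `l` normalized by `l (r 0) = 1`, and the directions `v (t, u)` of
the chords of the Hugoniot curve `t ↦ u + t v (t, u)` through `u`. The last property says that a
state connected to `u` by the Rankine–Hugoniot conditions lies on this curve, unless the chord is
far from the direction of `r 0`. -/
structure WaveField {n : ℕ} (f : State n → State n) (lam : State n → ℝ) (r : State n → State n)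
    (l : State n →L[ℝ] ℝ) (v : ℝ × State n → State n) : Prop where
  flux_contDiffAt : ContDiffAt ℝ 4 f 0
  lam_contDiffAt : ContDiffAt ℝ 3 lam 0
  r_contDiffAt : ContDiffAt ℝ 2 r 0
  v_contDiffAt : ContDiffAt ℝ 3 v 0
  l_r : l (r 0) = 1
  eigen : ∀ᶠ u in 𝓝 (0 : State n), fderiv ℝ f u (r u) = lam u • r u
  r_eq : ∀ᶠ u in 𝓝 (0 : State n), r u = l (r u) • v (0, u)
  chord : ∃ κ > 0, κ * ‖r 0‖ < 1 / 2 ∧ ∀ᶠ z in 𝓝 (0 : State n × State n), ∀ s : ℝ, z.2 ≠ z.1 →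
    f z.2 - f z.1 = s • (z.2 - z.1) → |l (z.2 - z.1)| ≤ κ * ‖z.2 - z.1‖ ∨
      (2 * κ * ‖z.2 - z.1‖ ≤ |l (z.2 - z.1)| ∧
        z.2 = z.1 + l (z.2 - z.1) • v (l (z.2 - z.1), z.1))

/-- An approximate eigenvector of a matrix with distinct real eigenvalues is either almost parallel
to the `j`-th eigenvector or has a small `j`-th coordinate. -/
theorem exists_forall_approx_eigenvector {n : ℕ} {A : State n →L[ℝ] State n} {lam : Fin n → ℝ}
    (hlam : Function.Injective lam) {b : Module.Basis (Fin n) ℝ (State n)}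
    (hb : ∀ j, A (b j) = lam j • b j) (j : Fin n) {κ κ' : ℝ} (hκ : 0 < κ) (hκ' : 0 < κ') :
    ∃ η > 0, ∀ (d : State n) (s : ℝ), ‖A d - s • d‖ ≤ η * ‖d‖ → κ * ‖d‖ < |b.coord j d| →
      ‖d - b.coord j d • b j‖ ≤ κ' * |b.coord j d| ∧ |s - lam j| ≤ κ' := by
  obtain ⟨M, hM0, hM⟩ : ∃ M > 0, ∀ i x, |b.coord i x| ≤ M * ‖x‖ := by
    let φ : Fin n → (State n →L[ℝ] ℝ) := fun i => LinearMap.toContinuousLinearMap (b.coord i)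
    refine ⟨∑ i, ‖φ i‖ + 1, by positivity, fun i x => ?_⟩
    have h1 : |b.coord i x| ≤ ‖φ i‖ * ‖x‖ := (φ i).le_opNorm x
    refine h1.trans ?_
    gcongr
    have := Finset.single_le_sum (f := fun i => ‖φ i‖) (fun i _ => norm_nonneg _) (Finset.mem_univ i)
    linarith
  obtain ⟨g, hg0, hg⟩ : ∃ g > 0, ∀ i, i ≠ j → g ≤ |lam i - lam j| := by
    have : ∀ᶠ g in 𝓝[>] (0 : ℝ), ∀ i, i ≠ j → g ≤ |lam i - lam j| := by
      refine eventually_all.2 fun i => ?_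
      by_cases hij : i = j
      · simp [hij]
      · have : 0 < |lam i - lam j| := abs_pos.2 (sub_ne_zero.2 fun h => hij (hlam h))
        filter_upwards [(eventually_le_nhds this).filter_mono nhdsWithin_le_nhds] with g hg _
        exact hg
    obtain ⟨g, h1, h2⟩ := (this.and self_mem_nhdsWithin).exists
    exact ⟨g, h2, h1⟩
  obtain ⟨S, hS0, hS⟩ : ∃ S > 0, ∑ i, ‖b i‖ ≤ S :=
    ⟨∑ i, ‖b i‖ + 1, by positivity, by linarith⟩
  obtain ⟨m, hm0, hm1, hm2⟩ : ∃ m > 0, m ≤ κ' ∧ m ≤ g / 2 :=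
    ⟨min κ' (g / 2), by positivity, min_le_left _ _, min_le_right _ _⟩
  obtain ⟨η, hη0, hη1, hη2⟩ : ∃ η > 0, M * η ≤ m * κ ∧ 2 * M * S * η ≤ κ' * κ * g := by
    refine ⟨min (m * κ / M) (κ' * κ * g / (2 * M * S)), by positivity, ?_, ?_⟩
    · rw [← le_div_iff₀' hM0]; exact min_le_left _ _
    · rw [← le_div_iff₀' (by positivity)]; exact min_le_right _ _
  refine ⟨η, hη0, fun d s hd hj => ?_⟩
  -- In coordinates `A - s` multiplies the `i`-th entry by `lam i - s`. A large `j`-th entry thus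
  -- forces `s` close to `lam j`, and the gap `g` between the eigenvalues then makes the other
  -- entries small.
  have hco : ∀ i, |lam i - s| * |b.coord i d| ≤ M * η * ‖d‖ := by
    intro i
    have h1 : b.coord i (A d - s • d) = (lam i - s) * b.coord i d := by
      rw [map_sub, coord_apply_of_eigenbasis hb, map_smul, smul_eq_mul]; ring
    rw [← abs_mul, ← h1]
    refine (hM i _).trans ?_
    rw [mul_assoc]
    gcongr
  have hd0 : 0 < ‖d‖ := by
    by_contra hcon
    have : d = 0 := by simpa using hcon
    simp [this] at hj
  have hs : |lam j - s| ≤ m := by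
    by_contra hcon
    push Not at hcon
    have h1 := hco j
    have h2 : m * (κ * ‖d‖) < |lam j - s| * |b.coord j d| := by
      apply mul_lt_mul'' hcon hj <;> positivity
    have h3 : M * η * ‖d‖ ≤ m * κ * ‖d‖ := mul_le_mul_of_nonneg_right hη1 hd0.le
    linarith
  refine ⟨?_, by rw [abs_sub_comm]; exact hs.trans hm1⟩
  have hi : ∀ i, i ≠ j → |b.coord i d| * S ≤ κ' * |b.coord j d| := by
    intro i hij
    have h1 := hco i
    have h2 : g / 2 ≤ |lam i - s| := by
      have h3 := hg i hij
      have h4 : |lam i - lam j| ≤ |lam i - s| + |lam j - s| := by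
        rw [abs_sub_comm (lam j) s]; exact abs_sub_le _ _ _
      have h5 := hs.trans hm2
      linarith
    have h3 : g / 2 * |b.coord i d| ≤ M * η * ‖d‖ := by
      refine le_trans ?_ h1
      gcongr
    have h4 : g * (|b.coord i d| * S) ≤ g * (κ' * |b.coord j d|) := by
      calc g * (|b.coord i d| * S) = 2 * S * (g / 2 * |b.coord i d|) := by ring
        _ ≤ 2 * S * (M * η * ‖d‖) := by gcongr
        _ = (2 * M * S * η) * ‖d‖ := by ring
        _ ≤ (κ' * κ * g) * ‖d‖ := by gcongr
        _ = κ' * g * (κ * ‖d‖) := by ring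
        _ ≤ κ' * g * |b.coord j d| := by gcongr
        _ = _ := by ring
    exact le_of_mul_le_mul_left h4 hg0
  have hsum : d - b.coord j d • b j = ∑ i ∈ Finset.univ.erase j, b.coord i d • b i := by
    rw [sub_eq_iff_eq_add, Finset.sum_erase_add _ _ (Finset.mem_univ j)]
    exact (b.sum_repr d).symm
  have hb0 : S * ‖d - b.coord j d • b j‖ ≤ S * (κ' * |b.coord j d|) := by
    rw [hsum]
    calc S * ‖∑ i ∈ Finset.univ.erase j, b.coord i d • b i‖
        ≤ S * ∑ i ∈ Finset.univ.erase j, |b.coord i d| * ‖b i‖ := by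
          gcongr
          refine (norm_sum_le _ _).trans (le_of_eq ?_)
          simp [norm_smul]
      _ = ∑ i ∈ Finset.univ.erase j, (|b.coord i d| * S) * ‖b i‖ := by
          rw [Finset.mul_sum]; refine Finset.sum_congr rfl fun i _ => by ring
      _ ≤ ∑ i ∈ Finset.univ.erase j, (κ' * |b.coord j d|) * ‖b i‖ := by
          refine Finset.sum_le_sum fun i hij => ?_
          have := hi i (Finset.ne_of_mem_erase hij)
          gcongr
      _ ≤ (κ' * |b.coord j d|) * S := by
          rw [← Finset.mul_sum]
          refine mul_le_mul_of_nonneg_left ?_ (by positivity)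
          have := Finset.sum_le_sum_of_subset_of_nonneg (f := fun i => ‖b i‖)
            (Finset.erase_subset j Finset.univ) (fun i _ _ => norm_nonneg _)
          linarith
      _ = _ := by ring
  exact le_of_mul_le_mul_left hb0 hS0

/-- The speeds given by `exists_hugoniot` at `t = 0` stay ordered near the origin, so they are the
eigenvalues, which are therefore `C³`. The `r_j` are multiples of the directions `v_j (0, u)`. A
chord satisfying the Rankine–Hugoniot condition is an approximate eigenvector of `Df(0)`, whence the
dichotomy of `WaveField.chord`. -/
theorem exists_waveField {n : ℕ} (P : System n) (hΩ : IsOpen P.Ω) (h0 : (0 : State n) ∈ P.Ω)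
    (hF : ConditionF P.Ω P.f) (hk : ∀ j, 0 < P.k j) (hr : IsNormalizedFrame P.Ω P.f P.k P.r) :
    ∃ (b : Module.Basis (Fin n) ℝ (State n)) (v : Fin n → ℝ × State n → State n),
      (∀ j, b j = P.r j 0) ∧ ∀ j, WaveField P.f (speed P.f j) (P.r j)
        (LinearMap.toContinuousLinearMap (b.coord j)) (v j) := by
  have hΩ0 : P.Ω ∈ 𝓝 (0 : State n) := hΩ.mem_nhds h0
  have hf : ContDiffAt ℝ 4 P.f 0 := hF.contDiffOn.contDiffAt hΩ0
  obtain ⟨lam, hlam⟩ := hF.strictlyHyperbolic 0 h0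
  have hsp : ∀ j, speed P.f j 0 = lam j := hlam.speed_eq
  have hA : ∀ j, fderiv ℝ P.f 0 (P.r j 0) = lam j • P.r j 0 := fun j => by
    rw [← hsp]; exact hr.eigen j 0 h0
  have hne : ∀ j, P.r j 0 ≠ 0 := by
    intro j hj
    rcases hF.fields j with h | h
    · have := hr.normalized_gnl j h 0 h0
      rw [hj, map_zero] at this
      exact (hk j).ne this
    · have := hr.normalized_ld j h 0 h0
      rw [hj, norm_zero] at this
      exact zero_ne_one this
  obtain ⟨b, hb⟩ := hlam.exists_basis hne hA
  have hbA : ∀ j, fderiv ℝ P.f 0 (b j) = lam j • b j := by rw [hb]; exact hA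
  set φ : Fin n → (State n →L[ℝ] ℝ) := fun j => LinearMap.toContinuousLinearMap (b.coord j) with hφ
  have hφa : ∀ j x, φ j x = b.coord j x := fun j x => rfl
  have hφb : ∀ j, φ j (P.r j 0) = 1 := by
    intro j
    rw [hφa, ← congrFun hb j]
    simp
  have hex := fun j => exists_hugoniot hf (hA j) (hφb j) (fun x c hx hl => by
    refine b.forall_coord_eq_zero_iff.1 fun i => ?_
    by_cases hij : i = j
    · rw [hij]; exact hl
    have h1 := congrArg (b.coord i) hx
    rw [map_sub, coord_apply_of_eigenbasis hbA, map_smul, map_smul, ← congrFun hb j] at h1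
    have h2 : b.coord i (b j) = 0 := by simp [Ne.symm hij]
    rw [h2, smul_zero, smul_eq_mul, ← sub_mul] at h1
    refine (mul_eq_zero.1 h1).resolve_left (sub_ne_zero.2 fun h => hij (hlam.1.injective h)))
  choose v s hv hs hv0 hs0 hugo heig huniq using hex
  have c0 : ContinuousAt (fun u : State n => ((0 : ℝ), u)) 0 := by fun_prop
  have hspec : ∀ᶠ u in 𝓝 (0 : State n), IsSpectrum (fderiv ℝ P.f u) (fun j => s j (0, u)) := by
    have h1 : ∀ᶠ u in 𝓝 (0 : State n), ∀ i j, i < j → s i (0, u) < s j (0, u) := by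
      refine eventually_all.2 fun i => eventually_all.2 fun j => ?_
      by_cases hij : i < j
      · have ci : ContinuousAt (fun u : State n => s i (0, u)) 0 :=
          (hs i).continuousAt.comp_of_eq c0 rfl
        have cj : ContinuousAt (fun u : State n => s j (0, u)) 0 :=
          (hs j).continuousAt.comp_of_eq c0 rfl
        refine (ci.eventually_lt cj ?_).mono fun u hu _ => hu
        have := hlam.1 hij
        rw [← hs0 i, ← hs0 j] at this
        exact this
      · simp [hij]
    have h2 : ∀ᶠ u in 𝓝 (0 : State n), ∀ j, φ j (v j (0, u)) = 1 :=
      eventually_all.2 fun j => (c0.eventually (hugo j)).mono fun u hu => hu.2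
    filter_upwards [h1, h2, eventually_all.2 heig] with u hu1 hu2 hu3
    refine ⟨fun i j hij => hu1 i j hij, fun j => ⟨v j (0, u), fun hz => ?_, hu3 j⟩⟩
    have := hu2 j
    rw [hz, map_zero] at this
    exact zero_ne_one this
  have hspeed : ∀ j, speed P.f j =ᶠ[𝓝 0] fun u => s j (0, u) := fun j =>
    hspec.mono fun u hu => hu.speed_eq j
  have hlamC : ∀ j, ContDiffAt ℝ 3 (speed P.f j) 0 := by
    intro j
    refine ContDiffAt.congr_of_eventuallyEq ?_ (hspeed j)
    exact ContDiffAt.comp (g := s j) (0 : State n) (hs j) (by fun_prop)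
  have hreq : ∀ j, ∀ᶠ u in 𝓝 (0 : State n), P.r j u = φ j (P.r j u) • v j (0, u) := by
    intro j
    filter_upwards [hspec, hspeed j, heig j, c0.eventually (hugo j), hΩ0] with u h1 h2 h3 h4 h5
    refine h1.eq_smul (j := j) ?_ h3 h4.2
    rw [← h2]
    exact hr.eigen j u h5
  have hvC : ∀ j, ContDiffAt ℝ 3 (fun u => v j (0, u)) 0 := fun j =>
    ContDiffAt.comp (g := v j) (0 : State n) (hv j) (by fun_prop)
  have hrC : ∀ j, ContDiffAt ℝ 2 (P.r j) 0 := by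
    intro j
    -- The scalar factor is found from the normalization: `k_j / (Dλ_j v_j)`, only `C²` since it
    -- contains `Dλ_j`, or `‖v_j‖⁻¹`, where continuity of `r_j` at the origin fixes the sign.
    suffices h : ∃ ρ : State n → ℝ, ContDiffAt ℝ 2 ρ 0 ∧ ∀ᶠ u in 𝓝 0, φ j (P.r j u) = ρ u by
      obtain ⟨ρ, hρ, hev⟩ := h
      refine ContDiffAt.congr_of_eventuallyEq (f := fun u => ρ u • v j (0, u))
        (hρ.smul ((hvC j).of_le (by norm_num))) ?_
      filter_upwards [hev, hreq j] with u h1 h2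
      rw [← h1, ← h2]
    rcases hF.fields j with h | h
    · refine ⟨fun u => P.k j / fderiv ℝ (speed P.f j) u (v j (0, u)), ?_, ?_⟩
      · refine ContDiffAt.div contDiffAt_const ?_ ?_
        · exact ((hlamC j).fderiv_right (m := 2) (by norm_num)).clm_apply
            ((hvC j).of_le (by norm_num))
        · have h1 := hr.normalized_gnl j h 0 h0
          have h2 : v j (0, 0) = P.r j 0 := hv0 j
          rw [h2, h1]
          exact (hk j).ne'
      · filter_upwards [hreq j, hΩ0] with u h1 h2
        have h3 := hr.normalized_gnl j h u h2
        rw [h1, map_smul, smul_eq_mul] at h3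
        have h4 : fderiv ℝ (speed P.f j) u (v j (0, u)) ≠ 0 := by
          intro hz
          rw [hz, mul_zero] at h3
          exact (hk j).ne h3
        rw [eq_div_iff h4]
        exact h3
    · refine ⟨fun u => ‖v j (0, u)‖⁻¹, ?_, ?_⟩
      · have h2 : v j (0, 0) ≠ 0 := by
          have : v j (0, 0) = P.r j 0 := hv0 j
          rw [this]; exact hne j
        refine ContDiffAt.inv ?_ (norm_ne_zero_iff.2 h2)
        exact ((hvC j).of_le (by norm_num)).norm ℝ h2
      · have hpos : ∀ᶠ u in 𝓝 (0 : State n), 0 < φ j (P.r j u) := by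
          have hc : ContinuousAt (fun u => φ j (P.r j u)) 0 :=
            (φ j).continuous.continuousAt.comp (hr.continuous_near j).self_of_nhds
          refine hc.eventually (lt_mem_nhds (a := 0) ?_)
          change 0 < φ j (P.r j 0)
          exact (hφb j).symm ▸ one_pos
        filter_upwards [hreq j, hΩ0, hpos] with u h1 h2 h3
        have h4 := hr.normalized_ld j h u h2
        rw [h1, norm_smul, Real.norm_of_nonneg h3.le] at h4
        exact eq_inv_of_mul_eq_one_left h4
  refine ⟨b, v, fun j => congrFun hb j, fun j => ⟨hf, hlamC j, hrC j, hv j, hφb j,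
    ?_, hreq j, ?_⟩⟩
  · filter_upwards [hΩ0] with u hu
    exact hr.eigen j u hu
  · set N := ‖P.r j 0‖ with hN
    have hN0 : 0 ≤ N := norm_nonneg _
    -- In the second alternative `‖d‖ ≤ |t| (N + 1)`, so this `κ` gives `2 κ ‖d‖ ≤ |t|`, and it also
    -- satisfies `κ N < 1 / 2`.
    set κ := 1 / (2 * (N + 1)) with hκ
    have hκ0 : 0 < κ := by positivity
    have hκN : 2 * κ * (N + 1) = 1 := by rw [hκ]; field_simp
    refine ⟨κ, hκ0, by nlinarith, ?_⟩
    obtain ⟨ρ, hρ, huq⟩ := Metric.eventually_nhds_iff_ball.1 (huniq j)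
    obtain ⟨η, hη, happ⟩ := exists_forall_approx_eigenvector hlam.1.injective hbA j hκ0
      (κ' := min (ρ / 2) 1) (by positivity)
    have hstrict : ∀ᶠ z in 𝓝 (0 : State n × State n),
        ‖P.f z.2 - P.f z.1 - fderiv ℝ P.f 0 (z.2 - z.1)‖ ≤ η * ‖z.2 - z.1‖ := by
      have h1 : HasStrictFDerivAt P.f (fderiv ℝ P.f 0) 0 := hf.hasStrictFDerivAt (by norm_num)
      have h2 := h1.isLittleO.def hη
      have h3 : Tendsto (Prod.swap : State n × State n → State n × State n) (𝓝 0) (𝓝 (0, 0)) := by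
        have := (continuous_swap (X := State n) (Y := State n)).tendsto 0
        exact this
      exact h3.eventually h2
    have hsmall : ∀ᶠ z in 𝓝 (0 : State n × State n), |φ j (z.2 - z.1)| < ρ ∧ ‖z.1‖ < ρ := by
      have h1 : ContinuousAt (fun z : State n × State n => |φ j (z.2 - z.1)|) 0 := by fun_prop
      have h2 : ContinuousAt (fun z : State n × State n => ‖z.1‖) 0 := by fun_prop
      exact (h1.eventually (gt_mem_nhds (by simpa using hρ))).and
        (h2.eventually (gt_mem_nhds (by simpa using hρ)))
    filter_upwards [hstrict, hsmall] with z hz hz' σ hne' hRH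
    set d := z.2 - z.1 with hd
    have hd0 : d ≠ 0 := sub_ne_zero.2 hne'
    by_cases hbad : |φ j d| ≤ κ * ‖d‖
    · exact Or.inl hbad
    refine Or.inr ?_
    push Not at hbad
    rw [hRH, ← norm_neg, neg_sub] at hz
    obtain ⟨h1, h2⟩ := happ d σ hz hbad
    change ‖d - φ j d • b j‖ ≤ _ * |φ j d| at h1
    rw [congrFun hb j] at h1
    set t := φ j d with ht
    have ht0 : 0 < |t| := (mul_pos hκ0 (norm_pos_iff.2 hd0)).trans hbad
    have ht1 : t ≠ 0 := abs_pos.1 ht0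
    have h3 : ‖d‖ ≤ |t| * (N + 1) := by
      have e : d = (d - t • P.r j 0) + t • P.r j 0 := by abel
      rw [e]
      refine (norm_add_le _ _).trans ?_
      rw [norm_smul, Real.norm_eq_abs]
      have : min (ρ / 2) 1 * |t| ≤ 1 * |t| := by gcongr; exact min_le_right _ _
      linarith
    refine ⟨?_, ?_⟩
    · calc 2 * κ * ‖d‖ ≤ 2 * κ * (|t| * (N + 1)) := by gcongr
        _ = (2 * κ * (N + 1)) * |t| := by ring
        _ = |t| := by rw [hκN, one_mul]
    · have h4 := huq ((t, z.1), (t⁻¹ • d, σ)) ?_ ht1 ?_ ?_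
      · simp only at h4
        rw [← h4, smul_smul, mul_inv_cancel₀ ht1, one_smul, hd]
        abel
      · rw [Metric.mem_ball, dist_eq_norm]
        simp only [Prod.mk_sub_mk, sub_zero, Prod.norm_mk, max_lt_iff]
        refine ⟨⟨hz'.1, hz'.2⟩, ?_, ?_⟩
        · have e : t⁻¹ • d - P.r j 0 = t⁻¹ • (d - t • P.r j 0) := by
            rw [smul_sub t⁻¹ d, smul_smul, inv_mul_cancel₀ ht1, one_smul]
          rw [e, norm_smul, norm_inv, Real.norm_eq_abs, inv_mul_lt_iff₀ ht0]
          calc _ ≤ _ := h1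
            _ < |t| * ρ := by
              rw [mul_comm]
              refine mul_lt_mul_of_pos_left ?_ ht0
              exact (min_le_left _ _).trans_lt (by linarith)
        · rw [Real.norm_eq_abs]
          exact h2.trans_lt ((min_le_left _ _).trans_lt (by linarith))
      · simp only [map_smul, smul_eq_mul]
        exact inv_mul_cancel₀ ht1
      · simp only [smul_smul]
        rw [mul_inv_cancel₀ ht1, one_smul, mul_right_comm, mul_inv_cancel₀ ht1, one_mul]
        have e : z.1 + d = z.2 := by rw [hd]; abel
        rw [e]
        exact hRH

end Glimm

/-! ### Rarefaction curves and Hugoniot curves -/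

namespace Glimm

section Helpers

variable {E : Type*} [NormedAddCommGroup E]

theorem exists_forall_of_eventually_prod {p : ℝ × E → Prop} (h : ∀ᶠ x in 𝓝 0, p x) :
    ∃ a > 0, ∀ t u, |t| < a → ‖u‖ < a → p (t, u) := by
  obtain ⟨a, ha, H⟩ := Metric.eventually_nhds_iff_ball.1 h
  refine ⟨a, ha, fun t u ht hu => H _ ?_⟩
  rw [mem_ball_zero_iff, Prod.norm_mk]
  exact max_lt ht hu

theorem eventually_prod_of_forall {p : ℝ × E → Prop} {a : ℝ} (ha : 0 < a)
    (h : ∀ t u, |t| < a → ‖u‖ < a → p (t, u)) : ∀ᶠ x in 𝓝 0, p x := by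
  refine Metric.eventually_nhds_iff_ball.2 ⟨a, ha, fun x hx => ?_⟩
  rw [mem_ball_zero_iff, Prod.norm_def] at hx
  exact h x.1 x.2 ((le_max_left _ _).trans_lt hx) ((le_max_right _ _).trans_lt hx)

variable [NormedSpace ℝ E]

/-- The mean value inequality in `t`, uniformly in the initial state. The case `p = 0` yields
tangency to a fixed direction, `p = 1` a quadratic error. -/
theorem eventually_norm_sub_le_of_deriv {φ φ' : ℝ × E → E} {c : E → E} {B : ℝ} (p : ℕ)
    (hd : ∀ᶠ x in 𝓝 (0 : ℝ × E), HasDerivAt (fun t => φ (t, x.2)) (φ' x) x.1)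
    (hb : ∀ᶠ x in 𝓝 (0 : ℝ × E), ‖φ' x - c x.2‖ ≤ B * |x.1| ^ p)
    (h0 : ∀ᶠ u in 𝓝 (0 : E), φ (0, u) = u) :
    ∀ᶠ x in 𝓝 (0 : ℝ × E), ‖φ x - x.2 - x.1 • c x.2‖ ≤ B * |x.1| ^ p * |x.1| := by
  have h0' : ∀ᶠ x in 𝓝 (0 : ℝ × E), φ (0, x.2) = x.2 :=
    (continuous_snd.tendsto (0 : ℝ × E)).eventually h0
  obtain ⟨a, ha, H⟩ := exists_forall_of_eventually_prod (hd.and (hb.and h0'))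
  refine eventually_prod_of_forall ha fun t u ht hu => ?_
  have hsub : ∀ s ∈ Set.uIcc 0 t, |s| ≤ |t| := fun s hs => by
    simpa using Set.abs_sub_left_of_mem_uIcc hs
  have key := (convex_uIcc (0 : ℝ) t).norm_image_sub_le_of_norm_hasDerivWithin_le
    (f := fun s => φ (s, u) - s • c u) (f' := fun s => φ' (s, u) - c u) (C := B * |t| ^ p)
    (fun s hs => ?_) (fun s hs => ?_) Set.left_mem_uIcc Set.right_mem_uIcc
  · have e0 := (H 0 u (by simpa using ha) hu).2.2
    simp only at e0
    simp only [zero_smul, sub_zero, e0, Real.norm_eq_abs] at key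
    convert key using 2
    abel
  · have h1 := (H s u ((hsub s hs).trans_lt ht) hu).1
    have h2 : HasDerivAt (fun s : ℝ => s • c u) (c u) s := by
      simpa using (hasDerivAt_id s).smul_const (c u)
    exact (h1.sub h2).hasDerivWithinAt
  · have h1 := (H s u ((hsub s hs).trans_lt ht) hu).2.1
    refine h1.trans ?_
    have hB : 0 ≤ B ∨ B < 0 := le_or_gt 0 B
    rcases hB with hB | hB
    · exact mul_le_mul_of_nonneg_left (pow_le_pow_left₀ (abs_nonneg _) (hsub s hs) p) hB
    · have h2 : B * |s| ^ p = 0 :=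
        le_antisymm (mul_nonpos_of_nonpos_of_nonneg hB.le (by positivity))
          ((norm_nonneg _).trans h1)
      have h3 := (H t u ht hu).2.1
      have h4 : B * |t| ^ p = 0 :=
        le_antisymm (mul_nonpos_of_nonpos_of_nonneg hB.le (by positivity))
          ((norm_nonneg _).trans h3)
      simp only at h2 h4 ⊢
      rw [h2, h4]

/-- A curve that advances in the direction `l` at a positive rate and stays in a small ball has a
short parameter interval. This is how wave sizes are bounded below. -/
theorem mul_sub_le_of_hasDerivWithinAt {c c' : ℝ → E} {l : E →L[ℝ] ℝ} {a b m : ℝ} (hab : a ≤ b)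
    (hc : ∀ s ∈ Set.Icc a b, HasDerivWithinAt c (c' s) (Set.Icc a b) s)
    (hm : ∀ s ∈ Set.Icc a b, m ≤ l (c' s)) : m * (b - a) ≤ l (c b - c a) := by
  have hd : ∀ s ∈ Set.Icc a b, HasDerivWithinAt (fun s => l (c s)) (l (c' s)) (Set.Icc a b) s :=
    fun s hs => l.hasFDerivAt.comp_hasDerivWithinAt s (hc s hs)
  have hd' : ∀ s ∈ interior (Set.Icc a b), HasDerivAt (fun s => l (c s)) (l (c' s)) s :=
    fun s hs => (hd s (interior_subset hs)).hasDerivAt (mem_interior_iff_mem_nhds.1 hs)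
  rw [map_sub]
  refine (convex_Icc a b).mul_sub_le_image_sub_of_le_deriv
    (fun s hs => (hd s hs).continuousWithinAt)
    (fun s hs => (hd' s hs).differentiableAt.differentiableWithinAt) (fun s hs => ?_)
    a (Set.left_mem_Icc.2 hab) b (Set.right_mem_Icc.2 hab) hab
  rw [(hd' s hs).deriv]
  exact hm s (interior_subset hs)

end Helpers

/-! ### Flows: expansion in time and the semigroup property. -/

section Flow

variable {E : Type*} [NormedAddCommGroup E] [NormedSpace ℝ E]

/-- Near the origin `R` is the flow of `r`, with all the properties needed below. -/
structure IsGoodFlow (r : E → E) (R : ℝ × E → E) : Prop where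
  fourPointAt : FourPointAt R 0
  zero : ∀ᶠ u in 𝓝 (0 : E), R (0, u) = u
  deriv : ∀ᶠ x in 𝓝 (0 : ℝ × E), HasDerivAt (fun t => R (t, x.2)) (r (R x)) x.1
  unique : ∃ ρ > 0, ∀ u ∈ Metric.ball 0 ρ, ∀ σ, |σ| < ρ → ∀ γ : ℝ → E, γ 0 = u →
    (∀ s ∈ Set.uIcc 0 σ, γ s ∈ Metric.ball 0 ρ ∧
      HasDerivWithinAt γ (r (γ s)) (Set.uIcc 0 σ) s) → γ σ = R (σ, u)

theorem exists_isGoodFlow [CompleteSpace E] {r : E → E} (hr : ContDiffAt ℝ 2 r 0) :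
    ∃ R : ℝ × E → E, IsGoodFlow r R := by
  obtain ⟨ρ₀, hρ₀, hfour⟩ := IsLocalFlow.fourPointAt hr
  obtain ⟨K, s, hs, hK⟩ := (hr.of_le (by norm_num : (1 : WithTop ℕ∞) ≤ 2)).exists_lipschitzOnWith
  obtain ⟨ρ₁, hρ₁, hsub⟩ := Metric.mem_nhds_iff.1 hs
  have hρ : 0 < min ρ₀ ρ₁ := by positivity
  obtain ⟨R, a, hR⟩ := exists_isLocalFlow (hr.of_le (by norm_num)) hρ
  have hKρ : LipschitzOnWith K r (Metric.ball 0 (min ρ₀ ρ₁)) :=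
    hK.mono ((Metric.ball_subset_ball (min_le_right _ _)).trans hsub)
  refine ⟨R, hfour _ (min_le_left _ _) R a hR, ?_, ?_, min a (min ρ₀ ρ₁), lt_min hR.pos hρ, ?_⟩
  · filter_upwards [Metric.ball_mem_nhds (0 : E) hR.pos] with u hu
    exact hR.zero u hu
  · exact eventually_prod_of_forall hR.pos fun t u ht hu => hR.deriv u (by simpa using hu) t ht
  · intro u hu σ hσ γ h0 hγ
    have hu' := Metric.ball_subset_ball (min_le_left a (min ρ₀ ρ₁)) hu
    refine integralCurve_unique hKρ (fun s hs => ⟨?_, (hγ s hs).2⟩) (χ := fun t => R (t, u))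
      (fun s hs => ?_) ?_
    · exact Metric.ball_subset_ball (min_le_right _ _) (hγ s hs).1
    · have hs' : |s| < a := by
        have : |s| ≤ |σ| := by simpa using Set.abs_sub_left_of_mem_uIcc hs
        exact this.trans_lt (hσ.trans_le (min_le_left _ _))
      exact ⟨hR.mem u hu' s hs', (hR.deriv u hu' s hs').hasDerivWithinAt⟩
    · rw [h0]; exact (hR.zero u hu').symm

variable {r : E → E} {R : ℝ × E → E}

theorem IsGoodFlow.apply_zero (h : IsGoodFlow r R) : R 0 = 0 := h.zero.self_of_nhds

theorem IsGoodFlow.tendsto (h : IsGoodFlow r R) : Tendsto R (𝓝 0) (𝓝 0) := by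
  have := h.fourPointAt.continuousAt.tendsto
  rwa [h.apply_zero] at this

theorem IsGoodFlow.quadratic (h : IsGoodFlow r R) (hr : ContDiffAt ℝ 1 r 0) :
    ∃ C, ∀ᶠ x in 𝓝 (0 : ℝ × E), ‖R x - x.2 - x.1 • r x.2‖ ≤ C * |x.1| ^ 1 * |x.1| := by
  obtain ⟨K, s, hs, hK⟩ := hr.exists_lipschitzOnWith
  obtain ⟨L, hL, t, ht, hLip⟩ := h.fourPointAt.lipschitz
  refine ⟨K * L, eventually_norm_sub_le_of_deriv 1 h.deriv ?_ h.zero⟩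
  have h1 : ∀ᶠ x in 𝓝 (0 : ℝ × E), R x ∈ s := h.tendsto.eventually hs
  have hsnd : Tendsto (Prod.snd : ℝ × E → E) (𝓝 0) (𝓝 0) := continuous_snd.tendsto (0 : ℝ × E)
  have h2 : ∀ᶠ x in 𝓝 (0 : ℝ × E), x.2 ∈ s := hsnd.eventually hs
  have h3 := hsnd.eventually h.zero
  have h4 : Tendsto (fun x : ℝ × E => ((0 : ℝ), x.2)) (𝓝 0) (𝓝 0) := by
    have : Continuous (fun x : ℝ × E => ((0 : ℝ), x.2)) := by fun_prop
    exact this.tendsto (0 : ℝ × E)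
  filter_upwards [h1, h2, h3, Metric.ball_mem_nhds (0 : ℝ × E) ht,
    h4.eventually (Metric.ball_mem_nhds (0 : ℝ × E) ht)] with x k1 k2 k3 k4 k5
  have e1 := hK.dist_le_mul _ k1 _ k2
  have e2 := hLip x k4 (0, x.2) k5
  rw [k3] at e2
  have e3 : ‖x - (0, x.2)‖ = |x.1| := by
    rw [Prod.norm_def]; simp
  rw [e3] at e2
  rw [dist_eq_norm, dist_eq_norm] at e1
  rw [pow_one, mul_assoc]
  exact e1.trans (by gcongr)

theorem IsGoodFlow.tangent (h : IsGoodFlow r R) (hr : ContinuousAt r 0) {κ : ℝ} (hκ : 0 < κ) :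
    ∀ᶠ x in 𝓝 (0 : ℝ × E), ‖R x - x.2 - x.1 • r 0‖ ≤ κ * |x.1| := by
  have h1 : ∀ᶠ x in 𝓝 (0 : ℝ × E), ‖r (R x) - r 0‖ ≤ κ * |x.1| ^ 0 := by
    have h2 : ∀ᶠ y in 𝓝 (0 : E), ‖r y - r 0‖ ≤ κ := by
      filter_upwards [hr.eventually (Metric.closedBall_mem_nhds _ hκ)] with y hy
      simpa [dist_eq_norm] using hy
    simpa using h.tendsto.eventually h2
  have := eventually_norm_sub_le_of_deriv (c := fun _ => r 0) 0 h.deriv h1 h.zero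
  simpa using this

/-- The translate `s ↦ R (s + t, u)` is an integral curve issuing from `R (t, u)`, so uniqueness
applies. -/
theorem IsGoodFlow.add (h : IsGoodFlow r R) : ∀ᶠ y in 𝓝 (0 : (ℝ × ℝ) × E),
    R (y.1.1, R (y.1.2, y.2)) = R (y.1.1 + y.1.2, y.2) := by
  obtain ⟨ρ, hρ, huniq⟩ := h.unique
  have hmem : ∀ᶠ x in 𝓝 (0 : ℝ × E), R x ∈ Metric.ball 0 ρ :=
    h.tendsto.eventually (Metric.ball_mem_nhds 0 hρ)
  obtain ⟨a, ha, H⟩ := exists_forall_of_eventually_prod (h.deriv.and hmem)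
  refine Metric.eventually_nhds_iff_ball.2 ⟨min (a / 2) (ρ / 2), by positivity, fun y hy => ?_⟩
  rw [mem_ball_zero_iff, Prod.norm_def, max_lt_iff, Prod.norm_def, max_lt_iff] at hy
  obtain ⟨⟨h1, h2⟩, h3⟩ := hy
  rw [Real.norm_eq_abs] at h1 h2
  have m1 : min (a / 2) (ρ / 2) ≤ a / 2 := min_le_left _ _
  have m2 : min (a / 2) (ρ / 2) ≤ ρ / 2 := min_le_right _ _
  refine (huniq (R (y.1.2, y.2)) (H _ _ (by linarith) (by linarith)).2 y.1.1 (by linarith)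
    (fun s => R (s + y.1.2, y.2)) (by simp) fun s hs => ?_).symm
  have hs' : |s| ≤ |y.1.1| := by simpa using Set.abs_sub_left_of_mem_uIcc hs
  have hlt : |s + y.1.2| < a := (abs_add_le _ _).trans_lt (by linarith)
  have h4 := H (s + y.1.2) y.2 hlt (by linarith)
  refine ⟨h4.2, ?_⟩
  have h5 := h4.1.comp_add_const s y.1.2
  exact h5.hasDerivWithinAt

end Flow

/-! ### Identification of the curves that stay in a small ball. -/

section Field

variable {n : ℕ} {f : State n → State n} {lam : State n → ℝ} {r : State n → State n}
  {l : State n →L[ℝ] ℝ} {v : ℝ × State n → State n}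

theorem WaveField.eventually_l_r (W : WaveField f lam r l v) {m : ℝ} (hm : m < 1) :
    ∀ᶠ u in 𝓝 (0 : State n), m ≤ l (r u) := by
  have hc : ContinuousAt (fun u => l (r u)) 0 :=
    l.continuous.continuousAt.comp W.r_contDiffAt.continuousAt
  have := hc.eventually (lt_mem_nhds (a := m) (by simpa [W.l_r] using hm))
  exact this.mono fun u hu => hu.le

/-- The integral curves of `r` in a small ball are short, and they are given by the flow. -/
theorem WaveField.rarefaction_unique (W : WaveField f lam r l v) {R : ℝ × State n → State n}
    (hR : IsGoodFlow r R) {κ : ℝ} (hκ : 0 < κ) :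
    ∃ ε₀ > 0, ∀ (γ : ℝ → State n) (σ : ℝ), 0 ≤ σ →
      (∀ s ∈ Set.Icc 0 σ, γ s ∈ Metric.ball 0 ε₀ ∧
        HasDerivWithinAt γ (r (γ s)) (Set.Icc 0 σ) s) → σ < κ ∧ γ σ = R (σ, γ 0) := by
  obtain ⟨ρ, hρ, huniq⟩ := hR.unique
  obtain ⟨t, ht, hl⟩ := Metric.eventually_nhds_iff_ball.1 (W.eventually_l_r (m := 1 / 2) (by norm_num))
  -- Along the curve `l` grows at rate at least `1 / 2`, so `σ / 2 ≤ 2 ‖l‖ δ`, which gives `σ < min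
  -- κ ρ`.
  set δ := min κ ρ / (8 * (‖l‖ + 1)) with hδ
  have hδ0 : 0 < δ := by positivity
  refine ⟨min (min ρ t) δ, by positivity, fun γ σ hσ hγ => ?_⟩
  have b1 := Metric.ball_subset_ball (x := (0 : State n))
    ((min_le_left (min ρ t) δ).trans (min_le_left _ _))
  have b2 := Metric.ball_subset_ball (x := (0 : State n))
    ((min_le_left (min ρ t) δ).trans (min_le_right _ _))
  have b3 := Metric.ball_subset_ball (x := (0 : State n)) (min_le_right (min ρ t) δ)
  have h1 := mul_sub_le_of_hasDerivWithinAt (l := l) hσ (fun s hs => (hγ s hs).2)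
    (fun s hs => hl _ (b2 (hγ s hs).1))
  have h2 : l (γ σ - γ 0) ≤ ‖l‖ * (δ + δ) := by
    refine (le_abs_self _).trans ((l.le_opNorm _).trans ?_)
    have k1 := b3 (hγ σ (Set.right_mem_Icc.2 hσ)).1
    have k2 := b3 (hγ 0 (Set.left_mem_Icc.2 hσ)).1
    rw [mem_ball_zero_iff] at k1 k2
    gcongr
    exact (norm_sub_le _ _).trans (add_le_add k1.le k2.le)
  have h3 : (‖l‖ + 1) * δ = min κ ρ / 8 := by rw [hδ]; field_simp
  have h4 : σ < min κ ρ := by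
    have : 0 < min κ ρ := by positivity
    nlinarith
  refine ⟨h4.trans_le (min_le_left _ _), huniq (γ 0) (b1 (hγ 0 (Set.left_mem_Icc.2 hσ)).1) σ ?_ γ
    rfl fun s hs => ?_⟩
  · rw [abs_of_nonneg hσ]
    exact h4.trans_le (min_le_right _ _)
  · rw [Set.uIcc_of_le hσ] at hs ⊢
    exact ⟨b1 (hγ s hs).1, (hγ s hs).2⟩

/-- A curve of states satisfying the Rankine–Hugoniot conditions with `u` and exiting `u` in the
direction of `r u` follows the Hugoniot curve, as long as it does not return to `u`. -/
theorem WaveField.eq_hugoniot (W : WaveField f lam r l v) :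
    ∃ ε₀ > 0, ∀ (c : ℝ → State n) (τ₁ : ℝ), τ₁ < 0 →
      HasDerivWithinAt c (r (c 0)) (Set.Icc τ₁ 0) 0 →
      (∀ τ ∈ Set.Icc τ₁ 0, c τ ∈ Metric.ball 0 ε₀ ∧ ContinuousWithinAt c (Set.Icc τ₁ 0) τ ∧
        ∃ s : ℝ, f (c τ) - f (c 0) = s • (c τ - c 0)) →
      (∀ τ ∈ Set.Ico τ₁ 0, c τ ≠ c 0) →
      ∀ τ ∈ Set.Icc τ₁ 0, c τ = c 0 + l (c τ - c 0) • v (l (c τ - c 0), c 0) := by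
  obtain ⟨κ, hκ, hκr, hch⟩ := W.chord
  obtain ⟨ρ, hρ, hch⟩ := Metric.eventually_nhds_iff_ball.1 hch
  have hdir : ∀ᶠ u in 𝓝 (0 : State n), 3 / 2 * κ * ‖r u‖ < l (r u) := by
    have c1 : ContinuousAt (fun u => 3 / 2 * κ * ‖r u‖) 0 :=
      continuousAt_const.mul W.r_contDiffAt.continuousAt.norm
    have c2 : ContinuousAt (fun u => l (r u)) 0 :=
      l.continuous.continuousAt.comp W.r_contDiffAt.continuousAt
    refine c1.eventually_lt c2 ?_
    simp only [W.l_r]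
    linarith
  obtain ⟨t, ht, hdir⟩ := Metric.eventually_nhds_iff_ball.1 hdir
  refine ⟨min ρ t, by positivity, fun c τ₁ hτ₁ hd hc hne τ hτ => ?_⟩
  rcases eq_or_lt_of_le hτ.2 with h0 | hτ0
  · subst h0; simp
  have b1 := Metric.ball_subset_ball (x := (0 : State n)) (min_le_left ρ t)
  have b2 := Metric.ball_subset_ball (x := (0 : State n)) (min_le_right ρ t)
  have h0mem : (0 : ℝ) ∈ Set.Icc τ₁ 0 := Set.right_mem_Icc.2 hτ₁.le
  -- The factor `3 / 2` lies strictly between the factors `1` and `2` of the two alternatives for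
  -- chords. Hence `φ` does not vanish while the curve is away from `c 0`, and by the intermediate
  -- value theorem the curve cannot pass from one alternative to the other.
  let φ : ℝ → ℝ := fun τ => |l (c τ - c 0)| - 3 / 2 * κ * ‖c τ - c 0‖
  have dich : ∀ τ ∈ Set.Ico τ₁ 0, φ τ < 0 ∨ (0 < φ τ ∧
      c τ = c 0 + l (c τ - c 0) • v (l (c τ - c 0), c 0)) := by
    intro τ hτ
    have hτ' := Set.Ico_subset_Icc_self hτ
    obtain ⟨s, hs⟩ := (hc τ hτ').2.2
    have hmem : (c 0, c τ) ∈ Metric.ball (0 : State n × State n) ρ := by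
      rw [mem_ball_zero_iff, Prod.norm_mk]
      exact max_lt (by simpa using b1 (hc 0 h0mem).1) (by simpa using b1 (hc τ hτ').1)
    have hpos : 0 < κ * ‖c τ - c 0‖ := mul_pos hκ (norm_pos_iff.2 (sub_ne_zero.2 (hne τ hτ)))
    rcases hch _ hmem s (hne τ hτ) hs with h | h
    · left
      simp only [φ] at *
      linarith
    · right
      refine ⟨?_, h.2⟩
      simp only [φ]
      have := h.1
      simp only at this
      linarith
  have hφc : ∀ τ ∈ Set.Icc τ₁ 0, ContinuousWithinAt φ (Set.Icc τ₁ 0) τ := by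
    intro τ hτ
    have h1 : ContinuousWithinAt (fun τ => c τ - c 0) (Set.Icc τ₁ 0) τ :=
      (hc τ hτ).2.1.sub continuousWithinAt_const
    exact (l.continuous.continuousAt.comp_continuousWithinAt h1).abs.sub
      (continuousWithinAt_const.mul h1.norm)
  rcases dich τ ⟨hτ.1, hτ0⟩ with hneg | h
  swap
  · exact h.2
  exfalso
  -- close to `0` the function `φ` is positive
  have hnear : ∃ τ' ∈ Set.Ioo τ 0, 0 < φ τ' := by
    have hslope := hasDerivWithinAt_iff_tendsto_slope.1 hd
    have h1 : Tendsto (fun τ => |l (slope c 0 τ)| - 3 / 2 * κ * ‖slope c 0 τ‖)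
        (𝓝[Set.Icc τ₁ 0 \ {0}] 0) (𝓝 (|l (r (c 0))| - 3 / 2 * κ * ‖r (c 0)‖)) :=
      ((l.continuous.tendsto _).comp hslope).abs.sub (hslope.norm.const_mul _)
    have h2 : 0 < |l (r (c 0))| - 3 / 2 * κ * ‖r (c 0)‖ := by
      have := hdir (c 0) (b2 (hc 0 h0mem).1)
      have := le_abs_self (l (r (c 0)))
      linarith
    have h3 := h1.eventually (lt_mem_nhds h2)
    have h4 : 𝓝[Set.Ioo τ 0] (0 : ℝ) ≤ 𝓝[Set.Icc τ₁ 0 \ {0}] 0 := by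
      refine nhdsWithin_mono _ fun s hs => ⟨⟨hτ.1.trans hs.1.le, hs.2.le⟩, ?_⟩
      simpa using hs.2.ne
    have h5 : (𝓝[Set.Ioo τ 0] (0 : ℝ)).NeBot := by
      rw [nhdsWithin_Ioo_eq_nhdsLT hτ0]; infer_instance
    obtain ⟨s, hs, hs'⟩ := ((h3.filter_mono h4).and self_mem_nhdsWithin).exists
    refine ⟨s, hs', ?_⟩
    have h6 : c s - c 0 = s • slope c 0 s := by
      rw [slope_def_module, sub_zero, smul_smul, mul_inv_cancel₀ hs'.2.ne, one_smul]
    simp only [φ]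
    rw [h6, map_smul, norm_smul, smul_eq_mul, abs_mul, Real.norm_eq_abs]
    have h7 : 0 < |s| := abs_pos.2 hs'.2.ne
    have h8 := mul_pos h7 hs
    linarith
  obtain ⟨τ', hτ', hpos⟩ := hnear
  have hsub : Set.Icc τ τ' ⊆ Set.Icc τ₁ 0 := Set.Icc_subset_Icc hτ.1 hτ'.2.le
  have hivt := intermediate_value_Icc hτ'.1.le (f := φ) fun s hs =>
    (hφc s (hsub hs)).mono hsub
  obtain ⟨s, hs, hs0⟩ := hivt ⟨hneg.le, hpos.le⟩
  rcases dich s ⟨(hsub hs).1, hs.2.trans_lt hτ'.2⟩ with h | h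
  · exact h.ne hs0
  · exact h.1.ne' hs0

end Field

end Glimm

/-! ### Lax curves -/

namespace Glimm

section Shock

variable {n : ℕ} {f : State n → State n} {lam : State n → ℝ} {r : State n → State n}
  {l : State n →L[ℝ] ℝ} {v : ℝ × State n → State n}

/-- The Hugoniot curve `t ↦ u + t v (t, u)`. -/
def hugoniotMap (v : ℝ × State n → State n) (x : ℝ × State n) : State n := x.2 + x.1 • v x

theorem WaveField.v_zero (W : WaveField f lam r l v) : v 0 = r 0 := by
  have := W.r_eq.self_of_nhds
  rw [W.l_r, one_smul] at this
  exact this.symm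

theorem WaveField.contDiffAt_hugoniotMap (W : WaveField f lam r l v) :
    ContDiffAt ℝ 3 (hugoniotMap v) 0 :=
  contDiffAt_snd.add (contDiffAt_fst.smul W.v_contDiffAt)

theorem hugoniotMap_zero (u : State n) : hugoniotMap v (0, u) = u := by simp [hugoniotMap]

theorem WaveField.hasFDerivAt_hugoniotMap (W : WaveField f lam r l v) :
    HasFDerivAt (hugoniotMap v) (.snd ℝ ℝ (State n) +
      (ContinuousLinearMap.fst ℝ ℝ (State n)).smulRight (r 0)) 0 := by
  have h1 := (W.v_contDiffAt.differentiableAt (by norm_num)).hasFDerivAt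
  have h2 := (hasFDerivAt_snd (𝕜 := ℝ) (p := (0 : ℝ × State n))).add
    ((hasFDerivAt_fst (𝕜 := ℝ) (p := (0 : ℝ × State n))).smul h1)
  refine h2.congr_fderiv ?_
  simp [W.v_zero]

/-- In a genuinely nonlinear field, `S (σ, u)` is the Hugoniot curve through `u`, parametrized in
such a way that the eigenvalue increases at the rate `k`. -/
theorem WaveField.exists_shockCurve (W : WaveField f lam r l v) {k : ℝ} (hk : 0 < k)
    (hlam : ∀ᶠ u in 𝓝 (0 : State n), fderiv ℝ lam u (r u) = k) :
    ∃ S : ℝ × State n → State n, ContDiffAt ℝ 2 S 0 ∧ (∀ᶠ u in 𝓝 0, S (0, u) = u) ∧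
      (∀ᶠ u in 𝓝 (0 : State n), fderiv ℝ S (0, u) (1, 0) = r u) ∧
      (∀ᶠ x in 𝓝 (0 : ℝ × State n),
        hugoniotMap v x = S ((lam (hugoniotMap v x) - lam x.2) / k, x.2)) := by
  have hH := W.contDiffAt_hugoniotMap
  have hH0 : hugoniotMap v 0 = 0 := hugoniotMap_zero 0
  -- The change of parameter from chord coordinate to normalized increment of the eigenvalue. Its
  -- derivative at the origin is the identity because `Dλ r = k`.
  let Θ : ℝ × State n → ℝ × State n := fun x => ((lam (hugoniotMap v x) - lam x.2) / k, x.2)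
  have hlamH : ContDiffAt ℝ 3 (fun x => lam (hugoniotMap v x)) 0 :=
    ContDiffAt.comp (g := lam) (0 : ℝ × State n) (by rw [hH0]; exact W.lam_contDiffAt) hH
  have hΘ : ContDiffAt ℝ 3 Θ 0 := by
    refine ContDiffAt.prodMk ((hlamH.sub ?_).div_const k) contDiffAt_snd
    exact ContDiffAt.comp (g := lam) (0 : ℝ × State n) W.lam_contDiffAt contDiffAt_snd
  have hΘ0 : ∀ u, Θ (0, u) = (0, u) := fun u => by simp [Θ, hugoniotMap_zero]
  have hd : HasFDerivAt Θ
      ((ContinuousLinearEquiv.refl ℝ (ℝ × State n) : ℝ × State n →L[ℝ] ℝ × State n)) 0 := by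
    have hl := (W.lam_contDiffAt.differentiableAt (by norm_num)).hasFDerivAt
    have h1 : HasFDerivAt (fun x => lam (hugoniotMap v x)) _ (0 : ℝ × State n) :=
      HasFDerivAt.comp (g := lam) (0 : ℝ × State n) (by rw [hH0]; exact hl)
        W.hasFDerivAt_hugoniotMap
    have h2 : HasFDerivAt (fun x : ℝ × State n => lam x.2) _ (0 : ℝ × State n) :=
      HasFDerivAt.comp (g := lam) (f := Prod.snd) (0 : ℝ × State n) hl
        (hasFDerivAt_snd (𝕜 := ℝ) (p := (0 : ℝ × State n)))
    have h3 := ((h1.sub h2).mul_const k⁻¹).prodMk (hasFDerivAt_snd (𝕜 := ℝ) (p := (0 : ℝ × State n)))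
    have h4 := hlam.self_of_nhds
    refine (h3.congr_fderiv ?_).congr_of_eventuallyEq (Eventually.of_forall fun x => ?_)
    · ext
      · simp [h4, hk.ne']
      · simp
      · simp
      · simp
    · simp [Θ, div_eq_mul_inv]
  have h3 : (3 : WithTop ℕ∞) ≠ 0 := by norm_num
  have hst : HasStrictFDerivAt Θ
      ((ContinuousLinearEquiv.refl ℝ (ℝ × State n) : ℝ × State n →L[ℝ] ℝ × State n)) 0 :=
    hΘ.hasStrictFDerivAt' hd h3
  have hz : Θ 0 = 0 := hΘ0 0
  set G := hst.localInverse Θ (ContinuousLinearEquiv.refl ℝ (ℝ × State n)) 0 with hG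
  have hGC : ContDiffAt ℝ 3 G 0 := by
    have := ContDiffAt.to_localInverse hΘ hd h3
    rw [hz] at this
    exact this
  have hG0 : G 0 = 0 := by
    have := hst.localInverse_apply_image
    rwa [hz] at this
  have hright : ∀ᶠ y in 𝓝 (0 : ℝ × State n), Θ (G y) = y := by
    have := hst.eventually_right_inverse
    rwa [hz] at this
  have hleft : ∀ᶠ x in 𝓝 (0 : ℝ × State n), G (Θ x) = x := hst.eventually_left_inverse
  have hGu : ∀ᶠ u in 𝓝 (0 : State n), G (0, u) = (0, u) := by
    have c0 : ContinuousAt (fun u : State n => ((0 : ℝ), u)) 0 := by fun_prop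
    filter_upwards [c0.eventually hleft] with u hu
    rwa [hΘ0] at hu
  have hSC : ContDiffAt ℝ 3 (fun y => hugoniotMap v (G y)) 0 :=
    ContDiffAt.comp (g := hugoniotMap v) (0 : ℝ × State n) (by rwa [hG0]) hGC
  have hSlam : ∀ᶠ x in 𝓝 (0 : ℝ × State n), lam (hugoniotMap v (G x)) = lam x.2 + k * x.1 := by
    filter_upwards [hright] with y hy
    have e1 := congrArg Prod.fst hy
    have e2 := congrArg Prod.snd hy
    simp only [Θ] at e1 e2
    rw [div_eq_iff hk.ne', e2] at e1
    linarith
  refine ⟨fun y => hugoniotMap v (G y), hSC.of_le (by norm_num), ?_, ?_, ?_⟩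
  · filter_upwards [hGu] with u hu
    rw [hu, hugoniotMap_zero]
  · have c0 : ContinuousAt (fun u : State n => ((0 : ℝ), u)) 0 := by fun_prop
    have hdiffG : ∀ᶠ u in 𝓝 (0 : State n), ContDiffAt ℝ 3 G (0, u) :=
      c0.eventually (hGC.eventually (by simp))
    have hdiffv : ∀ᶠ u in 𝓝 (0 : State n), ContDiffAt ℝ 3 v (0, u) :=
      c0.eventually (W.v_contDiffAt.eventually (by simp))
    have hdiffS : ∀ᶠ u in 𝓝 (0 : State n), ContDiffAt ℝ 3 (fun y => hugoniotMap v (G y)) (0, u) :=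
      c0.eventually (hSC.eventually (by simp))
    have hdifflam : ∀ᶠ u in 𝓝 (0 : State n), ContDiffAt ℝ 3 lam u :=
      W.lam_contDiffAt.eventually (by simp)
    have hSlam' : ∀ᶠ u in 𝓝 (0 : State n), ∀ᶠ x in 𝓝 ((0 : ℝ), u),
        lam (hugoniotMap v (G x)) = lam x.2 + k * x.1 := c0.eventually hSlam.eventually_nhds
    have hright' : ∀ᶠ u in 𝓝 (0 : State n), ∀ᶠ y in 𝓝 ((0 : ℝ), u), Θ (G y) = y :=
      c0.eventually hright.eventually_nhds
    filter_upwards [hdiffG, hdiffv, hdiffS, hdifflam, hSlam', hright', hGu, hlam, W.r_eq]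
      with u kG kv kS kl kSl kr kGu klam kreq
    have hline : HasDerivAt (fun σ : ℝ => (σ, u)) ((1 : ℝ), (0 : State n)) 0 :=
      (hasDerivAt_id (0 : ℝ)).prodMk (hasDerivAt_const (0 : ℝ) u)
    -- the derivative of the curve is a multiple of `v (0, u)`
    have hT : HasDerivAt (fun σ : ℝ => (G (σ, u))) (fderiv ℝ G (0, u) (1, 0)) 0 :=
      ((kG.differentiableAt (by norm_num)).hasFDerivAt).comp_hasDerivAt (0 : ℝ) hline
    have hS1 : HasDerivAt (fun σ : ℝ => hugoniotMap v (G (σ, u)))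
        (fderiv ℝ (fun y => hugoniotMap v (G y)) (0, u) (1, 0)) 0 :=
      HasFDerivAt.comp_hasDerivAt (l := fun y => hugoniotMap v (G y)) (0 : ℝ)
        (kS.differentiableAt (by norm_num)).hasFDerivAt hline
    have hvG : DifferentiableAt ℝ (fun σ : ℝ => v (G (σ, u))) 0 := by
      refine DifferentiableAt.comp (g := v) (0 : ℝ) ?_ hT.differentiableAt
      rw [kGu]
      exact kv.differentiableAt (by norm_num)
    have hS2 : HasDerivAt (fun σ : ℝ => hugoniotMap v (G (σ, u)))
        ((fderiv ℝ G (0, u) (1, 0)).1 • v (0, u)) 0 := by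
      have h4 : HasDerivAt (fun σ : ℝ => (G (σ, u)).1) (fderiv ℝ G (0, u) (1, 0)).1 0 :=
        (ContinuousLinearMap.fst ℝ ℝ (State n)).hasFDerivAt.comp_hasDerivAt (0 : ℝ) hT
      have h5 := h4.smul hvG.hasDerivAt
      have h6 := h5.const_add u
      simp only [kGu, zero_smul, zero_add] at h6
      refine h6.congr_of_eventuallyEq ?_
      filter_upwards [hline.continuousAt.eventually kr] with σ hσ
      have e2 := congrArg Prod.snd hσ
      simp only [Θ] at e2
      simp only [hugoniotMap, e2, Pi.smul_apply']
    have hlamd : HasDerivAt (fun σ : ℝ => lam (hugoniotMap v (G (σ, u))))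
        (fderiv ℝ lam u ((fderiv ℝ G (0, u) (1, 0)).1 • v (0, u))) 0 := by
      have e : hugoniotMap v (G (0, u)) = u := by rw [kGu, hugoniotMap_zero]
      have := (kl.differentiableAt (by norm_num)).hasFDerivAt
      exact HasFDerivAt.comp_hasDerivAt (l := lam) (0 : ℝ) (by rw [e]; exact this) hS2
    have hlamd' : HasDerivAt (fun σ : ℝ => lam (hugoniotMap v (G (σ, u)))) k 0 := by
      have h7 : HasDerivAt (fun σ : ℝ => lam u + k * σ) k 0 := by
        simpa using ((hasDerivAt_id (0 : ℝ)).const_mul k).const_add (lam u)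
      refine h7.congr_of_eventuallyEq ?_
      filter_upwards [hline.continuousAt.eventually kSl] with σ hσ
      exact hσ
    -- The tangent is a multiple of `v (0, u)`, and so is `r u`. Both make the eigenvalue grow at
    -- the rate `k`, so the factors agree.
    have h8 := hlamd.unique hlamd'
    rw [map_smul, smul_eq_mul] at h8
    have h9 := klam
    rw [kreq, map_smul, smul_eq_mul] at h9
    have h10 : fderiv ℝ lam u (v (0, u)) ≠ 0 := by
      intro hzero
      rw [hzero, mul_zero] at h9
      exact hk.ne h9
    rw [hS1.unique hS2, mul_right_cancel₀ h10 (h8.trans h9.symm), ← kreq]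
  · filter_upwards [hleft] with x hx
    change hugoniotMap v x = hugoniotMap v (G (Θ x))
    rw [hx]

end Shock

/-- Near the origin, the `j`-th Lax curve is `σ ↦ ψ (σ, u)`, and its tangent at the origin is `e`. -/
structure LaxCurve {n : ℕ} (P : System n) (j : Fin n) (ψ : ℝ × State n → State n)
    (e : State n) : Prop where
  fourPointAt : FourPointAt ψ 0
  zero : ∀ᶠ u in 𝓝 (0 : State n), ψ (0, u) = u
  tangent : ∀ κ > 0, ∀ᶠ x in 𝓝 (0 : ℝ × State n), ‖ψ x - x.2 - x.1 • e‖ ≤ κ * |x.1|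
  unique : ∀ κ > 0, ∃ ε₀ > 0, ∀ ε ≤ ε₀, ∀ σ u w, P.Lax ε j σ u w → |σ| < κ ∧ w = ψ (σ, u)
  add : ∀ᶠ y in 𝓝 (0 : (ℝ × ℝ) × State n),
    (¬ GenuinelyNonlinear P.Ω P.f j ∨ (0 ≤ y.1.1 ∧ 0 ≤ y.1.2)) →
      ψ (y.1.1, ψ (y.1.2, y.2)) = ψ (y.1.1 + y.1.2, y.2)

/-! ### Lax curves of genuinely nonlinear fields. -/

section LaxCurve

variable {n : ℕ} {P : System n} {j : Fin n} {l : State n →L[ℝ] ℝ} {v : ℝ × State n → State n}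
  {R : ℝ × State n → State n}

/-- The shock branch `S` and the rarefaction branch `R` both leave `u` with velocity `r u`, so `S -
R = O(σ²)`, and `ψ` is `R` plus this difference cut off at `σ = 0`, which `FourPointAt.comp_min`
controls. -/
theorem exists_laxCurve_gnl (W : WaveField P.f (speed P.f j) (P.r j) l v) (hΩ : P.Ω ∈ 𝓝 0)
    (hg : GenuinelyNonlinear P.Ω P.f j) (hk : 0 < P.k j)
    (hlam : ∀ u ∈ P.Ω, fderiv ℝ (speed P.f j) u (P.r j u) = P.k j) :
    ∃ ψ, LaxCurve P j ψ (P.r j 0) := by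
  obtain ⟨R, hR⟩ := exists_isGoodFlow W.r_contDiffAt
  obtain ⟨S, hSC, hS0, hSd, hSH⟩ :=
    W.exists_shockCurve hk (by filter_upwards [hΩ] with u hu using hlam u hu)
  set S' : ℝ × State n → State n := fun x => fderiv ℝ S x (1, 0) with hS'
  have hS'C : ContDiffAt ℝ 1 S' 0 := (hSC.fderiv_right (m := 1) (by norm_num)).clm_apply contDiffAt_const
  have hSderiv : ∀ᶠ x in 𝓝 (0 : ℝ × State n), HasDerivAt (fun t => S (t, x.2)) (S' x) x.1 := by
    filter_upwards [hSC.eventually (by simp)] with x hx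
    have hline : HasDerivAt (fun σ : ℝ => (σ, x.2)) ((1 : ℝ), (0 : State n)) x.1 :=
      (hasDerivAt_id x.1).prodMk (hasDerivAt_const x.1 x.2)
    exact ((hx.differentiableAt (by norm_num)).hasFDerivAt).comp_hasDerivAt x.1 hline
  have hS'0 : S' 0 = P.r j 0 := hSd.self_of_nhds
  have hsnd : Tendsto (Prod.snd : ℝ × State n → State n) (𝓝 0) (𝓝 0) :=
    continuous_snd.tendsto (0 : ℝ × State n)
  have hSquad : ∃ C, ∀ᶠ x in 𝓝 (0 : ℝ × State n),
      ‖S x - x.2 - x.1 • P.r j x.2‖ ≤ C * |x.1| ^ 1 * |x.1| := by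
    obtain ⟨K, s, hs, hK⟩ := hS'C.exists_lipschitzOnWith
    refine ⟨K, eventually_norm_sub_le_of_deriv 1 hSderiv ?_ hS0⟩
    have h4 : Tendsto (fun x : ℝ × State n => ((0 : ℝ), x.2)) (𝓝 0) (𝓝 0) := by
      have : Continuous (fun x : ℝ × State n => ((0 : ℝ), x.2)) := by fun_prop
      exact this.tendsto (0 : ℝ × State n)
    filter_upwards [hs, h4.eventually hs, hsnd.eventually hSd] with x k1 k2 k3
    have e1 := hK.dist_le_mul _ k1 _ k2
    have e3 : ‖x - (0, x.2)‖ = |x.1| := by rw [Prod.norm_def]; simp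
    rw [dist_eq_norm, dist_eq_norm, e3] at e1
    rw [pow_one, ← k3]
    exact e1
  obtain ⟨C₁, hC₁⟩ := hSquad
  obtain ⟨C₂, hC₂⟩ := hR.quadratic (W.r_contDiffAt.of_le (by norm_num))
  have hfS : FourPointAt S 0 := .of_contDiffAt hSC
  have hglue : FourPointAt (fun x : ℝ × State n => S (min x.1 0, x.2) - R (min x.1 0, x.2)) 0 := by
    refine FourPointAt.comp_min (D := fun x => S x - R x) (hfS.sub hR.fourPointAt) (C := C₁ + C₂) ?_
    filter_upwards [hC₁, hC₂] with x h1 h2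
    have e : S x - R x = (S x - x.2 - x.1 • P.r j x.2) - (R x - x.2 - x.1 • P.r j x.2) := by abel
    rw [e]
    refine (norm_sub_le _ _).trans ((add_le_add h1 h2).trans (le_of_eq ?_))
    rw [← sq_abs]; ring
  set ψ : ℝ × State n → State n := fun x => if 0 ≤ x.1 then R x else S x with hψ
  have hSR0 : ∀ᶠ x in 𝓝 (0 : ℝ × State n), S (0, x.2) = R (0, x.2) := by
    filter_upwards [hsnd.eventually hS0, hsnd.eventually hR.zero] with x h1 h2
    rw [h1, h2]
  have hψeq : (fun x : ℝ × State n => R x + (S (min x.1 0, x.2) - R (min x.1 0, x.2))) =ᶠ[𝓝 0]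
      ψ := by
    filter_upwards [hSR0] with x hx
    by_cases h : 0 ≤ x.1
    · simp only [hψ, if_pos h, min_eq_right h, hx, sub_self, add_zero]
    · simp only [hψ, if_neg h, min_eq_left (not_le.1 h).le]
      abel
  refine ⟨ψ, (hR.fourPointAt.add hglue).congr hψeq, ?_, ?_, ?_, ?_⟩
  · filter_upwards [hR.zero] with u hu
    simp [hψ, hu]
  · intro κ hκ
    have hb : ∀ᶠ x in 𝓝 (0 : ℝ × State n), ‖S' x - P.r j 0‖ ≤ κ * |x.1| ^ 0 := by
      have := hS'C.continuousAt.eventually (Metric.closedBall_mem_nhds _ hκ)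
      filter_upwards [this] with x hx
      rw [hS'0] at hx
      simpa [dist_eq_norm] using hx
    have h1 := eventually_norm_sub_le_of_deriv (c := fun _ => P.r j 0) 0 hSderiv hb hS0
    filter_upwards [h1, hR.tangent W.r_contDiffAt.continuousAt hκ] with x k1 k2
    by_cases h : 0 ≤ x.1
    · simpa only [hψ, if_pos h] using k2
    · simpa only [hψ, if_neg h, pow_zero, mul_one] using k1
  · intro κ hκ
    obtain ⟨ε₁, hε₁, hrar⟩ := W.rarefaction_unique hR hκ
    obtain ⟨ε₂, hε₂, hhug⟩ := W.eq_hugoniot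
    obtain ⟨a, ha, hSH⟩ := exists_forall_of_eventually_prod hSH
    have hlamc : ∀ᶠ u in 𝓝 (0 : State n), |speed P.f j u - speed P.f j 0| < κ * P.k j / 2 := by
      have := W.lam_contDiffAt.continuousAt.eventually
        (Metric.ball_mem_nhds _ (show 0 < κ * P.k j / 2 by positivity))
      filter_upwards [this] with u hu
      simpa [Real.dist_eq] using hu
    have hlc : ∀ᶠ u in 𝓝 (0 : State n), |l u| < a / 2 := by
      have : ContinuousAt (fun u => |l u|) 0 := by fun_prop
      exact this.eventually (gt_mem_nhds (by simpa using ha))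
    obtain ⟨ε₃, hε₃, hlam3⟩ := Metric.eventually_nhds_iff_ball.1 (hlamc.and hlc)
    refine ⟨min (min ε₁ ε₂) (min ε₃ a), by positivity, fun ε hε σ u w hlax => ?_⟩
    have i1 := Metric.ball_subset_ball (x := (0 : State n))
      (hε.trans ((min_le_left _ _).trans (min_le_left _ _)))
    have i2 := Metric.ball_subset_ball (x := (0 : State n))
      (hε.trans ((min_le_left _ _).trans (min_le_right _ _)))
    have i3 := Metric.ball_subset_ball (x := (0 : State n))
      (hε.trans ((min_le_right _ _).trans (min_le_left _ _)))
    have i4 := Metric.ball_subset_ball (x := (0 : State n))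
      (hε.trans ((min_le_right _ _).trans (min_le_right _ _)))
    rcases hlax with ⟨hσ, γ, h0, h1, hγ⟩ | ⟨hσ, c, c', h0, h1, hc'0, -, hc⟩
    · have := hrar γ σ hσ fun s hs => ⟨i1 (hγ s hs).1.2, (hγ s hs).2⟩
      rw [h0, h1] at this
      rw [abs_of_nonneg hσ]
      simp only [hψ, if_pos hσ]
      exact this
    · have hσm : σ ∈ Set.Icc σ 0 := Set.left_mem_Icc.2 hσ.le
      have h0m : (0 : ℝ) ∈ Set.Icc σ 0 := Set.right_mem_Icc.2 hσ.le
      have hu : u ∈ P.nbhd ε := h0 ▸ (hc 0 h0m).1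
      have hsp : ∀ τ ∈ Set.Icc σ 0, speed P.f j (c τ) = speed P.f j u + P.k j * τ :=
        fun τ hτ => (hc τ hτ).2.2.2.1 hg
      -- The eigenvalue is strictly monotone along the curve, so the curve never returns to `u` and
      -- must follow the Hugoniot curve.
      have key := hhug c σ hσ (by rw [h0, ← hc'0]; exact (hc 0 h0m).2.1)
        (fun τ hτ => ⟨i2 (hc τ hτ).1.2, (hc τ hτ).2.1.continuousWithinAt, by
          rw [h0]; exact (hc τ hτ).2.2.1⟩) (fun τ hτ heq => by
          have h2 := hsp τ (Set.Ico_subset_Icc_self hτ)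
          rw [heq, h0, left_eq_add] at h2
          rcases mul_eq_zero.1 h2 with h3 | h3
          · exact hk.ne' h3
          · exact hτ.2.ne h3) σ hσm
      rw [h0, h1] at key
      have hwsp : speed P.f j w = speed P.f j u + P.k j * σ := h1 ▸ hsp σ hσm
      have hw : w ∈ P.nbhd ε := h1 ▸ (hc σ hσm).1
      constructor
      · have b1 := (hlam3 u (i3 hu.2)).1
        have b2 := (hlam3 w (i3 hw.2)).1
        have b3 : P.k j * |σ| < P.k j * κ := by
          rw [← abs_of_pos hk, ← abs_mul, abs_of_pos hk]
          have e : P.k j * σ = (speed P.f j w - speed P.f j 0) - (speed P.f j u - speed P.f j 0) := by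
            rw [hwsp]; ring
          rw [e]
          have := abs_sub (speed P.f j w - speed P.f j 0) (speed P.f j u - speed P.f j 0)
          linarith
        exact lt_of_mul_lt_mul_left b3 hk.le
      · simp only [hψ, if_neg (not_le.2 hσ)]
        have b1 := (hlam3 u (i3 hu.2)).2
        have b2 := (hlam3 w (i3 hw.2)).2
        have b3 : |l (w - u)| < a := by
          rw [map_sub]
          have := abs_sub (l w) (l u)
          linarith
        have h5 := hSH (l (w - u)) u b3 (by simpa using i4 hu.2)
        have e : hugoniotMap v (l (w - u), u) = w := by
          simp only [hugoniotMap]; exact key.symm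
        rw [e] at h5
        simp only at h5
        rw [hwsp, add_sub_cancel_left, mul_div_cancel_left₀ _ hk.ne'] at h5
        exact h5
  · filter_upwards [hR.add] with y hy h
    obtain ⟨h1, h2⟩ := h.resolve_left (not_not.2 hg)
    simp only [hψ, if_pos h1, if_pos h2, if_pos (add_nonneg h1 h2)]
    exact hy

end LaxCurve
end Glimm

/-! ### Contact discontinuities -/

namespace Glimm

section Contact

variable {n : ℕ} {f : State n → State n} {lam : State n → ℝ} {r : State n → State n}
  {l : State n →L[ℝ] ℝ} {v : ℝ × State n → State n} {R : ℝ × State n → State n}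

/-- The function may depend on the initial state of the curve. This is needed for `w ↦ f w - λ(u)
w`, whose constancy along the curve from `u` is the Rankine–Hugoniot condition. -/
theorem IsGoodFlow.eventually_const {F : Type*} [NormedAddCommGroup F] [NormedSpace ℝ F]
    {E : Type*} [NormedAddCommGroup E] [NormedSpace ℝ E] {r : E → E} {R : ℝ × E → E}
    (hR : IsGoodFlow r R) {g : E → E → F} (hg : ∀ᶠ z in 𝓝 (0 : E × E),
      HasFDerivAt (g z.1) (fderiv ℝ (g z.1) z.2) z.2)
    (h0 : ∀ᶠ x in 𝓝 (0 : ℝ × E), fderiv ℝ (g x.2) (R x) (r (R x)) = 0) :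
    ∀ᶠ x in 𝓝 (0 : ℝ × E), g x.2 (R x) = g x.2 x.2 := by
  have hsnd : Tendsto (Prod.snd : ℝ × E → E) (𝓝 0) (𝓝 0) := continuous_snd.tendsto (0 : ℝ × E)
  have hpair : Tendsto (fun x : ℝ × E => (x.2, R x)) (𝓝 0) (𝓝 0) := hsnd.prodMk_nhds hR.tendsto
  obtain ⟨a, ha, H⟩ := exists_forall_of_eventually_prod
    ((hpair.eventually hg).and (h0.and (hR.deriv.and (hsnd.eventually hR.zero))))
  refine eventually_prod_of_forall ha fun t u ht hu => ?_
  have key := (convex_uIcc (0 : ℝ) t).norm_image_sub_le_of_norm_hasDerivWithin_le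
    (f := fun s => g u (R (s, u))) (f' := fun s => 0) (C := 0)
    (fun s hs => ?_) (fun s hs => by simp) Set.left_mem_uIcc Set.right_mem_uIcc
  · rw [zero_mul, norm_le_zero_iff, sub_eq_zero] at key
    have e0 := (H t u ht hu).2.2.2
    simp only at e0
    simp only [e0] at key
    exact key
  · have hs' : |s| < a := (by simpa using Set.abs_sub_left_of_mem_uIcc hs : |s| ≤ |t|).trans_lt ht
    obtain ⟨k1, k2, k3, -⟩ := H s u hs' hu
    have := k1.comp_hasDerivAt s k3
    simp only at k2
    rw [← k2]
    exact this.hasDerivWithinAt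

/-- In a linearly degenerate field the integral curves of `r` are Hugoniot curves. -/
theorem WaveField.flow_rankineHugoniot (W : WaveField f lam r l v) (hR : IsGoodFlow r R)
    (hlam : ∀ᶠ u in 𝓝 (0 : State n), fderiv ℝ lam u (r u) = 0) :
    ∀ᶠ x in 𝓝 (0 : ℝ × State n), f (R x) - f x.2 = lam x.2 • (R x - x.2) := by
  have hsnd2 : Tendsto (Prod.snd : State n × State n → State n) (𝓝 0) (𝓝 0) :=
    continuous_snd.tendsto (0 : State n × State n)
  have h1 : ∀ᶠ x in 𝓝 (0 : ℝ × State n), lam (R x) = lam x.2 := by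
    refine hR.eventually_const (g := fun _ => lam) ?_ (hR.tendsto.eventually hlam)
    filter_upwards [hsnd2.eventually (W.lam_contDiffAt.eventually (by simp))] with z hz
    exact (hz.differentiableAt (by norm_num)).hasFDerivAt
  have hfd : ∀ᶠ u in 𝓝 (0 : State n), DifferentiableAt ℝ f u := by
    filter_upwards [W.flux_contDiffAt.eventually (by simp)] with u hu
    exact hu.differentiableAt (by norm_num)
  have hgd : ∀ u w, DifferentiableAt ℝ f w → HasFDerivAt (fun w => f w - lam u • w)
      (fderiv ℝ f w - lam u • ContinuousLinearMap.id ℝ (State n)) w := fun u w hw =>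
    hw.hasFDerivAt.sub ((hasFDerivAt_id w).const_smul (lam u))
  have h2 := hR.eventually_const (g := fun u w => f w - lam u • w) ?_ ?_
  · filter_upwards [h2] with x hx
    rw [smul_sub, sub_eq_sub_iff_sub_eq_sub]
    exact hx
  · filter_upwards [hsnd2.eventually hfd] with z hz
    rw [(hgd z.1 z.2 hz).fderiv]
    exact hgd z.1 z.2 hz
  · filter_upwards [h1, hR.tendsto.eventually hfd, hR.tendsto.eventually W.eigen] with x k1 k2 k3
    rw [(hgd x.2 _ k2).fderiv]
    simp [k3, k1]

/-- The chord from `u` to `R (σ, u)` satisfies Rankine–Hugoniot and is nearly parallel to `r 0`.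
Since `κ ‖r 0‖ < 1 / 2`, its `l`-coordinate is too large for the first alternative of
`WaveField.chord`. -/
theorem WaveField.flow_eq_hugoniotMap (W : WaveField f lam r l v) (hR : IsGoodFlow r R)
    (hlam : ∀ᶠ u in 𝓝 (0 : State n), fderiv ℝ lam u (r u) = 0) :
    ∀ᶠ x in 𝓝 (0 : ℝ × State n), R x = hugoniotMap v (l (R x - x.2), x.2) := by
  obtain ⟨κ, hκ, hκr, hch⟩ := W.chord
  set κ' := 1 / (4 * (‖l‖ + κ + 1)) with hκ'
  have hκ'0 : 0 < κ' := by positivity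
  have hκ'1 : 4 * (‖l‖ * κ' + κ * κ') ≤ 1 := by
    have : 4 * ((‖l‖ + κ + 1) * κ') = 1 := by rw [hκ']; field_simp
    linarith
  have hsnd : Tendsto (Prod.snd : ℝ × State n → State n) (𝓝 0) (𝓝 0) :=
    continuous_snd.tendsto (0 : ℝ × State n)
  have hpair : Tendsto (fun x : ℝ × State n => (x.2, R x)) (𝓝 0) (𝓝 0) :=
    hsnd.prodMk_nhds hR.tendsto
  filter_upwards [hpair.eventually hch, W.flow_rankineHugoniot hR hlam,
    hR.tangent W.r_contDiffAt.continuousAt hκ'0, hsnd.eventually hR.zero] with x h1 h2 h3 h4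
  by_cases hx : x.1 = 0
  · have hx' : x = (0, x.2) := Prod.ext hx rfl
    have e : R x = x.2 := by rw [hx']; exact h4
    rw [e, sub_self, map_zero, hugoniotMap_zero]
  have hx0 : 0 < |x.1| := abs_pos.2 hx
  have k1 : |x.1| - ‖l‖ * (κ' * |x.1|) ≤ |l (R x - x.2)| := by
    have e : x.1 = l (R x - x.2) - l (R x - x.2 - x.1 • r 0) := by
      rw [← map_sub, sub_sub_cancel, map_smul, W.l_r, smul_eq_mul, mul_one]
    have k2 : |l (R x - x.2 - x.1 • r 0)| ≤ ‖l‖ * (κ' * |x.1|) :=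
      (l.le_opNorm _).trans (by gcongr)
    have k3 := abs_sub (l (R x - x.2)) (l (R x - x.2 - x.1 • r 0))
    rw [← e] at k3
    linarith
  have k2 : ‖R x - x.2‖ ≤ |x.1| * ‖r 0‖ + κ' * |x.1| := by
    have e : R x - x.2 = (x.1 • r 0) + (R x - x.2 - x.1 • r 0) := by abel
    rw [e]
    refine (norm_add_le _ _).trans ?_
    rw [norm_smul, Real.norm_eq_abs]
    gcongr
  have k0 : ∀ {m : ℝ}, 0 ≤ m → m ≤ κ → ¬ |l (R x - x.2)| ≤ m * ‖R x - x.2‖ := by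
    intro m hm0 hm hcon
    have c1 : m * ‖R x - x.2‖ ≤ κ * (|x.1| * ‖r 0‖ + κ' * |x.1|) := by gcongr
    have c2 : |x.1| * (1 - ‖l‖ * κ' - κ * κ' - κ * ‖r 0‖) ≤ 0 := by linarith
    nlinarith
  have hne : R x ≠ x.2 := by
    intro hcon
    apply k0 le_rfl hκ.le
    simp [hcon]
  rcases h1 (lam x.2) hne h2 with h | h
  · exact absurd h (k0 hκ.le le_rfl)
  · exact h.2

/-- In a linearly degenerate field the tangents of the Hugoniot curve are eigenvectors. -/
theorem WaveField.fderiv_hugoniotMap (W : WaveField f lam r l v) (hR : IsGoodFlow r R)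
    (hlam : ∀ᶠ u in 𝓝 (0 : State n), fderiv ℝ lam u (r u) = 0) :
    ∀ᶠ x in 𝓝 (0 : ℝ × State n),
      l (r (hugoniotMap v x)) • fderiv ℝ (hugoniotMap v) x (1, 0) = r (hugoniotMap v x) := by
  have hH := W.contDiffAt_hugoniotMap
  have hsnd : Tendsto (Prod.snd : ℝ × State n → State n) (𝓝 0) (𝓝 0) :=
    continuous_snd.tendsto (0 : ℝ × State n)
  have hg : Tendsto (fun x => (l (R x - x.2), x.2)) (𝓝 (0 : ℝ × State n)) (𝓝 0) := by
    have h1 := (l.continuous.tendsto _).comp (hR.tendsto.sub hsnd)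
    rw [sub_zero, map_zero] at h1
    exact h1.prodMk_nhds hsnd
  have hd : ∀ᶠ x in 𝓝 (0 : ℝ × State n), DifferentiableAt ℝ (hugoniotMap v) x := by
    filter_upwards [hH.eventually (by simp)] with x hx
    exact hx.differentiableAt (by norm_num)
  have heq := W.flow_eq_hugoniotMap hR hlam
  obtain ⟨κ, hκ, hκl⟩ : ∃ κ > 0, ‖l‖ * κ ≤ 1 / 2 :=
    ⟨1 / (2 * (‖l‖ + 1)), by positivity, by
      rw [mul_one_div, div_le_div_iff₀ (by positivity) (by positivity)]; linarith⟩
  obtain ⟨a, ha, H⟩ := exists_forall_of_eventually_prod (heq.eventually_nhds.and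
    ((hg.eventually hd).and (hR.deriv.and ((hsnd.eventually hR.zero).and
      (hR.tangent W.r_contDiffAt.continuousAt hκ)))))
  -- every `(t, u)` is of the form `(l (R (τ, u) - u), u)`
  refine eventually_prod_of_forall (a := a / 3) (by positivity) fun t u ht hu => ?_
  have hu' : ‖u‖ < a := by linarith
  have hlow : ∀ τ, |τ| < a → |l (R (τ, u) - u) - τ| ≤ |τ| / 2 := by
    intro τ hτ
    have k := (H τ u hτ hu').2.2.2.2
    simp only at k
    have e : l (R (τ, u) - u) - τ = l (R (τ, u) - u - τ • r 0) := by
      rw [map_sub _ (R (τ, u) - u), map_smul, W.l_r, smul_eq_mul, mul_one]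
    rw [e]
    calc _ ≤ ‖l‖ * (κ * |τ|) := (l.le_opNorm _).trans (by gcongr)
      _ = (‖l‖ * κ) * |τ| := by ring
      _ ≤ 1 / 2 * |τ| := by gcongr
      _ = _ := by ring
  -- The function `τ ↦ l (R (τ, u) - u)` differs from `τ` by at most `|τ| / 2`, so it attains `t` on
  -- `[-2|t|, 2|t|]`. The radius `a / 3` keeps this interval within reach.
  obtain ⟨τ, hτ, hτt⟩ : ∃ τ, |τ| < a ∧ l (R (τ, u) - u) = t := by
    have hc : ContinuousOn (fun τ => l (R (τ, u) - u)) (Set.Icc (-(2 * |t|)) (2 * |t|)) := by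
      intro τ hτ
      have hτ' : |τ| < a := (abs_le.2 hτ).trans_lt (by linarith)
      exact (l.continuous.continuousAt.comp
        (((H τ u hτ' hu').2.2.1.continuousAt).sub continuousAt_const)).continuousWithinAt
    have ht0 := abs_nonneg t
    have hlt : abs (2 * |t|) < a := by rw [abs_of_nonneg (by linarith)]; linarith
    have k1 := abs_le.1 (hlow (2 * |t|) hlt)
    have k2 := abs_le.1 (hlow (-(2 * |t|)) (by rwa [abs_neg]))
    rw [abs_neg] at k2
    rw [abs_of_nonneg (by linarith : 0 ≤ 2 * |t|)] at k1 k2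
    obtain ⟨τ, hτ, h⟩ := intermediate_value_Icc (by linarith) hc
      (show t ∈ Set.Icc (l (R (-(2 * |t|), u) - u)) (l (R (2 * |t|, u) - u)) from
        ⟨by linarith [neg_abs_le t], by linarith [le_abs_self t]⟩)
    exact ⟨τ, (abs_le.2 hτ).trans_lt (by linarith), h⟩
  obtain ⟨k1, k2, k3, -, -⟩ := H τ u hτ hu'
  simp only [hτt] at k2
  have hR' : R (τ, u) = hugoniotMap v (t, u) := by
    have := k1.self_of_nhds
    simp only [hτt] at this
    exact this
  have d1 : HasDerivAt (fun s => l (R (s, u) - u)) (l (r (R (τ, u)))) τ :=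
    l.hasFDerivAt.comp_hasDerivAt τ (k3.sub_const u)
  have d2 : HasDerivAt (fun s => (l (R (s, u) - u), u)) (l (r (R (τ, u))), (0 : State n)) τ :=
    d1.prodMk (hasDerivAt_const τ u)
  have d3 : HasDerivAt (fun s => hugoniotMap v (l (R (s, u) - u), u))
      (fderiv ℝ (hugoniotMap v) (t, u) (l (r (R (τ, u))), 0)) τ :=
    HasFDerivAt.comp_hasDerivAt (l := hugoniotMap v) τ (by simpa only [hτt] using k2.hasFDerivAt) d2
  have d4 : HasDerivAt (fun s => hugoniotMap v (l (R (s, u) - u), u)) (r (R (τ, u))) τ := by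
    refine k3.congr_of_eventuallyEq ?_
    have cl : ContinuousAt (fun s : ℝ => (s, u)) τ := by fun_prop
    filter_upwards [cl.eventually k1] with s hs
    exact hs.symm
  have e := d3.unique d4
  rw [hR'] at e
  rw [← map_smul, Prod.smul_mk, smul_eq_mul, mul_one, smul_zero]
  exact e

/-- In a linearly degenerate field the shock curves parametrized by arc length are integral curves
of `r`. -/
theorem WaveField.contact_unique (W : WaveField f lam r l v) (hR : IsGoodFlow r R)
    (hlam : ∀ᶠ u in 𝓝 (0 : State n), fderiv ℝ lam u (r u) = 0)
    (hunit : ∀ᶠ u in 𝓝 (0 : State n), ‖r u‖ = 1) {κ : ℝ} (hκ : 0 < κ) :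
    ∃ ε₀ > 0, ∀ (c c' : ℝ → State n) (σ : ℝ), σ < 0 → c' 0 = r (c 0) →
      ContinuousOn c' (Set.Icc σ 0) →
      (∀ τ ∈ Set.Icc σ 0, c τ ∈ Metric.ball 0 ε₀ ∧ HasDerivWithinAt c (c' τ) (Set.Icc σ 0) τ ∧
        (∃ s : ℝ, f (c τ) - f (c 0) = s • (c τ - c 0)) ∧ ‖c' τ‖ = 1) →
      |σ| < κ ∧ c σ = R (σ, c 0) := by
  obtain ⟨ρ, hρ, huniq⟩ := hR.unique
  obtain ⟨ε₁, hε₁, hhug⟩ := W.eq_hugoniot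
  have hH := W.contDiffAt_hugoniotMap
  have hd : ∀ᶠ x in 𝓝 (0 : ℝ × State n), DifferentiableAt ℝ (hugoniotMap v) x := by
    filter_upwards [hH.eventually (by simp)] with x hx
    exact hx.differentiableAt (by norm_num)
  obtain ⟨a, ha, HD⟩ := exists_forall_of_eventually_prod (hd.and (W.fderiv_hugoniotMap hR hlam))
  have hrc : ∀ᶠ u in 𝓝 (0 : State n), ContinuousAt r u := by
    filter_upwards [W.r_contDiffAt.eventually (by simp)] with u hu using hu.continuousAt
  have hlc : ∀ᶠ u in 𝓝 (0 : State n), |l u| < min (a / 2) (min κ ρ / 8) := by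
    have : ContinuousAt (fun u => |l u|) 0 := by fun_prop
    refine this.eventually (gt_mem_nhds ?_)
    simp only [map_zero, abs_zero]
    positivity
  obtain ⟨ε₂, hε₂, HE⟩ := Metric.eventually_nhds_iff_ball.1
    (((W.eventually_l_r (m := 1 / 2) (by norm_num)).and hunit).and (hrc.and hlc))
  refine ⟨min (min ρ a) (min ε₁ ε₂), by positivity, fun c c' σ hσ hc'0 hc'c hc => ?_⟩
  have i0 := Metric.ball_subset_ball (x := (0 : State n))
    ((min_le_left (min ρ a) (min ε₁ ε₂)).trans (min_le_left _ _))
  have ia := Metric.ball_subset_ball (x := (0 : State n))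
    ((min_le_left (min ρ a) (min ε₁ ε₂)).trans (min_le_right _ _))
  have i1 := Metric.ball_subset_ball (x := (0 : State n))
    ((min_le_right (min ρ a) (min ε₁ ε₂)).trans (min_le_left _ _))
  have i2 := Metric.ball_subset_ball (x := (0 : State n))
    ((min_le_right (min ρ a) (min ε₁ ε₂)).trans (min_le_right _ _))
  have h0m : (0 : ℝ) ∈ Set.Icc σ 0 := Set.right_mem_Icc.2 hσ.le
  have hE := fun τ hτ => HE (c τ) (i2 (hc τ hτ).1)
  -- where the curve does not return to its starting point it is an integral curve
  have keyA : ∀ τ₁ ∈ Set.Ico σ 0, (∀ τ ∈ Set.Ico τ₁ 0, c τ ≠ c 0) →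
      ∀ τ ∈ Set.Icc τ₁ 0, c' τ = r (c τ) := by
    intro τ₁ hτ₁ hne
    have hsub : Set.Icc τ₁ 0 ⊆ Set.Icc σ 0 := Set.Icc_subset_Icc_left hτ₁.1
    have hd1 : ∀ τ ∈ Set.Icc τ₁ 0, HasDerivWithinAt c (c' τ) (Set.Icc τ₁ 0) τ :=
      fun τ hτ => (hc τ (hsub hτ)).2.1.mono hsub
    have hon := hhug c τ₁ hτ₁.2 (by rw [← hc'0]; exact hd1 0 (Set.right_mem_Icc.2 hτ₁.2.le))
      (fun τ hτ => ⟨i1 (hc τ (hsub hτ)).1, (hd1 τ hτ).continuousWithinAt, (hc τ (hsub hτ)).2.2.1⟩)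
      hne
    -- The curve lies on the Hugoniot curve, whose tangents are eigenvectors, so `c'` is parallel to
    -- `r (c τ)`.
    have hq : ∀ τ ∈ Set.Icc τ₁ 0, l (r (c τ)) • c' τ = l (c' τ) • r (c τ) := by
      intro τ hτ
      have ht : |l (c τ - c 0)| < a := by
        have b1 := (hE τ (hsub hτ)).2.2
        have b2 := (hE 0 h0m).2.2
        rw [map_sub]
        have := abs_sub (l (c τ)) (l (c 0))
        have := min_le_left (a / 2) (min κ ρ / 8)
        linarith
      obtain ⟨k1, k2⟩ := HD (l (c τ - c 0)) (c 0) ht (by simpa using ia (hc 0 h0m).1)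
      have e : hugoniotMap v (l (c τ - c 0), c 0) = c τ := (hon τ hτ).symm
      rw [e] at k2
      have d1 : HasDerivWithinAt (fun s => (l (c s - c 0), c 0)) (l (c' τ), (0 : State n))
          (Set.Icc τ₁ 0) τ :=
        (l.hasFDerivAt.comp_hasDerivWithinAt τ ((hd1 τ hτ).sub_const (c 0))).prodMk
          (hasDerivWithinAt_const τ _ (c 0))
      have d2 : HasDerivWithinAt (fun s => hugoniotMap v (l (c s - c 0), c 0))
          (fderiv ℝ (hugoniotMap v) (l (c τ - c 0), c 0) (l (c' τ), 0)) (Set.Icc τ₁ 0) τ :=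
        HasFDerivAt.comp_hasDerivWithinAt (l := hugoniotMap v) τ k1.hasFDerivAt d1
      have d3 : HasDerivWithinAt (fun s => hugoniotMap v (l (c s - c 0), c 0)) (c' τ)
          (Set.Icc τ₁ 0) τ :=
        (hd1 τ hτ).congr (fun s hs => (hon s hs).symm) (hon τ hτ).symm
      have d4 := (uniqueDiffOn_Icc hτ₁.2 τ hτ).eq_deriv _ d2 d3
      have e2 : ((l (c' τ), 0) : ℝ × State n) = l (c' τ) • ((1 : ℝ), (0 : State n)) := by simp
      rw [e2, map_smul] at d4
      have k3 := congrArg (fun z => l (c' τ) • z) k2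
      change l (c' τ) • (l (r (c τ)) • _) = l (c' τ) • r (c τ) at k3
      rwa [smul_comm, d4] at k3
    have hpos : ∀ τ ∈ Set.Icc τ₁ 0, 0 < l (r (c τ)) := fun τ hτ =>
      lt_of_lt_of_le (by norm_num) (hE τ (hsub hτ)).1.1
    have habs : ∀ τ ∈ Set.Icc τ₁ 0, l (r (c τ)) = |l (c' τ)| := by
      intro τ hτ
      have := congrArg norm (hq τ hτ)
      rw [norm_smul, norm_smul, (hc τ (hsub hτ)).2.2.2, (hE τ (hsub hτ)).1.2, mul_one, mul_one,
        Real.norm_of_nonneg (hpos τ hτ).le] at this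
      exact this
    intro τ hτ
    -- Both vectors have unit length, so `|l (c' τ)| = l (r (c τ))` does not vanish. By continuity
    -- of `c'` the sign is the one at `τ = 0`.
    have hsign : 0 < l (c' τ) := by
      by_contra hcon
      push Not at hcon
      have hcl : ContinuousOn (fun s => l (c' s)) (Set.Icc τ 0) := by
        refine l.continuous.comp_continuousOn (hc'c.mono ?_)
        exact Set.Icc_subset_Icc_left (hsub hτ).1
      have h0pos : 0 < l (c' 0) := by
        rw [hc'0]; exact hpos 0 (Set.right_mem_Icc.2 hτ₁.2.le)
      obtain ⟨s, hs, hs0⟩ := intermediate_value_Icc hτ.2 hcl ⟨hcon, h0pos.le⟩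
      have hs' : s ∈ Set.Icc τ₁ 0 := ⟨hτ.1.trans hs.1, hs.2⟩
      have := habs s hs'
      rw [show l (c' s) = 0 from hs0, abs_zero] at this
      exact (hpos s hs').ne' this
    have h1 := hq τ hτ
    rw [habs τ hτ, abs_of_pos hsign] at h1
    exact smul_right_injective (State n) hsign.ne' h1
  have hlow : ∀ τ₁ ∈ Set.Ico σ 0, (∀ τ ∈ Set.Ico τ₁ 0, c τ ≠ c 0) →
      1 / 2 * (0 - τ₁) ≤ l (c 0 - c τ₁) := by
    intro τ₁ hτ₁ hne
    have hsub : Set.Icc τ₁ 0 ⊆ Set.Icc σ 0 := Set.Icc_subset_Icc_left hτ₁.1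
    refine mul_sub_le_of_hasDerivWithinAt (c' := c') hτ₁.2.le
      (fun s hs => (hc s (hsub hs)).2.1.mono hsub) fun s hs => ?_
    rw [keyA τ₁ hτ₁ hne s hs]
    exact (hE s (hsub hs)).1.1
  -- The eigenvalue is constant in this case and cannot rule out a return. Since `c' 0 ≠ 0`, the
  -- return times stay away from `0` and there is a latest one, `τm`. After it the curve is an
  -- integral curve, and the bound `hlow` passes to the limit at `τm`, where it contradicts `c τm =
  -- c 0`.
  have hne : ∀ τ ∈ Set.Ico σ 0, c τ ≠ c 0 := by
    by_contra hcon
    push Not at hcon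
    obtain ⟨τ₀, hτ₀, hτ₀c⟩ := hcon
    have hcc : ContinuousOn c (Set.Icc σ 0) := fun τ hτ => (hc τ hτ).2.1.continuousWithinAt
    have hnear : ∃ b < 0, ∀ τ ∈ Set.Ioo b 0, σ ≤ τ → c τ ≠ c 0 := by
      have h1 : c' 0 ≠ 0 := by
        intro h
        have := (hc 0 h0m).2.2.2
        rw [h, norm_zero] at this
        exact zero_ne_one this
      have h2 := ((hc 0 h0m).2.1).eventually_ne h1 (c := c 0)
      rw [eventually_nhdsWithin_iff] at h2
      obtain ⟨b, hb, hb'⟩ := Metric.eventually_nhds_iff_ball.1 h2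
      refine ⟨-b, by linarith, fun τ hτ hστ => hb' τ ?_ ⟨⟨hστ, hτ.2.le⟩, hτ.2.ne⟩⟩
      rw [mem_ball_zero_iff, Real.norm_eq_abs, abs_of_neg hτ.2]
      linarith [hτ.1]
    obtain ⟨b, hb, hbne⟩ := hnear
    set Z := {τ | τ ∈ Set.Icc σ b ∧ c τ = c 0} with hZ
    have hZc : IsCompact Z := by
      have h1 : ContinuousOn c (Set.Icc σ b) := hcc.mono (Set.Icc_subset_Icc_right hb.le)
      have h2 : IsClosed Z := by
        have := h1.preimage_isClosed_of_isClosed isClosed_Icc (isClosed_singleton (x := c 0))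
        exact this
      exact isCompact_Icc.of_isClosed_subset h2 fun τ hτ => hτ.1
    have hτ₀b : τ₀ ≤ b := by
      by_contra hlt
      push Not at hlt
      exact hbne τ₀ ⟨hlt, hτ₀.2⟩ hτ₀.1 hτ₀c
    obtain ⟨τm, hτm, hmax⟩ := hZc.exists_isGreatest ⟨τ₀, ⟨hτ₀.1, hτ₀b⟩, hτ₀c⟩
    have hm0 : τm < 0 := hτm.1.2.trans_lt hb
    have hne' : ∀ τ ∈ Set.Ioo τm 0, c τ ≠ c 0 := by
      intro τ hτ hcon
      rcases le_or_gt τ b with h | h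
      · exact absurd (hmax ⟨⟨hτm.1.1.trans hτ.1.le, h⟩, hcon⟩) (not_le.2 hτ.1)
      · exact hbne τ ⟨h, hτ.2⟩ (hτm.1.1.trans hτ.1.le) hcon
    have hmem : τm ∈ Set.Icc σ 0 := ⟨hτm.1.1, hm0.le⟩
    have hsubm : Set.Ioo τm 0 ⊆ Set.Icc σ 0 := fun s hs => ⟨hmem.1.trans hs.1.le, hs.2.le⟩
    have ht1 : Tendsto (fun τ => l (c 0 - c τ)) (𝓝[Set.Ioo τm 0] τm) (𝓝 (l (c 0 - c τm))) :=
      (l.continuous.tendsto _).comp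
        (tendsto_const_nhds.sub ((hcc τm hmem).mono hsubm).tendsto)
    have ht2 : Tendsto (fun τ : ℝ => 1 / 2 * (0 - τ)) (𝓝[Set.Ioo τm 0] τm)
        (𝓝 (1 / 2 * (0 - τm))) := by
      have : Continuous fun τ : ℝ => 1 / 2 * (0 - τ) := by fun_prop
      exact this.continuousWithinAt.tendsto
    have : (𝓝[Set.Ioo τm 0] τm).NeBot := by
      rw [nhdsWithin_Ioo_eq_nhdsGT hm0]; infer_instance
    have := le_of_tendsto_of_tendsto ht2 ht1 (by
      filter_upwards [self_mem_nhdsWithin] with τ hτ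
      exact hlow τ ⟨(hsubm hτ).1, hτ.2⟩ fun s hs => hne' s ⟨hτ.1.trans_le hs.1, hs.2⟩)
    rw [hτm.2, sub_self, map_zero] at this
    linarith
  have hσI : σ ∈ Set.Ico σ 0 := ⟨le_rfl, hσ⟩
  have hσm : σ ∈ Set.Icc σ 0 := Set.left_mem_Icc.2 hσ.le
  have hsmall : |σ| < min κ ρ := by
    have h1 := hlow σ hσI hne
    have b1 := (hE σ hσm).2.2
    have b2 := (hE 0 h0m).2.2
    have b3 := min_le_right (a / 2) (min κ ρ / 8)
    rw [map_sub] at h1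
    have := le_abs_self (l (c 0))
    have := neg_abs_le (l (c σ))
    have : 0 < min κ ρ := by positivity
    rw [abs_of_neg hσ]
    linarith
  refine ⟨hsmall.trans_le (min_le_left _ _), huniq (c 0) (i0 (hc 0 h0m).1) σ
    (hsmall.trans_le (min_le_right _ _)) c rfl fun s hs => ?_⟩
  rw [Set.uIcc_of_ge hσ.le] at hs ⊢
  refine ⟨i0 (hc s hs).1, ?_⟩
  rw [← keyA σ hσI hne s hs]
  exact (hc s hs).2.1

end Contact

/-! ### Lax curves of linearly degenerate fields, and of all families. -/

section

variable {n : ℕ} {P : System n} {j : Fin n} {l : State n →L[ℝ] ℝ} {v : ℝ × State n → State n}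

/-- Contact curves are integral curves for both signs of `σ`. The flow is the whole Lax curve and
has the semigroup property without sign conditions. -/
theorem exists_laxCurve_ld (W : WaveField P.f (speed P.f j) (P.r j) l v) (hΩ : P.Ω ∈ 𝓝 0)
    (hld : LinearlyDegenerate P.Ω P.f j)
    (heig : ∀ u ∈ P.Ω, fderiv ℝ P.f u (P.r j u) = speed P.f j u • P.r j u)
    (hunit : ∀ u ∈ P.Ω, ‖P.r j u‖ = 1) : ∃ ψ, LaxCurve P j ψ (P.r j 0) := by
  obtain ⟨R, hR⟩ := exists_isGoodFlow W.r_contDiffAt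
  have hlam : ∀ᶠ u in 𝓝 (0 : State n), fderiv ℝ (speed P.f j) u (P.r j u) = 0 := by
    filter_upwards [hΩ] with u hu
    exact hld u hu _ (heig u hu)
  have hunit' : ∀ᶠ u in 𝓝 (0 : State n), ‖P.r j u‖ = 1 := by
    filter_upwards [hΩ] with u hu using hunit u hu
  refine ⟨R, hR.fourPointAt, hR.zero, fun κ hκ => hR.tangent W.r_contDiffAt.continuousAt hκ, ?_,
    hR.add.mono fun y hy _ => hy⟩
  · intro κ hκ
    obtain ⟨ε₁, hε₁, hrar⟩ := W.rarefaction_unique hR hκ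
    obtain ⟨ε₂, hε₂, hcon⟩ := W.contact_unique hR hlam hunit' hκ
    refine ⟨min ε₁ ε₂, by positivity, fun ε hε σ u w hlax => ?_⟩
    have i1 := Metric.ball_subset_ball (x := (0 : State n)) (hε.trans (min_le_left _ _))
    have i2 := Metric.ball_subset_ball (x := (0 : State n)) (hε.trans (min_le_right _ _))
    rcases hlax with ⟨hσ, γ, h0, h1, hγ⟩ | ⟨hσ, c, c', h0, h1, hc'0, hc', hc⟩
    · have := hrar γ σ hσ fun s hs => ⟨i1 (hγ s hs).1.2, (hγ s hs).2⟩
      rw [h0, h1] at this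
      rw [abs_of_nonneg hσ]
      exact this
    · have := hcon c c' σ hσ (by rw [h0, hc'0]) hc' fun τ hτ => ⟨i2 (hc τ hτ).1.2,
        (hc τ hτ).2.1, by rw [h0]; exact (hc τ hτ).2.2.1, (hc τ hτ).2.2.2.2 hld⟩
      rwa [h0, h1] at this

/-- Near the origin there are Lax curves of all families, with linearly independent tangents. -/
theorem exists_laxCurves {n : ℕ} (P : System n) (hΩ : IsOpen P.Ω) (h0 : (0 : State n) ∈ P.Ω)
    (hF : ConditionF P.Ω P.f) (hk : ∀ j, 0 < P.k j) (hr : IsNormalizedFrame P.Ω P.f P.k P.r) :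
    ∃ (b : Module.Basis (Fin n) ℝ (State n)) (ψ : Fin n → ℝ × State n → State n),
      ∀ j, LaxCurve P j (ψ j) (b j) := by
  obtain ⟨b, v, hb, hW⟩ := exists_waveField P hΩ h0 hF hk hr
  have hΩ0 : P.Ω ∈ 𝓝 (0 : State n) := hΩ.mem_nhds h0
  have : ∀ j, ∃ ψ, LaxCurve P j ψ (P.r j 0) := by
    intro j
    rcases hF.fields j with h | h
    · exact exists_laxCurve_gnl (hW j) hΩ0 h (hk j) (hr.normalized_gnl j h)
    · exact exists_laxCurve_ld (hW j) hΩ0 h (hr.eigen j)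
        (hr.normalized_ld j h)
  choose ψ hψ using this
  exact ⟨b, ψ, fun j => by rw [hb]; exact hψ j⟩

end

end Glimm

/-! ### The composition of the Lax curves -/

namespace Glimm

variable {n : ℕ}

/-- Tangency compares `ψ (σ, u)` only with `u`. Two second differences, in the parameter and in the
state, reduce a general increment to that case. They contribute `κ / 4` each and the tangency `κ /
2`. -/
theorem LaxCurve.hasStrictFDerivAt {P : System n} {j : Fin n} {ψ : ℝ × State n → State n}
    {e : State n} (h : LaxCurve P j ψ e) :
    HasStrictFDerivAt ψ (ContinuousLinearMap.snd ℝ ℝ (State n) +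
      (ContinuousLinearMap.fst ℝ ℝ (State n)).smulRight e) 0 := by
  refine HasStrictFDerivAt.of_isLittleO (Asymptotics.isLittleO_iff.2 fun κ hκ => ?_)
  obtain ⟨C, hC, r, hr, H⟩ := h.fourPointAt
  obtain ⟨s, hs, Hs⟩ := Metric.eventually_nhds_iff_ball.1
    (h.tangent (κ / 2) (half_pos hκ))
  obtain ⟨q, hq, Hq⟩ := Metric.eventually_nhds_iff_ball.1 h.zero
  obtain ⟨t, ht, htr, hts, htq, htC⟩ : ∃ t > 0, 2 * t ≤ r ∧ 2 * t ≤ s ∧ t ≤ q ∧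
      C * t ≤ κ / 4 := by
    refine ⟨min (min (r / 2) (s / 2)) (min q (κ / 4 / (C + 1))), by positivity, ?_, ?_, ?_, ?_⟩
    · have : min (min (r / 2) (s / 2)) (min q (κ / 4 / (C + 1))) ≤ r / 2 :=
        (min_le_left _ _).trans (min_le_left _ _)
      linarith
    · have : min (min (r / 2) (s / 2)) (min q (κ / 4 / (C + 1))) ≤ s / 2 :=
        (min_le_left _ _).trans (min_le_right _ _)
      linarith
    · exact (min_le_right _ _).trans (min_le_left _ _)
    · have : min (min (r / 2) (s / 2)) (min q (κ / 4 / (C + 1))) ≤ κ / 4 / (C + 1) :=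
        (min_le_right _ _).trans (min_le_right _ _)
      rw [le_div_iff₀ (by positivity)] at this
      nlinarith [show 0 ≤ min (min (r / 2) (s / 2)) (min q (κ / 4 / (C + 1))) by positivity]
  have key : ∀ (σ σ' : ℝ) (u u' : State n), |σ| < t → |σ'| < t → ‖u‖ < t → ‖u'‖ < t →
      ‖ψ (σ, u) - ψ (σ', u') - ((u - u') + (σ - σ') • e)‖ ≤
        κ * max |σ - σ'| ‖u - u'‖ := by
    intro σ σ' u u' h1 h2 h3 h4
    have hd : |σ - σ'| < 2 * t := (abs_sub _ _).trans_lt (by linarith)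
    have mem : ∀ (x : ℝ) (y : State n) (R : ℝ), 2 * t ≤ R → |x| < 2 * t → ‖y‖ < t →
        (x, y) ∈ Metric.ball (0 : ℝ × State n) R := by
      intro x y R hR hx hy
      rw [mem_ball_zero_iff, Prod.norm_mk, Real.norm_eq_abs]
      exact max_lt (by linarith) (by linarith)
    have z0 : |(0 : ℝ)| < 2 * t := by rw [abs_zero]; linarith
    have k1 := H (0, u) (mem _ _ _ htr z0 h3) (σ', u) (mem _ _ _ htr (by linarith) h3)
      (σ - σ', u) (mem _ _ _ htr hd h3) (σ, u) (mem _ _ _ htr (by linarith) h3)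
    have k2 := H (0, u') (mem _ _ _ htr z0 h4) (σ', u') (mem _ _ _ htr (by linarith) h4)
      (0, u) (mem _ _ _ htr z0 h3) (σ', u) (mem _ _ _ htr (by linarith) h3)
    have k3 := Hs (σ - σ', u) (mem _ _ _ hts hd h3)
    have e1 := Hq u (by rw [mem_ball_zero_iff]; linarith)
    have e2 := Hq u' (by rw [mem_ball_zero_iff]; linarith)
    rw [e1] at k1
    rw [e1, e2] at k2
    have f1 : ((σ, u) - (σ', u) - (σ - σ', u) + (0, u) : ℝ × State n) = 0 := by
      ext <;> simp
    have f2 : ((σ', u) - (σ', u') - (0, u) + (0, u') : ℝ × State n) = 0 := by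
      ext <;> simp
    rw [f1] at k1
    rw [f2] at k2
    simp only [Prod.mk_sub_mk, sub_self, sub_zero, norm_zero, zero_add, Prod.norm_mk,
      Real.norm_eq_abs, abs_nonneg, norm_nonneg, sup_of_le_left, sup_of_le_right] at k1 k2 k3
    have m1 : |σ - σ'| ≤ max |σ - σ'| ‖u - u'‖ := le_max_left _ _
    have m2 : ‖u - u'‖ ≤ max |σ - σ'| ‖u - u'‖ := le_max_right _ _
    have n1 : C * (|σ'| * |σ - σ'|) ≤ κ / 4 * max |σ - σ'| ‖u - u'‖ := by
      calc C * (|σ'| * |σ - σ'|) ≤ C * (t * max |σ - σ'| ‖u - u'‖) := by gcongr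
        _ = C * t * max |σ - σ'| ‖u - u'‖ := by ring
        _ ≤ _ := by gcongr
    have n2 : C * (|σ'| * ‖u - u'‖) ≤ κ / 4 * max |σ - σ'| ‖u - u'‖ := by
      calc C * (|σ'| * ‖u - u'‖) ≤ C * (t * max |σ - σ'| ‖u - u'‖) := by gcongr
        _ = C * t * max |σ - σ'| ‖u - u'‖ := by ring
        _ ≤ _ := by gcongr
    have n3 : κ / 2 * |σ - σ'| ≤ κ / 2 * max |σ - σ'| ‖u - u'‖ := by gcongr
    have split : ψ (σ, u) - ψ (σ', u') - ((u - u') + (σ - σ') • e) =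
        (ψ (σ, u) - ψ (σ', u) - ψ (σ - σ', u) + u) + (ψ (σ', u) - ψ (σ', u') - u + u') +
        (ψ (σ - σ', u) - u - (σ - σ') • e) := by abel
    rw [split]
    refine (norm_add₃_le).trans ?_
    linarith
  have hb : Metric.ball ((0 : ℝ × State n), (0 : ℝ × State n)) t ∈
      𝓝 ((0 : ℝ × State n), (0 : ℝ × State n)) := Metric.ball_mem_nhds _ ht
  filter_upwards [hb] with x hx
  obtain ⟨⟨σ, u⟩, ⟨σ', u'⟩⟩ := x
  rw [mem_ball_iff_norm, show (((0 : ℝ × State n), (0 : ℝ × State n))) = 0 from rfl,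
    sub_zero] at hx
  simp only [Prod.norm_mk, max_lt_iff, Real.norm_eq_abs] at hx
  simpa [sub_smul] using key σ σ' u u' hx.1.1 hx.2.1 hx.1.2 hx.2.2

/-- The state reached from `x.2` after the first `k` waves of sizes `x.1`. -/
def fanState (ψ : Fin n → ℝ × State n → State n) (x : (Fin n → ℝ) × State n) : ℕ → State n
  | 0 => x.2
  | k + 1 => if h : k < n then ψ ⟨k, h⟩ (x.1 ⟨k, h⟩, fanState ψ x k) else fanState ψ x k

variable {P : System n} {ψ : Fin n → ℝ × State n → State n}
  {b : Module.Basis (Fin n) ℝ (State n)}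

theorem fanState_zero (x : (Fin n → ℝ) × State n) : fanState ψ x 0 = x.2 := rfl

theorem fanState_succ (x : (Fin n → ℝ) × State n) (j : Fin n) :
    fanState ψ x (j + 1) = ψ j (x.1 j, fanState ψ x j) := by
  rw [fanState, dif_pos j.2]

theorem fanState_congr {σ τ : Fin n → ℝ} (u : State n) {k : ℕ}
    (h : ∀ i : Fin n, (i : ℕ) < k → σ i = τ i) :
    fanState ψ (σ, u) k = fanState ψ (τ, u) k := by
  induction k with
  | zero => rfl
  | succ k ih =>
    have ih' := ih fun i hi => h i (by omega)
    simp only [fanState]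
    split_ifs with hk
    · rw [ih', h ⟨k, hk⟩ (Nat.lt_succ_self k)]
    · exact ih'

theorem fanState_at_zero (H : ∀ j, LaxCurve P j (ψ j) (b j)) (k : ℕ) :
    fanState ψ 0 k = 0 := by
  induction k with
  | zero => rfl
  | succ k ih =>
    simp only [fanState, ih]
    split_ifs with hk
    · exact (H ⟨k, hk⟩).zero.self_of_nhds
    · rfl

theorem fourPointAt_fanState (H : ∀ j, LaxCurve P j (ψ j) (b j)) (k : ℕ) :
    FourPointAt (fun x => fanState ψ x k) 0 := by
  induction k with
  | zero => exact FourPointAt.of_contDiffAt contDiffAt_snd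
  | succ k ih =>
    by_cases hk : k < n
    · simp only [fanState, dif_pos hk]
      have h1 : FourPointAt (fun x : (Fin n → ℝ) × State n => x.1 ⟨k, hk⟩) 0 := by
        refine FourPointAt.of_contDiffAt ?_
        fun_prop
      have h2 := h1.prodMk ih
      refine FourPointAt.comp (φ := ψ ⟨k, hk⟩) ?_ h2
      have e : (((0 : (Fin n → ℝ) × State n).1 ⟨k, hk⟩, fanState ψ 0 k) : ℝ × State n) = 0 := by
        rw [fanState_at_zero H]; rfl
      rw [e]
      exact (H ⟨k, hk⟩).fourPointAt
    · simpa only [fanState, dif_neg hk] using ih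

theorem tendsto_fanState (H : ∀ j, LaxCurve P j (ψ j) (b j)) (k : ℕ) :
    Tendsto (fun x => fanState ψ x k) (𝓝 0) (𝓝 0) := by
  have := (fourPointAt_fanState H k).continuousAt.tendsto
  rwa [fanState_at_zero H] at this

theorem hasStrictFDerivAt_fanState (H : ∀ j, LaxCurve P j (ψ j) (b j)) (k : ℕ) :
    ∃ L : ((Fin n → ℝ) × State n) →L[ℝ] State n,
      HasStrictFDerivAt (fun x => fanState ψ x k) L 0 ∧
      ∀ x, L x = x.2 + ∑ j : Fin n, if (j : ℕ) < k then x.1 j • b j else 0 := by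
  induction k with
  | zero => exact ⟨ContinuousLinearMap.snd ℝ _ _, hasStrictFDerivAt_snd, fun x => by simp⟩
  | succ k ih =>
    obtain ⟨L, hL, hLx⟩ := ih
    by_cases hk : k < n
    · simp only [fanState, dif_pos hk]
      have h1 : HasStrictFDerivAt (fun x : (Fin n → ℝ) × State n => x.1 ⟨k, hk⟩)
          ((ContinuousLinearMap.proj (R := ℝ) (φ := fun _ : Fin n => ℝ) ⟨k, hk⟩).comp
            (ContinuousLinearMap.fst ℝ (Fin n → ℝ) (State n))) 0 :=
        ((ContinuousLinearMap.proj (R := ℝ) (φ := fun _ : Fin n => ℝ) ⟨k, hk⟩).comp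
          (ContinuousLinearMap.fst ℝ (Fin n → ℝ) (State n))).hasStrictFDerivAt
      have h2 := h1.prodMk hL
      have e : (((0 : (Fin n → ℝ) × State n).1 ⟨k, hk⟩, fanState ψ 0 k) : ℝ × State n) = 0 := by
        rw [fanState_at_zero H]; rfl
      have h3 := (H ⟨k, hk⟩).hasStrictFDerivAt
      rw [← e] at h3
      refine ⟨_, HasStrictFDerivAt.comp (g := ψ ⟨k, hk⟩) 0 h3 h2, fun x => ?_⟩
      have e2 : ∀ j : Fin n, (if (j : ℕ) < k + 1 then x.1 j • b j else 0) =
          (if (j : ℕ) < k then x.1 j • b j else 0) +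
            if j = ⟨k, hk⟩ then x.1 j • b j else 0 := by
        intro j
        rcases lt_trichotomy (j : ℕ) k with hj | hj | hj
        · simp [hj, hj.trans (Nat.lt_succ_self k), Fin.ext_iff, hj.ne]
        · simp [hj, Fin.ext_iff]
        · simp [hj.not_gt, Fin.ext_iff, hj.ne', show ¬ (j : ℕ) < k + 1 by omega]
      simp only [e2, Finset.sum_add_distrib, Finset.sum_ite_eq', Finset.mem_univ, if_true]
      simp [hLx, add_assoc]
    · refine ⟨L, by simpa only [fanState, dif_neg hk] using hL, fun x => ?_⟩
      rw [hLx]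
      congr 1
      refine Finset.sum_congr rfl fun j _ => ?_
      rw [if_pos (by omega), if_pos (by omega)]

/-- Near the origin the map `x ↦ fanState ψ x n` can be solved for the sizes of the waves. -/
theorem exists_riemannSolver (H : ∀ j, LaxCurve P j (ψ j) (b j)) :
    ∃ S : State n × State n → Fin n → ℝ, FourPointAt S 0 ∧
      (∀ᶠ x in 𝓝 (0 : (Fin n → ℝ) × State n), S (x.2, fanState ψ x n) = x.1) ∧
      ∀ᶠ y in 𝓝 (0 : State n × State n), fanState ψ (S y, y.1) n = y.2 := by
  obtain ⟨L, hL, hLx⟩ := hasStrictFDerivAt_fanState H n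
  -- The derivative at the origin of `x ↦ (x.2, fanState ψ x n)`, invertible because the tangents `b
  -- j` form a basis.
  let A : ((Fin n → ℝ) × State n) ≃L[ℝ] (State n × State n) :=
    LinearEquiv.toContinuousLinearEquiv
      { toFun := fun x => (x.2, x.2 + b.equivFun.symm x.1)
        invFun := fun y => (b.equivFun (y.2 - y.1), y.1)
        left_inv := fun x => by
          simp only [add_sub_cancel_left, LinearEquiv.apply_symm_apply]
        right_inv := fun y => by
          simp only [LinearEquiv.symm_apply_apply, add_sub_cancel]
        map_add' := fun x y => by
          simp only [Prod.fst_add, Prod.snd_add, map_add, Prod.mk_add_mk, add_add_add_comm]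
        map_smul' := fun c x => by
          simp only [Prod.smul_fst, Prod.smul_snd, map_smul, Prod.smul_mk, smul_add,
            RingHom.id_apply] }
  have hs : HasStrictFDerivAt (fun x : (Fin n → ℝ) × State n => (x.2, fanState ψ x n))
      (A : ((Fin n → ℝ) × State n) →L[ℝ] (State n × State n)) 0 := by
    refine (hasStrictFDerivAt_snd.prodMk hL).congr_fderiv ?_
    refine ContinuousLinearMap.ext fun x => ?_
    simp [A, hLx, Module.Basis.equivFun_symm_apply]
  have hf : FourPointAt (fun x : (Fin n → ℝ) × State n => (x.2, fanState ψ x n)) 0 :=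
    FourPointAt.prodMk (FourPointAt.of_contDiffAt contDiffAt_snd) (fourPointAt_fanState H n)
  have hz : ((0 : (Fin n → ℝ) × State n).2, fanState ψ (0 : (Fin n → ℝ) × State n) n) = 0 := by
    rw [fanState_at_zero H]; rfl
  have hg := hf.localInverse hs
  have h1 := hs.eventually_left_inverse
  have h2 := hs.eventually_right_inverse
  rw [hz] at hg h2
  refine ⟨fun y => (hs.localInverse _ _ _ y).1, ?_, ?_, ?_⟩
  · exact FourPointAt.comp (φ := Prod.fst) (FourPointAt.of_contDiffAt contDiffAt_fst) hg
  · filter_upwards [h1] with x hx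
    rw [hx]
  · filter_upwards [h2] with y hy
    obtain ⟨k1, k2⟩ := Prod.ext_iff.1 hy
    simp only at k1 k2
    rw [← k1]
    exact k2

theorem LaxCurve.zero_eventually_fanState (H : ∀ j, LaxCurve P j (ψ j) (b j)) :
    ∀ᶠ x in 𝓝 (0 : (Fin n → ℝ) × State n), ∀ (j : Fin n) (k : Fin (n + 1)),
      ψ j (0, fanState ψ x k) = fanState ψ x k := by
  refine eventually_all.2 fun j => eventually_all.2 fun k => ?_
  exact (tendsto_fanState H k).eventually (H j).zero

/-- Waves of size zero do not move the state, so a fan without waves from the `k`-th family on ends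
after its first `k` waves. -/
theorem fanState_eq_of_eq_zero {x : (Fin n → ℝ) × State n}
    (h : ∀ (j : Fin n) (k : Fin (n + 1)), ψ j (0, fanState ψ x k) = fanState ψ x k)
    {k : ℕ} (hx : ∀ i : Fin n, k ≤ i → x.1 i = 0) (hk : k ≤ n) :
    fanState ψ x n = fanState ψ x k := by
  have : ∀ m, k ≤ m → m ≤ n → fanState ψ x m = fanState ψ x k := by
    intro m hkm
    induction m, hkm using Nat.le_induction with
    | base => exact fun _ => rfl
    | succ m hkm ih =>
      intro hm
      have e := fanState_succ (ψ := ψ) x ⟨m, hm⟩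
      have e2 := h ⟨m, hm⟩ ⟨m, by omega⟩
      simp only at e e2
      rw [e, hx ⟨m, hm⟩ hkm, e2, ih (by omega)]
  exact this n hk le_rfl

end Glimm

/-! ### The interaction estimate -/

namespace Glimm

variable {n : ℕ}

/-- A wave of size `s` of the `i`-th family, on the left, approaches a wave of size `t` of the
`j`-th family, on the right. The genuinely nonlinear families are those satisfying `N`. -/
def Approach (N : Fin n → Prop) (i j : Fin n) (s t : ℝ) : Prop :=
  j < i ∨ (i = j ∧ N i ∧ min s t < 0)

open Classical in
/-- The total size of the waves in `σ` approaching a wave of size `t` of the `j`-th family. -/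
noncomputable def approachingSize (N : Fin n → Prop) (σ : Fin n → ℝ) (j : Fin n) (t : ℝ) : ℝ :=
  ∑ i, if Approach N i j (σ i) t then |σ i| else 0

open Classical in
/-- The amount of interaction between the waves `σ`, on the left, and `τ`, on the right. -/
noncomputable def interaction (N : Fin n → Prop) (σ τ : Fin n → ℝ) : ℝ :=
  ∑ i, ∑ j, if Approach N i j (σ i) (τ j) then |σ i * τ j| else 0

variable {N : Fin n → Prop}

theorem approachingSize_nonneg (σ : Fin n → ℝ) (j : Fin n) (t : ℝ) :
    0 ≤ approachingSize N σ j t :=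
  Finset.sum_nonneg fun i _ => by split_ifs <;> positivity

theorem interaction_eq (σ τ : Fin n → ℝ) :
    interaction N σ τ = ∑ j, |τ j| * approachingSize N σ j (τ j) := by
  rw [interaction, Finset.sum_comm]
  refine Finset.sum_congr rfl fun j _ => ?_
  rw [approachingSize, Finset.mul_sum]
  refine Finset.sum_congr rfl fun i _ => ?_
  split_ifs
  · rw [abs_mul, mul_comm]
  · rw [mul_zero]

theorem mul_approachingSize_le_interaction (σ τ : Fin n → ℝ) (j : Fin n) :
    |τ j| * approachingSize N σ j (τ j) ≤ interaction N σ τ := by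
  rw [interaction_eq]
  exact Finset.single_le_sum (f := fun j => |τ j| * approachingSize N σ j (τ j))
    (fun i _ => mul_nonneg (abs_nonneg _) (approachingSize_nonneg _ _ _)) (Finset.mem_univ j)

variable {P : System n} {ψ : Fin n → ℝ × State n → State n}
  {b : Module.Basis (Fin n) ℝ (State n)} {S : State n × State n → Fin n → ℝ}

theorem tendsto_fanState_comp {α : Type*} {l : Filter α} (H : ∀ j, LaxCurve P j (ψ j) (b j))
    {f : α → Fin n → ℝ} {g : α → State n} (hf : Tendsto f l (𝓝 0)) (hg : Tendsto g l (𝓝 0))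
    (k : ℕ) : Tendsto (fun x => fanState ψ (f x, g x) k) l (𝓝 0) :=
  (tendsto_fanState H k).comp (hf.prodMk_nhds hg)

/-- The interaction estimate for a single wave on the right. Let `τ₀` be the waves of `τ` that do
not approach `t`. The outgoing waves of `(τ, 0)`, `(τ₀, 0)` and `(τ₀, t)` are known exactly, so the
error for `(τ, t)` is a second difference and is bounded by `C |t| ‖τ - τ₀‖`. -/
theorem exists_norm_add_wave_le (H : ∀ j, LaxCurve P j (ψ j) (b j)) (hS : FourPointAt S 0)
    (hS' : ∀ᶠ x in 𝓝 (0 : (Fin n → ℝ) × State n), S (x.2, fanState ψ x n) = x.1) (j : Fin n) :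
    ∃ C, 0 ≤ C ∧ ∀ᶠ x in 𝓝 (0 : ((Fin n → ℝ) × ℝ) × State n),
      ‖S (x.2, ψ j (x.1.2, fanState ψ (x.1.1, x.2) n)) - x.1.1 - Pi.single j x.1.2‖ ≤
        C * (|x.1.2| * approachingSize (GenuinelyNonlinear P.Ω P.f) x.1.1 j x.1.2) := by
  classical
  have T1 : Tendsto (fun x : ((Fin n → ℝ) × ℝ) × State n => x.1.1) (𝓝 0) (𝓝 0) :=
    Continuous.tendsto' (by fun_prop) _ _ rfl
  have T2 : Tendsto (fun x : ((Fin n → ℝ) × ℝ) × State n => x.1.2) (𝓝 0) (𝓝 0) :=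
    Continuous.tendsto' (by fun_prop) _ _ rfl
  have T3 : Tendsto (fun x : ((Fin n → ℝ) × ℝ) × State n => x.2) (𝓝 0) (𝓝 0) :=
    Continuous.tendsto' (by fun_prop) _ _ rfl
  have T4 : Tendsto (fun x : ((Fin n → ℝ) × ℝ) × State n => x.1.1 + Pi.single j x.1.2)
      (𝓝 0) (𝓝 0) := by
    have : Continuous fun x : ((Fin n → ℝ) × ℝ) × State n =>
        x.1.1 + (Pi.single j x.1.2 : Fin n → ℝ) := by
      have := (continuous_single (A := fun _ : Fin n => ℝ) j)
      fun_prop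
    exact this.tendsto' _ _ (by simp)
  have F1 := (T1.prodMk_nhds T3).eventually hS'
  have F2 := (T1.prodMk_nhds T3).eventually (LaxCurve.zero_eventually_fanState H)
  have F3 := (((T2.prodMk_nhds (tendsto_pi_nhds.1 T1 j)).prodMk_nhds
    (tendsto_fanState_comp H T1 T3 j))).eventually (H j).add
  have F4 := (T4.prodMk_nhds T3).eventually hS'
  have F5 := (T4.prodMk_nhds T3).eventually (LaxCurve.zero_eventually_fanState H)
  have hG : FourPointAt (fun x : ((Fin n → ℝ) × ℝ) × State n =>
      S (x.2, ψ j (x.1.2, fanState ψ (x.1.1, x.2) n))) 0 := by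
    have g1 : FourPointAt (fun x : ((Fin n → ℝ) × ℝ) × State n => (x.1.1, x.2)) 0 :=
      FourPointAt.of_contDiffAt (by fun_prop)
    have g2 : FourPointAt (fun x : ((Fin n → ℝ) × ℝ) × State n => x.1.2) 0 :=
      FourPointAt.of_contDiffAt (by fun_prop)
    have g3 : FourPointAt (fun x : ((Fin n → ℝ) × ℝ) × State n => x.2) 0 :=
      FourPointAt.of_contDiffAt (by fun_prop)
    have g4 : FourPointAt (fun x : ((Fin n → ℝ) × ℝ) × State n =>
        fanState ψ (x.1.1, x.2) n) 0 :=
      FourPointAt.comp (φ := fun x => fanState ψ x n) (fourPointAt_fanState H n) g1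
    have e1 : fanState ψ ((0 : ((Fin n → ℝ) × ℝ) × State n).1.1,
        (0 : ((Fin n → ℝ) × ℝ) × State n).2) n = 0 := fanState_at_zero H n
    have g5 : FourPointAt (fun x : ((Fin n → ℝ) × ℝ) × State n =>
        ψ j (x.1.2, fanState ψ (x.1.1, x.2) n)) 0 := by
      refine FourPointAt.comp (φ := ψ j) ?_ (g2.prodMk g4)
      rw [e1]
      exact (H j).fourPointAt
    refine FourPointAt.comp (φ := S) ?_ (g3.prodMk g5)
    rw [e1]
    have e2 : ψ j ((0 : ((Fin n → ℝ) × ℝ) × State n).1.2, 0) = 0 :=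
      (H j).zero.self_of_nhds
    rw [e2]
    exact hS
  obtain ⟨C, hC, r, hr, HG⟩ := hG
  obtain ⟨s, hs, Hs⟩ := Metric.eventually_nhds_iff_ball.1
    (F1.and (F2.and (F3.and (F4.and F5))))
  refine ⟨C, hC, ?_⟩
  filter_upwards [Metric.ball_mem_nhds _ (lt_min hr hs)]
  rintro ⟨⟨τ, t⟩, u⟩ hx
  obtain ⟨τ₀, hτ₀⟩ : ∃ τ₀ : Fin n → ℝ, ∀ i, τ₀ i =
    if Approach (GenuinelyNonlinear P.Ω P.f) i j (τ i) t then 0 else τ i := ⟨_, fun i => rfl⟩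
  simp only [mem_ball_zero_iff, Prod.norm_mk, max_lt_iff, lt_min_iff] at hx
  obtain ⟨⟨⟨x1, x3⟩, x5⟩, ⟨x2, x4⟩, x6⟩ := hx
  have hn : ‖τ₀‖ ≤ ‖τ‖ := by
    refine (pi_norm_le_iff_of_nonneg (norm_nonneg _)).2 fun i => ?_
    rw [hτ₀]
    split_ifs
    · simp
    · exact norm_le_pi_norm τ i
  have mem : ∀ (σ : Fin n → ℝ) (t' : ℝ), ‖σ‖ ≤ ‖τ‖ → |t'| ≤ |t| →
      ((σ, t'), u) ∈ Metric.ball (0 : ((Fin n → ℝ) × ℝ) × State n) r ∧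
      ((σ, t'), u) ∈ Metric.ball (0 : ((Fin n → ℝ) × ℝ) × State n) s := by
    intro σ t' h1 h2
    rw [← Real.norm_eq_abs, ← Real.norm_eq_abs] at h2
    simp only [mem_ball_zero_iff, Prod.norm_mk, max_lt_iff]
    refine ⟨⟨⟨?_, ?_⟩, ?_⟩, ⟨?_, ?_⟩, ?_⟩ <;> linarith
  have z0 : |(0 : ℝ)| ≤ |t| := by simp
  have k := HG _ (mem τ₀ 0 hn z0).1 _ (mem τ 0 le_rfl z0).1 _ (mem τ₀ t hn le_rfl).1
    _ (mem τ t le_rfl le_rfl).1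
  obtain ⟨a1, a2, -, -, -⟩ := Hs _ (mem τ 0 le_rfl z0).2
  obtain ⟨b1, b2, b3, b4, b5⟩ := Hs _ (mem τ₀ t hn le_rfl).2
  simp only at a1 a2 b1 b2 b3 b4 b5 k
  have c1 := a2 j (Fin.last n)
  have c2 := b2 j (Fin.last n)
  rw [Fin.val_last] at c1 c2
  have hz : ∀ i, j < i → τ₀ i = 0 := fun i hi => by
    rw [hτ₀]
    exact if_pos (Or.inl hi)
  have d1 : fanState ψ (τ₀, u) n = fanState ψ (τ₀, u) (j + 1) :=
    fanState_eq_of_eq_zero b2 (fun i hi => hz i (by rw [Fin.lt_def]; omega)) j.2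
  have d2 : fanState ψ (τ₀ + Pi.single j t, u) n =
      fanState ψ (τ₀ + Pi.single j t, u) (j + 1) := by
    refine fanState_eq_of_eq_zero b5 (fun i hi => ?_) j.2
    have hi' : j < i := by rw [Fin.lt_def]; omega
    simp [hz i hi', Pi.single_eq_of_ne hi'.ne']
  have d3 : fanState ψ (τ₀ + Pi.single j t, u) j = fanState ψ (τ₀, u) j := by
    refine fanState_congr u fun i hi => ?_
    rw [Pi.add_apply, Pi.single_eq_of_ne (by rw [ne_eq, Fin.ext_iff]; omega), add_zero]
  -- Exact superposition: families after the `j`-th are absent from `τ₀`, and within the `j`-th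
  -- either the semigroup property applies or `τ₀ j = 0`.
  have d4 : ψ j (t, fanState ψ (τ₀, u) n) = fanState ψ (τ₀ + Pi.single j t, u) n := by
    rw [d1, d2, fanState_succ, fanState_succ, d3]
    simp only [Pi.add_apply, Pi.single_eq_same]
    by_cases hA : ¬ GenuinelyNonlinear P.Ω P.f j ∨ (0 ≤ t ∧ 0 ≤ τ₀ j)
    · rw [b3 hA, add_comm]
    · have h0 : τ₀ j = 0 := by
        push Not at hA
        rw [hτ₀]
        split_ifs with h
        · rfl
        · exfalso
          refine h (Or.inr ⟨rfl, hA.1, ?_⟩)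
          rw [min_lt_iff]
          by_contra hcon
          push Not at hcon
          have := hA.2 hcon.2
          rw [hτ₀, if_neg h] at this
          exact this.not_ge hcon.1
      have b6 := b2 j j.castSucc
      rw [Fin.val_castSucc] at b6
      rw [h0, zero_add, b6]
  rw [d4, b4, c1, c2, a1, b1] at k
  have e1 : (((τ, t), u) - ((τ, 0), u) - ((τ₀, t), u) + ((τ₀, 0), u) :
      ((Fin n → ℝ) × ℝ) × State n) = 0 := by
    simp
  rw [e1] at k
  simp only [norm_zero, Prod.mk_sub_mk, sub_self, sub_zero, Prod.norm_mk, norm_nonneg, zero_add,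
    sup_of_le_left, sup_of_le_right] at k
  have e2 : S (u, ψ j (t, fanState ψ (τ, u) n)) - τ - Pi.single j t =
      S (u, ψ j (t, fanState ψ (τ, u) n)) - τ - (τ₀ + Pi.single j t) + τ₀ := by abel
  rw [e2]
  refine k.trans ?_
  rw [mul_comm |t|, ← Real.norm_eq_abs t]
  gcongr
  refine (pi_norm_le_iff_of_nonneg (approachingSize_nonneg _ _ _)).2 fun i => ?_
  refine le_trans ?_ (Finset.single_le_sum (fun i _ => ?_) (Finset.mem_univ i))
  · rw [Pi.sub_apply, hτ₀]
    split_ifs <;> simp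
  · split_ifs <;> positivity

end Glimm

/-! ### Interaction of two complete fans, and the solver `S`. -/

namespace Glimm

variable {n : ℕ} {N : Fin n → Prop}

/-- Only families `i ≥ j` can approach. If `τ i` approaches `t` and `σ i` does not, then `τ i < 0 ≤
σ i`, so `|τ i|` is itself at most the perturbation. -/
theorem approachingSize_le {σ τ : Fin n → ℝ} {j : Fin n} {t e : ℝ}
    (h : ∀ i, j ≤ i → |τ i - σ i| ≤ e) (he : 0 ≤ e) :
    approachingSize N τ j t ≤ approachingSize N σ j t + n * e := by
  classical
  have : (n : ℝ) * e = ∑ _i : Fin n, e := by simp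
  rw [this, approachingSize, approachingSize, ← Finset.sum_add_distrib]
  refine Finset.sum_le_sum fun i _ => ?_
  by_cases hτ : Approach N i j (τ i) t
  · rw [if_pos hτ]
    have hi : |τ i - σ i| ≤ e := by
      refine h i ?_
      rcases hτ with hτ | hτ
      · exact hτ.le
      · exact hτ.1.ge
    by_cases hσ : Approach N i j (σ i) t
    · rw [if_pos hσ]
      linarith [abs_sub_abs_le_abs_sub (τ i) (σ i)]
    · rw [if_neg hσ, zero_add]
      rcases hτ with hτ | hτ
      · exact absurd (Or.inl hτ) hσ
      · have h1 : ¬ min (σ i) t < 0 := fun h1 => hσ (Or.inr ⟨hτ.1, hτ.2.1, h1⟩)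
        rw [min_lt_iff, not_or, not_lt, not_lt] at h1
        have h2 : τ i < 0 := (min_lt_iff.1 hτ.2.2).resolve_right h1.2.not_gt
        rw [abs_of_neg h2]
        linarith [neg_abs_le (τ i - σ i), h1.1]
  · rw [if_neg hτ]
    split_ifs <;> positivity

theorem interaction_nonneg (σ τ : Fin n → ℝ) : 0 ≤ interaction N σ τ := by
  rw [interaction_eq]
  exact Finset.sum_nonneg fun i _ => mul_nonneg (abs_nonneg _) (approachingSize_nonneg _ _ _)

variable {P : System n} {ψ : Fin n → ℝ × State n → State n}
  {b : Module.Basis (Fin n) ℝ (State n)} {S : State n × State n → Fin n → ℝ}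

theorem solver_zero (H : ∀ j, LaxCurve P j (ψ j) (b j))
    (hS' : ∀ᶠ x in 𝓝 (0 : (Fin n → ℝ) × State n), S (x.2, fanState ψ x n) = x.1) : S 0 = 0 := by
  have := hS'.self_of_nhds
  rwa [fanState_at_zero H] at this

/-- The right fan is added one family at a time. When the `j`-th wave is added, the waves of
families `i ≥ j` are still those of the left fan up to the error made so far, so
`exists_norm_add_wave_le` costs no more than a multiple of the interaction of the two fans. -/
theorem exists_norm_fanState_le (H : ∀ j, LaxCurve P j (ψ j) (b j)) (hS : FourPointAt S 0)
    (hS' : ∀ᶠ x in 𝓝 (0 : (Fin n → ℝ) × State n), S (x.2, fanState ψ x n) = x.1)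
    (hS'' : ∀ᶠ y in 𝓝 (0 : State n × State n), fanState ψ (S y, y.1) n = y.2)
    (k : ℕ) (hk : k ≤ n) :
    ∃ K, 0 ≤ K ∧ ∀ᶠ x in 𝓝 (0 : ((Fin n → ℝ) × (Fin n → ℝ)) × State n),
      ‖S (x.2, fanState ψ (x.1.2, fanState ψ (x.1.1, x.2) n) k) - x.1.1 -
        (fun i : Fin n => if (i : ℕ) < k then x.1.2 i else 0)‖ ≤
        K * interaction (GenuinelyNonlinear P.Ω P.f) x.1.1 x.1.2 := by
  have T1 : Tendsto (fun x : ((Fin n → ℝ) × (Fin n → ℝ)) × State n => x.1.1) (𝓝 0) (𝓝 0) :=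
    Continuous.tendsto' (by fun_prop) _ _ rfl
  have T2 : Tendsto (fun x : ((Fin n → ℝ) × (Fin n → ℝ)) × State n => x.1.2) (𝓝 0) (𝓝 0) :=
    Continuous.tendsto' (by fun_prop) _ _ rfl
  have T3 : Tendsto (fun x : ((Fin n → ℝ) × (Fin n → ℝ)) × State n => x.2) (𝓝 0) (𝓝 0) :=
    Continuous.tendsto' (by fun_prop) _ _ rfl
  induction k with
  | zero =>
    refine ⟨0, le_rfl, ?_⟩
    filter_upwards [(T1.prodMk_nhds T3).eventually hS'] with x hx
    rw [fanState_zero]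
    simp only at hx ⊢
    rw [hx]
    simp [Pi.zero_def]
  | succ k ih =>
    obtain ⟨K, hK, hx⟩ := ih (by omega)
    obtain ⟨j, hj⟩ : ∃ j : Fin n, (j : ℕ) = k := ⟨⟨k, hk⟩, rfl⟩
    obtain ⟨C, hC, hC'⟩ := exists_norm_add_wave_le H hS hS' j
    have Tw := tendsto_fanState_comp H T2 (tendsto_fanState_comp H T1 T3 n) k
    have TS : Tendsto S (𝓝 0) (𝓝 0) := by
      have := hS.continuousAt.tendsto
      rwa [solver_zero H hS'] at this
    have Tτ := TS.comp (T3.prodMk_nhds Tw)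
    have Tj := tendsto_pi_nhds.1 T2 j
    refine ⟨K + C * (1 + n * K), by positivity, ?_⟩
    filter_upwards [hx, (T3.prodMk_nhds Tw).eventually hS'',
      ((Tτ.prodMk_nhds Tj).prodMk_nhds T3).eventually hC',
      Tj.eventually (Metric.closedBall_mem_nhds (0 : ℝ) one_pos)] with x h1 h2 h3 h4
    simp only [Function.comp_apply] at h1 h2 h3 h4
    rw [dist_zero_right, Real.norm_eq_abs] at h4
    obtain ⟨⟨σ, σ'⟩, u⟩ := x
    simp only at h1 h2 h3 h4 ⊢
    obtain ⟨w, hw⟩ : ∃ w, w = fanState ψ (σ', fanState ψ (σ, u) n) k := ⟨_, rfl⟩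
    rw [← hw] at h1 h2 h3
    rw [h2] at h3
    have e1 : fanState ψ (σ', fanState ψ (σ, u) n) (k + 1) = ψ j (σ' j, w) := by
      rw [hw, ← hj, fanState_succ]
    have e2 : (fun i : Fin n => if (i : ℕ) < k + 1 then σ' i else 0) =
        (fun i : Fin n => if (i : ℕ) < k then σ' i else 0) + Pi.single j (σ' j) := by
      ext i
      rcases lt_trichotomy i j with hi | hi | hi
      · have : (i : ℕ) < k := by omega
        simp [this, this.trans (Nat.lt_succ_self k), Pi.single_eq_of_ne hi.ne]
      · subst hi
        simp [hj]
      · have : ¬ (i : ℕ) < k + 1 := by omega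
        have h' : ¬ (i : ℕ) < k := by omega
        simp [this, h', Pi.single_eq_of_ne hi.ne']
    obtain ⟨D, hD⟩ : ∃ D, D = interaction (GenuinelyNonlinear P.Ω P.f) σ σ' := ⟨_, rfl⟩
    have hD0 : 0 ≤ D := hD ▸ interaction_nonneg _ _
    rw [← hD] at h1 ⊢
    have h5 : approachingSize (GenuinelyNonlinear P.Ω P.f) (S (u, w)) j (σ' j) ≤
        approachingSize (GenuinelyNonlinear P.Ω P.f) σ j (σ' j) + n * (K * D) := by
      refine approachingSize_le (fun i hi => ?_) (by positivity)
      have := (norm_le_pi_norm _ i).trans h1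
      have hi' : ¬ (i : ℕ) < k := by omega
      simpa [hi'] using this
    have h6 : |σ' j| * approachingSize (GenuinelyNonlinear P.Ω P.f) (S (u, w)) j (σ' j) ≤
        D + n * (K * D) := by
      calc _ ≤ |σ' j| * (approachingSize (GenuinelyNonlinear P.Ω P.f) σ j (σ' j) +
            n * (K * D)) := by gcongr
        _ = |σ' j| * approachingSize (GenuinelyNonlinear P.Ω P.f) σ j (σ' j) +
            |σ' j| * (n * (K * D)) := by ring
        _ ≤ D + 1 * (n * (K * D)) := by
            have := (mul_approachingSize_le_interaction (N := GenuinelyNonlinear P.Ω P.f)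
              σ σ' j).trans_eq hD.symm
            gcongr
        _ = _ := by ring
    rw [e1, e2]
    have e3 : S (u, ψ j (σ' j, w)) - σ -
        ((fun i : Fin n => if (i : ℕ) < k then σ' i else 0) + Pi.single j (σ' j)) =
        (S (u, ψ j (σ' j, w)) - S (u, w) - Pi.single j (σ' j)) +
        (S (u, w) - σ - fun i : Fin n => if (i : ℕ) < k then σ' i else 0) := by abel
    rw [e3]
    refine (norm_add_le _ _).trans ?_
    have h7 := h3.trans (mul_le_mul_of_nonneg_left h6 hC)
    linarith

theorem exists_interaction_estimate (H : ∀ j, LaxCurve P j (ψ j) (b j)) (hS : FourPointAt S 0)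
    (hS' : ∀ᶠ x in 𝓝 (0 : (Fin n → ℝ) × State n), S (x.2, fanState ψ x n) = x.1)
    (hS'' : ∀ᶠ y in 𝓝 (0 : State n × State n), fanState ψ (S y, y.1) n = y.2) :
    ∃ K, 0 ≤ K ∧ ∀ᶠ x in 𝓝 (0 : (State n × State n) × State n),
      ∑ i, |S (x.1.1, x.2) i - S (x.1.1, x.1.2) i - S (x.1.2, x.2) i| ≤
        K * interaction (GenuinelyNonlinear P.Ω P.f) (S (x.1.1, x.1.2)) (S (x.1.2, x.2)) := by
  obtain ⟨K, hK, hK'⟩ := exists_norm_fanState_le H hS hS' hS'' n le_rfl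
  have T1 : Tendsto (fun x : (State n × State n) × State n => x.1.1) (𝓝 0) (𝓝 0) :=
    Continuous.tendsto' (by fun_prop) _ _ rfl
  have T2 : Tendsto (fun x : (State n × State n) × State n => x.1.2) (𝓝 0) (𝓝 0) :=
    Continuous.tendsto' (by fun_prop) _ _ rfl
  have T3 : Tendsto (fun x : (State n × State n) × State n => x.2) (𝓝 0) (𝓝 0) :=
    Continuous.tendsto' (by fun_prop) _ _ rfl
  have TS : Tendsto S (𝓝 0) (𝓝 0) := by
    have := hS.continuousAt.tendsto
    rwa [solver_zero H hS'] at this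
  have Tab := TS.comp (T1.prodMk_nhds T2)
  have Tbc := TS.comp (T2.prodMk_nhds T3)
  refine ⟨n * K, by positivity, ?_⟩
  filter_upwards [(T1.prodMk_nhds T2).eventually hS'', (T2.prodMk_nhds T3).eventually hS'',
    ((Tab.prodMk_nhds Tbc).prodMk_nhds T1).eventually hK'] with x h1 h2 h3
  obtain ⟨⟨a, b⟩, c⟩ := x
  simp only [Function.comp_apply] at h1 h2 h3 ⊢
  rw [h1, h2] at h3
  calc ∑ i, |S (a, c) i - S (a, b) i - S (b, c) i|
      ≤ ∑ _i : Fin n, K * interaction (GenuinelyNonlinear P.Ω P.f) (S (a, b)) (S (b, c)) := by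
        refine Finset.sum_le_sum fun i _ => ?_
        have := (norm_le_pi_norm _ i).trans h3
        simpa using this
    _ = _ := by simp [mul_assoc]

/-- Confinement to a small ball makes each wave small and puts it on the local Lax curve, so every
fan allowed by the definition is a `fanState`. -/
theorem exists_waveFan_eq (H : ∀ j, LaxCurve P j (ψ j) (b j)) {κ : ℝ} (hκ : 0 < κ) :
    ∃ ε₀ > 0, ∀ ε, 0 < ε → ε ≤ ε₀ → ∀ σ um up, P.WaveFan ε σ um up →
      ‖σ‖ < κ ∧ up = fanState ψ (σ, um) n ∧ um ∈ Metric.ball 0 ε ∧ up ∈ Metric.ball 0 ε := by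
  have h : ∀ j, ∃ ε₀ > 0, ∀ ε ≤ ε₀, ∀ σ u w, P.Lax ε j σ u w → |σ| < κ ∧ w = ψ j (σ, u) :=
    fun j => (H j).unique κ hκ
  choose e he he' using h
  obtain ⟨ε₀, hε₀, hle⟩ : ∃ ε₀ > 0, ∀ j, ε₀ ≤ e j := by
    rcases isEmpty_or_nonempty (Fin n) with hn | hn
    · exact ⟨1, one_pos, fun j => hn.elim j⟩
    · refine ⟨Finset.univ.inf' Finset.univ_nonempty e, ?_, fun j => ?_⟩
      · simpa [Finset.lt_inf'_iff] using he
      · exact Finset.inf'_le _ (Finset.mem_univ j)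
  refine ⟨ε₀, hε₀, fun ε hε hεε σ um up hfan => ?_⟩
  obtain ⟨ω, hω0, hωn, hω⟩ := hfan
  have key : ∀ j, |σ j| < κ ∧ ω j.succ = ψ j (σ j, ω j.castSucc) := fun j =>
    he' j ε (hεε.trans (hle j)) _ _ _ (hω j)
  have hmem : ∀ j : Fin n, ω j.castSucc ∈ Metric.ball (0 : State n) ε ∧
      ω j.succ ∈ Metric.ball (0 : State n) ε := by
    intro j
    rcases hω j with ⟨hs, γ, h0, h1, hγ⟩ | ⟨hs, c, c', h0, h1, -, -, hc⟩
    · rw [← h0, ← h1]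
      exact ⟨(hγ 0 ⟨le_rfl, hs⟩).1.2, (hγ (σ j) ⟨hs, le_rfl⟩).1.2⟩
    · rw [← h0, ← h1]
      exact ⟨(hc 0 ⟨hs.le, le_rfl⟩).1.2, (hc (σ j) ⟨le_rfl, hs.le⟩).1.2⟩
  have hst : ∀ k (hk : k < n + 1), ω ⟨k, hk⟩ = fanState ψ (σ, um) k := by
    intro k
    induction k with
    | zero => exact fun _ => hω0
    | succ k ih =>
      intro hk
      have h1 := (key ⟨k, by omega⟩).2
      rw [Fin.succ_mk, Fin.castSucc_mk, ih (by omega)] at h1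
      rw [h1]
      exact (fanState_succ (σ, um) ⟨k, _⟩).symm
  refine ⟨(pi_norm_lt_iff hκ).2 fun j => (key j).1, ?_, ?_, ?_⟩
  · rw [← hωn]; exact hst n _
  -- Without families no curve places the end states in the ball, but then `0` is the only state.
  · cases n with
    | zero => rw [Subsingleton.elim um 0]; exact Metric.mem_ball_self hε
    | succ m => rw [← hω0]; exact (hmem 0).1
  · cases n with
    | zero => rw [Subsingleton.elim up 0]; exact Metric.mem_ball_self hε
    | succ m => rw [← hωn]; exact (hmem (Fin.last m)).2

/-- `S` extends the map `E` to all pairs of states in the ball of radius `ρ`, and satisfies the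
interaction estimate there. -/
structure RiemannSolver (P : System n) (S : State n × State n → Fin n → ℝ) (ρ K : ℝ) : Prop where
  pos : 0 < ρ
  nonneg : 0 ≤ K
  continuousAt : ∀ x ∈ Metric.ball 0 ρ, ∀ y ∈ Metric.ball 0 ρ, ContinuousAt S (x, y)
  self : ∀ x ∈ Metric.ball 0 ρ, S (x, x) = 0
  estimate : ∀ x ∈ Metric.ball 0 ρ, ∀ y ∈ Metric.ball 0 ρ, ∀ z ∈ Metric.ball 0 ρ,
    ∑ i, |S (x, z) i - S (x, y) i - S (y, z) i| ≤
      K * interaction (GenuinelyNonlinear P.Ω P.f) (S (x, y)) (S (y, z))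
  solvable : ∀ ε, 0 < ε → ε ≤ ρ → ∀ x y, P.Solvable ε x y →
    x ∈ Metric.ball 0 ρ ∧ y ∈ Metric.ball 0 ρ ∧ P.E ε x y = S (x, y)

/-- The sizes selected by `E` are small, hence lie where `S` inverts the composed Lax curves, and so
they equal the value of `S`. -/
theorem exists_riemannSolver_of_laxCurve (H : ∀ j, LaxCurve P j (ψ j) (b j)) :
    ∃ S ρ K, RiemannSolver P S ρ K := by
  obtain ⟨S, hS, hS', hS''⟩ := exists_riemannSolver H
  obtain ⟨K, hK, hest⟩ := exists_interaction_estimate H hS hS' hS''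
  have hself : ∀ᶠ x in 𝓝 (0 : State n), S (x, x) = 0 := by
    have T : Tendsto (fun x : State n => ((0 : Fin n → ℝ), x)) (𝓝 0) (𝓝 0) :=
      Continuous.tendsto' (by fun_prop) _ _ rfl
    filter_upwards [T.eventually hS', T.eventually (LaxCurve.zero_eventually_fanState H)]
      with x h1 h2
    rwa [fanState_eq_of_eq_zero h2 (k := 0) (fun i _ => rfl) (Nat.zero_le n)] at h1
  obtain ⟨κ, hκ, Hκ⟩ := Metric.eventually_nhds_iff_ball.1 hS'
  obtain ⟨ε₀, hε₀, Hε⟩ := exists_waveFan_eq H hκ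
  obtain ⟨r1, hr1, H1⟩ := Metric.eventually_nhds_iff_ball.1 hS.eventually_continuousAt
  obtain ⟨r2, hr2, H2⟩ := Metric.eventually_nhds_iff_ball.1 hself
  obtain ⟨r3, hr3, H3⟩ := Metric.eventually_nhds_iff_ball.1 hest
  obtain ⟨ρ, hρ, q0, q1, q2, q3, q4⟩ :
      ∃ ρ > 0, ρ ≤ ε₀ ∧ ρ ≤ r1 ∧ ρ ≤ r2 ∧ ρ ≤ r3 ∧ ρ ≤ κ :=
    ⟨min ε₀ (min r1 (min r2 (min r3 κ))), by positivity, by simp, by simp, by simp, by simp,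
      by simp⟩
  refine ⟨S, ρ, K, hρ, hK, fun x hx y hy => ?_, fun x hx => ?_, fun x hx y hy z hz => ?_,
    fun ε hε hερ x y hxy => ?_⟩
  · rw [mem_ball_zero_iff] at hx hy
    refine H1 _ ?_
    rw [mem_ball_zero_iff, Prod.norm_mk]
    exact max_lt (by linarith) (by linarith)
  · exact H2 x (Metric.ball_subset_ball q2 hx)
  · rw [mem_ball_zero_iff] at hx hy hz
    refine H3 ((x, y), z) ?_
    rw [mem_ball_zero_iff, Prod.norm_mk, Prod.norm_mk]
    exact max_lt (max_lt (by linarith) (by linarith)) (by linarith)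
  · have hfan : P.WaveFan ε (P.E ε x y) x y := by
      rw [System.E, dif_pos hxy]
      exact hxy.choose_spec
    obtain ⟨h1, h2, h3, h4⟩ := Hε ε hε (hερ.trans q0) _ _ _ hfan
    have i := Metric.ball_subset_ball (x := (0 : State n)) hερ
    refine ⟨i h3, i h4, ?_⟩
    have := Hκ (P.E ε x y, x) (by
      rw [mem_ball_zero_iff, Prod.norm_mk]
      refine max_lt h1 ?_
      have := i h3
      rw [mem_ball_zero_iff] at this
      linarith)
    rw [← h2] at this
    exact this.symm

end Glimm

/-! ### The functionals on finite sequences of waves -/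

namespace Glimm

variable {n : ℕ} {N : Fin n → Prop}

/-- The total strength of the waves `σ`. -/
noncomputable def strength (σ : Fin n → ℝ) : ℝ := ∑ i, |σ i|

theorem strength_nonneg (σ : Fin n → ℝ) : 0 ≤ strength σ :=
  Finset.sum_nonneg fun _ _ => abs_nonneg _

theorem strength_le_add {a b c : Fin n → ℝ} {d : ℝ} (h : ∑ i, |c i - a i - b i| ≤ d) :
    strength c ≤ strength a + strength b + d := by
  refine le_trans ?_ (add_le_add_right h _)
  rw [strength, strength, strength, ← Finset.sum_add_distrib, ← Finset.sum_add_distrib]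
  refine Finset.sum_le_sum fun i _ => ?_
  calc |c i| = |a i + b i + (c i - a i - b i)| := by ring_nf
    _ ≤ _ := abs_add_three _ _ _

-- If `s` approaches waves of the `j`-th family of every size, or of none, this is the triangle
-- inequality or trivial. Otherwise `s ≥ 0` and the contribution is `s` times the negative part of
-- the right wave, which is subadditive.
open Classical in
theorem ite_approach_le_right (i j : Fin n) (s x y z : ℝ) :
    (if Approach N i j s z then |s * z| else 0) ≤
      (if Approach N i j s x then |s * x| else 0) + (if Approach N i j s y then |s * y| else 0) +
        |s| * |z - x - y| := by
  have hx : 0 ≤ if Approach N i j s x then |s * x| else 0 := by split_ifs <;> positivity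
  have hy : 0 ≤ if Approach N i j s y then |s * y| else 0 := by split_ifs <;> positivity
  by_cases hz : Approach N i j s z
  · have tri : |s * z| ≤ |s * x| + |s * y| + |s| * |z - x - y| := by
      rw [← abs_mul]
      calc |s * z| = |s * x + s * y + s * (z - x - y)| := by ring_nf
        _ ≤ _ := abs_add_three _ _ _
    by_cases hall : j < i ∨ (i = j ∧ N i ∧ s < 0)
    · have h : ∀ t, Approach N i j s t := by
        intro t
        rcases hall with h | h
        · exact Or.inl h
        · exact Or.inr ⟨h.1, h.2.1, min_lt_iff.2 (Or.inl h.2.2)⟩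
      rw [if_pos (h x), if_pos (h y), if_pos hz]
      exact tri
    · rw [if_pos hz]
      rcases hz with hz | ⟨h1, h2, h3⟩
      · exact absurd (Or.inl hz) hall
      · have hs : 0 ≤ s := by
          by_contra hs
          exact hall (Or.inr ⟨h1, h2, not_le.1 hs⟩)
        have hzneg : z < 0 := (min_lt_iff.1 h3).resolve_left hs.not_gt
        have key : ∀ t, -(s * t) ≤ if Approach N i j s t then |s * t| else 0 := by
          intro t
          split_ifs with ht
          · exact neg_le_abs _
          · have : 0 ≤ t := by
              by_contra hcon
              exact ht (Or.inr ⟨h1, h2, min_lt_iff.2 (Or.inr (not_le.1 hcon))⟩)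
            have := mul_nonneg hs this
            linarith
        have e : |s * z| = -(s * z) := abs_of_nonpos (mul_nonpos_of_nonneg_of_nonpos hs hzneg.le)
        have k : -(s * (z - x - y)) ≤ |s| * |z - x - y| := by
          rw [← abs_mul]; exact neg_le_abs _
        rw [e]
        linarith [key x, key y]
  · rw [if_neg hz]
    positivity

-- Exchanging left and right while reversing the order of the families preserves approach. Estimates
-- in the left argument thus follow from those in the right one.
open Classical in
theorem ite_approach_comm (i j : Fin n) (s t : ℝ) :
    (if Approach N i j s t then |s * t| else 0) =
      if Approach (fun k => N k.rev) j.rev i.rev t s then |t * s| else 0 := by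
  have : Approach N i j s t ↔ Approach (fun k => N k.rev) j.rev i.rev t s := by
    simp only [Approach, Fin.rev_lt_rev, Fin.rev_inj, Fin.rev_rev, min_comm t s]
    constructor
    · rintro (h | ⟨rfl, h⟩)
      · exact Or.inl h
      · exact Or.inr ⟨rfl, h⟩
    · rintro (h | ⟨rfl, h⟩)
      · exact Or.inl h
      · exact Or.inr ⟨rfl, h⟩
  simp only [this, mul_comm]

theorem interaction_le_right (e : Fin n → ℝ) {a b c : Fin n → ℝ} {d : ℝ}
    (h : ∑ i, |c i - a i - b i| ≤ d) :
    interaction N e c ≤ interaction N e a + interaction N e b + strength e * d := by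
  refine le_trans ?_ (add_le_add_right (mul_le_mul_of_nonneg_left h (strength_nonneg e)) _)
  rw [strength, Finset.sum_mul_sum, interaction, interaction, interaction]
  simp only [← Finset.sum_add_distrib]
  exact Finset.sum_le_sum fun i _ => Finset.sum_le_sum fun j _ =>
    ite_approach_le_right i j (e i) (a j) (b j) (c j)

theorem interaction_le_left (e : Fin n → ℝ) {a b c : Fin n → ℝ} {d : ℝ}
    (h : ∑ i, |c i - a i - b i| ≤ d) :
    interaction N c e ≤ interaction N a e + interaction N b e + strength e * d := by
  classical
  refine le_trans ?_ (add_le_add_right (mul_le_mul_of_nonneg_left h (strength_nonneg e)) _)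
  rw [strength, Finset.sum_mul_sum, Finset.sum_comm, interaction, interaction, interaction]
  simp only [← Finset.sum_add_distrib]
  refine Finset.sum_le_sum fun i _ => Finset.sum_le_sum fun j _ => ?_
  rw [ite_approach_comm i j (c i), ite_approach_comm i j (a i), ite_approach_comm i j (b i)]
  exact ite_approach_le_right _ _ _ _ _ _

/-- The linear potential of a sequence of waves. -/
noncomputable def listV (l : List (Fin n → ℝ)) : ℝ := (l.map strength).sum

/-- The interaction potential of a sequence of waves. -/
noncomputable def listQ (N : Fin n → Prop) : List (Fin n → ℝ) → ℝ
  | [] => 0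
  | a :: l => (l.map (interaction N a)).sum + listQ N l

theorem listQ_nonneg (l : List (Fin n → ℝ)) : 0 ≤ listQ N l := by
  induction l with
  | nil => exact le_rfl
  | cons a l ih =>
    refine add_nonneg (List.sum_nonneg fun x hx => ?_) ih
    obtain ⟨b, -, rfl⟩ := List.mem_map.1 hx
    exact interaction_nonneg a b

theorem listV_append (l l' : List (Fin n → ℝ)) : listV (l ++ l') = listV l + listV l' := by
  simp [listV]

theorem listV_cons (a : Fin n → ℝ) (l : List (Fin n → ℝ)) :
    listV (a :: l) = strength a + listV l := by
  simp [listV]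

theorem sum_interaction_le {a b c : Fin n → ℝ} {d : ℝ} (h : ∑ i, |c i - a i - b i| ≤ d)
    (l : List (Fin n → ℝ)) :
    (l.map (interaction N c)).sum ≤
      (l.map (interaction N a)).sum + (l.map (interaction N b)).sum + d * listV l := by
  induction l with
  | nil => simp [listV]
  | cons e l ih =>
    simp only [List.map_cons, List.sum_cons, listV_cons]
    linarith [interaction_le_left (N := N) e h]

/-- The pair `a, b` disappears together with its interaction, while each other wave sees `c` as `a`
and `b` up to the error `d`. -/
theorem listQ_merge_le {a b c : Fin n → ℝ} {d : ℝ} (h : ∑ i, |c i - a i - b i| ≤ d)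
    (l l' : List (Fin n → ℝ)) :
    listQ N (l ++ c :: l') + interaction N a b ≤
      listQ N (l ++ a :: b :: l') + d * (listV l + listV l') := by
  induction l with
  | nil =>
    simp only [List.nil_append, listQ, List.map_cons, List.sum_cons]
    have := sum_interaction_le (N := N) h l'
    have e : listV ([] : List (Fin n → ℝ)) = 0 := rfl
    rw [e, zero_add]
    linarith
  | cons e l ih =>
    simp only [List.cons_append, listQ, List.map_append, List.map_cons, List.sum_append,
      List.sum_cons, listV_cons]
    linarith [interaction_le_right (N := N) e h]

theorem listV_merge_le {a b c : Fin n → ℝ} {d : ℝ} (h : ∑ i, |c i - a i - b i| ≤ d)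
    (l l' : List (Fin n → ℝ)) :
    listV (l ++ c :: l') ≤ listV (l ++ a :: b :: l') + d := by
  simp only [listV_append, listV_cons]
  linarith [strength_le_add h]

/-- Replacing two consecutive waves by a single one decreases the combinations of `listV` and
`listQ` where the latter has a large coefficient. -/
theorem glimm_merge_le {K α β : ℝ} (hK : 0 ≤ K) (hα : 0 ≤ α) (hβ : 2 * K * α ≤ β)
    {a b c : Fin n → ℝ} (h : ∑ i, |c i - a i - b i| ≤ K * interaction N a b)
    {l l' : List (Fin n → ℝ)} (hV : K * listV (l ++ a :: b :: l') ≤ 1 / 2) :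
    α * listV (l ++ c :: l') + β * listQ N (l ++ c :: l') ≤
      α * listV (l ++ a :: b :: l') + β * listQ N (l ++ a :: b :: l') := by
  have h1 := listV_merge_le h l l'
  have h2 := listQ_merge_le (N := N) h l l'
  have hD := interaction_nonneg (N := N) a b
  obtain ⟨D, hDe⟩ : ∃ D, D = interaction N a b := ⟨_, rfl⟩
  rw [← hDe] at h1 h2 hD
  have h3 : K * (listV l + listV l') ≤ 1 / 2 := by
    refine le_trans (mul_le_mul_of_nonneg_left ?_ hK) hV
    simp only [listV_append, listV_cons]
    linarith [strength_nonneg a, strength_nonneg b]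
  have h4 : K * D * (listV l + listV l') ≤ D / 2 := by
    calc K * D * (listV l + listV l') = D * (K * (listV l + listV l')) := by ring
      _ ≤ D * (1 / 2) := by gcongr
      _ = D / 2 := by ring
  -- Small total strength leaves a net loss `D / 2` in `listQ`. Multiplied by `β ≥ 2 K α`, it covers
  -- the gain `α K D` in the linear part.
  have h5 : listQ N (l ++ c :: l') ≤ listQ N (l ++ a :: b :: l') - D / 2 := by linarith
  have hβ0 : 0 ≤ β := le_trans (by positivity) hβ
  have h6 := mul_le_mul_of_nonneg_left h1 hα
  have h7 := mul_le_mul_of_nonneg_left h5 hβ0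
  have h8 := mul_le_mul_of_nonneg_right hβ hD
  linarith

/-- The waves in the solutions of the Riemann problems between consecutive states. -/
def waves (S : State n × State n → Fin n → ℝ) : List (State n) → List (Fin n → ℝ)
  | [] => []
  | [_] => []
  | x :: y :: l => S (x, y) :: waves S (y :: l)

variable {S : State n × State n → Fin n → ℝ}

theorem waves_cons_cons (x y : State n) (l : List (State n)) :
    waves S (x :: y :: l) = S (x, y) :: waves S (y :: l) := rfl

theorem waves_append_cons (l : List (State n)) (x : State n) (l' : List (State n)) :
    waves S (l ++ x :: l') = waves S (l ++ [x]) ++ waves S (x :: l') := by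
  induction l with
  | nil => simp [waves]
  | cons a l ih =>
    cases l with
    | nil => simp [waves]
    | cons b l =>
      simp only [List.cons_append, waves_cons_cons] at ih ⊢
      rw [ih]

variable {P : System n} {ρ K : ℝ}

/-- The functional `α V + β Q` on the sequence `0, l, 0` of states. -/
noncomputable def glimm (P : System n) (S : State n × State n → Fin n → ℝ) (α β : ℝ)
    (l : List (State n)) : ℝ :=
  α * listV (waves S (0 :: l ++ [0])) +
    β * listQ (GenuinelyNonlinear P.Ω P.f) (waves S (0 :: l ++ [0]))

/-- Erasing `y` merges the waves `S (x, y)` and `S (y, z)` into `S (x, z)`, with `x`, `z` its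
neighbours, possibly the end states `0`. The bound on `glimm P S 1 C₀` serves only to make the total
strength small. -/
theorem RiemannSolver.glimm_erase_le (R : RiemannSolver P S ρ K) {α β δ C₀ : ℝ} (hα : 0 ≤ α)
    (hβ : 2 * K * α ≤ β) (hδ : K * δ ≤ 1 / 2) (hC₀ : 0 ≤ C₀) {l l' : List (State n)} {y : State n}
    (hl : ∀ x ∈ l ++ y :: l', x ∈ Metric.ball 0 ρ)
    (h : glimm P S 1 C₀ (l ++ y :: l') < δ) :
    glimm P S α β (l ++ l') ≤ glimm P S α β (l ++ y :: l') := by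
  obtain ⟨A, x, hA⟩ : ∃ A x, (0 :: l : List (State n)) = A ++ [x] :=
    ⟨_, _, (List.dropLast_append_getLast (List.cons_ne_nil 0 l)).symm⟩
  obtain ⟨z, B, hB⟩ : ∃ z B, l' ++ [(0 : State n)] = z :: B := List.exists_cons_of_ne_nil (by simp)
  have h0 : (0 : State n) ∈ Metric.ball (0 : State n) ρ := Metric.mem_ball_self R.pos
  have hx : x ∈ Metric.ball (0 : State n) ρ := by
    have : x ∈ (0 :: l : List (State n)) := by rw [hA]; simp
    rcases List.mem_cons.1 this with h | h
    · rw [h]; exact h0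
    · exact hl x (by simp [h])
  have hy : y ∈ Metric.ball (0 : State n) ρ := hl y (by simp)
  have hz : z ∈ Metric.ball (0 : State n) ρ := by
    have : z ∈ l' ++ [(0 : State n)] := by rw [hB]; simp
    rcases List.mem_append.1 this with h | h
    · exact hl z (by simp [h])
    · rw [List.mem_singleton.1 h]; exact h0
  have e1 : (0 :: (l ++ y :: l') ++ [0] : List (State n)) = A ++ x :: y :: z :: B := by
    have : (0 :: (l ++ y :: l') ++ [0] : List (State n)) = (0 :: l) ++ y :: (l' ++ [0]) := by
      simp
    rw [this, hB, hA, List.append_assoc]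
    rfl
  have e2 : (0 :: (l ++ l') ++ [0] : List (State n)) = A ++ x :: z :: B := by
    rw [← List.cons_append, List.append_assoc, hB, hA, List.append_assoc]
    rfl
  simp only [glimm, e1, e2] at h ⊢
  rw [waves_append_cons A x (y :: z :: B), waves_cons_cons, waves_cons_cons] at h ⊢
  rw [waves_append_cons A x (z :: B), waves_cons_cons]
  refine glimm_merge_le R.nonneg hα hβ (R.estimate x hx y hy z hz) ?_
  refine le_trans (mul_le_mul_of_nonneg_left ?_ R.nonneg) hδ
  have := mul_nonneg hC₀ (listQ_nonneg (N := GenuinelyNonlinear P.Ω P.f)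
    (waves S (A ++ [x]) ++ S (x, y) :: S (y, z) :: waves S (z :: B)))
  linarith

theorem RiemannSolver.glimm_sublist_le (R : RiemannSolver P S ρ K) {α β δ C₀ : ℝ} (hα : 0 ≤ α)
    (hβ : 2 * K * α ≤ β) (hδ : K * δ ≤ 1 / 2) (hC₀ : 2 * K ≤ C₀)
    {m m' : List (State n)} (hm : m'.Sublist m) (hb : ∀ x ∈ m, x ∈ Metric.ball 0 ρ)
    (h : glimm P S 1 C₀ m < δ) :
    glimm P S α β m' ≤ glimm P S α β m := by
  have hC₀' : 0 ≤ C₀ := le_trans (by have := R.nonneg; positivity) hC₀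
  -- The prefix `l` collects the states already kept. The smallness hypothesis survives each erasure
  -- because `glimm P S 1 C₀` itself does not increase (`h2`).
  suffices ∀ l : List (State n), (∀ x ∈ l ++ m, x ∈ Metric.ball 0 ρ) →
      glimm P S 1 C₀ (l ++ m) < δ → glimm P S α β (l ++ m') ≤ glimm P S α β (l ++ m) from
    this [] hb h
  clear hb h
  induction hm with
  | slnil => exact fun _ _ _ => le_rfl
  | @cons m' m y _ ih =>
    intro l hb h
    have h1 := R.glimm_erase_le hα hβ hδ hC₀' hb h
    have h2 := R.glimm_erase_le (α := 1) (β := C₀) zero_le_one (by linarith) hδ hC₀' hb h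
    refine (ih l (fun x hx => hb x ?_) (h2.trans_lt h)).trans h1
    rcases List.mem_append.1 hx with hx | hx <;> simp [hx]
  | @cons_cons m' m y _ ih =>
    intro l hb h
    have := ih (l ++ [y])
    simp only [List.append_assoc, List.singleton_append] at this
    exact this hb h

end Glimm

/-! ### Piecewise constant functions -/

namespace Glimm

variable {n : ℕ}

/-- The function `v`, of bounded support, is constant on each interval `[p, q[` that contains no
point of `F` besides `p`. -/
structure StepOn (v : ℝ → State n) (F : Set ℝ) : Prop where
  const : ∀ y z, y ≤ z → (∀ p ∈ F, ¬ (y < p ∧ p ≤ z)) → v y = v z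
  left : ∀ y, (∀ p ∈ F, y < p) → v y = 0
  right : ∀ y, (∀ p ∈ F, p ≤ y) → v y = 0

variable {v : ℝ → State n} {F : Set ℝ}

theorem StepOn.mono (h : StepOn v F) {G : Set ℝ} (hFG : F ⊆ G) : StepOn v G :=
  ⟨fun y z hyz hp => h.const y z hyz fun p hpF => hp p (hFG hpF),
    fun y hy => h.left y fun p hp => hy p (hFG hp),
    fun y hy => h.right y fun p hp => hy p (hFG hp)⟩

theorem stepOn_sum_indicator {N : ℕ} (x : Fin (N + 1) → ℝ)
    (a : Fin N → State n) :
    StepOn (∑ α : Fin N, (Set.Ico (x α.castSucc) (x α.succ)).indicator (fun _ => a α))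
      (Set.range x) := by
  refine ⟨fun y z hyz hp => ?_, fun y hy => ?_, fun y hy => ?_⟩
  · simp only [Finset.sum_apply]
    refine Finset.sum_congr rfl fun α _ => ?_
    have h1 := hp _ ⟨α.castSucc, rfl⟩
    have h2 := hp _ ⟨α.succ, rfl⟩
    have : y ∈ Set.Ico (x α.castSucc) (x α.succ) ↔ z ∈ Set.Ico (x α.castSucc) (x α.succ) := by
      constructor
      · rintro ⟨h3, h4⟩
        refine ⟨h3.trans hyz, ?_⟩
        by_contra hcon
        exact h2 ⟨h4, not_lt.1 hcon⟩
      · rintro ⟨h3, h4⟩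
        refine ⟨?_, hyz.trans_lt h4⟩
        by_contra hcon
        exact h1 ⟨not_le.1 hcon, h3⟩
    by_cases h : y ∈ Set.Ico (x α.castSucc) (x α.succ)
    · rw [Set.indicator_of_mem h, Set.indicator_of_mem (this.1 h)]
    · rw [Set.indicator_of_notMem h, Set.indicator_of_notMem (fun h' => h (this.2 h'))]
  · simp only [Finset.sum_apply]
    refine Finset.sum_eq_zero fun α _ => Set.indicator_of_notMem (fun h => ?_) _
    exact (hy _ ⟨α.castSucc, rfl⟩).not_ge h.1
  · simp only [Finset.sum_apply]
    refine Finset.sum_eq_zero fun α _ => Set.indicator_of_notMem (fun h => ?_) _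
    exact (hy _ ⟨α.succ, rfl⟩).not_gt h.2

theorem StepOn.rightLim_eq (h : StepOn v F) (hF : F.Finite) (p : ℝ) :
    Function.rightLim v p = v p := by
  have h1 : ∀ᶠ z in 𝓝[>] p, ∀ q ∈ F, p < q → z < q :=
    (eventually_all_finite hF).2 fun q _ => by
      by_cases hq : p < q
      · filter_upwards [nhdsWithin_le_nhds (eventually_lt_nhds hq)] with z hz using fun _ => hz
      · exact Eventually.of_forall fun z hz => absurd hz hq
  refine rightLim_eq_of_tendsto (tendsto_const_nhds.congr' ?_)
  filter_upwards [h1, self_mem_nhdsWithin] with z hz hpz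
  exact h.const p z (le_of_lt hpz) fun q hq hqz => (hz q hq hqz.1).not_ge hqz.2

theorem StepOn.leftLim_eq_of_lt (h : StepOn v F) {y p : ℝ} (hyp : y < p)
    (hq : ∀ q ∈ F, ¬ (y < q ∧ q < p)) : Function.leftLim v p = v y := by
  refine leftLim_eq_of_tendsto (tendsto_const_nhds.congr' ?_)
  filter_upwards [Ioo_mem_nhdsLT hyp] with z hz
  exact h.const y z hz.1.le fun q hqF hqz => hq q hqF ⟨hqz.1, hqz.2.trans_lt hz.2⟩

theorem StepOn.leftLim_eq_of_notMem (h : StepOn v F) (hF : F.Finite) {p : ℝ} (hp : p ∉ F) :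
    Function.leftLim v p = v p := by
  have h1 : ∀ᶠ z in 𝓝[<] p, ∀ q ∈ F, q < p → q < z :=
    (eventually_all_finite hF).2 fun q _ => by
      by_cases hq : q < p
      · filter_upwards [nhdsWithin_le_nhds (eventually_gt_nhds hq)] with z hz using fun _ => hz
      · exact Eventually.of_forall fun z hz => absurd hz hq
  refine leftLim_eq_of_tendsto (tendsto_const_nhds.congr' ?_)
  filter_upwards [h1, self_mem_nhdsWithin] with z hz hpz
  refine (h.const z p (le_of_lt hpz) fun q hq hqz => ?_).symm
  have hne : q ≠ p := fun e => hp (e ▸ hq)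
  exact (hz q hq (lt_of_le_of_ne hqz.2 hne)).not_gt hqz.1

variable {S : State n × State n → Fin n → ℝ}

theorem StepOn.waves_map (h : StepOn v F) :
    ∀ (l : List ℝ) (y : ℝ), (y :: l).Pairwise (· < ·) → (∀ p ∈ F, y < p → p ∈ l) →
      waves S (v y :: l.map v) = l.map fun p => S (Function.leftLim v p, v p)
  | [], _, _, _ => rfl
  | p :: l, y, hl, hF => by
    obtain ⟨h1, h2⟩ := List.pairwise_cons.1 hl
    obtain ⟨h3, -⟩ := List.pairwise_cons.1 h2
    have hyp : y < p := h1 p (by simp)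
    have e : Function.leftLim v p = v y := by
      refine h.leftLim_eq_of_lt hyp fun q hq hqp => ?_
      rcases List.mem_cons.1 (hF q hq hqp.1) with rfl | hql
      · exact hqp.2.false
      · exact (h3 q hql).not_gt hqp.2
    have ih := StepOn.waves_map h l p h2 fun q hq hpq => by
      rcases List.mem_cons.1 (hF q hq (hyp.trans hpq)) with rfl | hql
      · exact absurd hpq (lt_irrefl _)
      · exact hql
    rw [List.map_cons, List.map_cons, waves_cons_cons, ih, e]

theorem sum_ite_lt_eq_listQ {N : Fin n → Prop} (σ : ℝ → Fin n → ℝ) :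
    ∀ l : List ℝ, l.Pairwise (· < ·) →
      (l.map fun x => (l.map fun y => if x < y then interaction N (σ x) (σ y) else 0).sum).sum =
        listQ N (l.map σ)
  | [], _ => rfl
  | p :: l, hl => by
    obtain ⟨h1, h2⟩ := List.pairwise_cons.1 hl
    have ih := sum_ite_lt_eq_listQ (N := N) σ l h2
    simp only [List.map_cons, List.sum_cons, lt_irrefl, if_false, zero_add, listQ, List.map_map]
    congr 1
    · congr 1
      exact List.map_congr_left fun y hy => if_pos (h1 y hy)
    · rw [← ih]
      congr 1
      refine List.map_congr_left fun x hx => ?_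
      rw [if_neg (h1 x hx).not_gt, zero_add]

variable {P : System n} {ρ K ε : ℝ}

theorem RiemannSolver.waveSize_eq (R : RiemannSolver P S ρ K) (hε : 0 < ε) (hερ : ε ≤ ρ)
    (hv : ∀ x, P.Solvable ε (Function.leftLim v x) (Function.rightLim v x))
    (hF : F.Finite) (h : StepOn v F) (x : ℝ) :
    P.waveSize ε v x = S (Function.leftLim v x, v x) := by
  have := (R.solvable ε hε hερ _ _ (hv x)).2.2
  rw [h.rightLim_eq hF] at this
  funext i
  rw [System.waveSize, h.rightLim_eq hF, this]

theorem RiemannSolver.mem_ball (R : RiemannSolver P S ρ K) (hε : 0 < ε) (hερ : ε ≤ ρ)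
    (hv : ∀ x, P.Solvable ε (Function.leftLim v x) (Function.rightLim v x))
    (hF : F.Finite) (h : StepOn v F) (x : ℝ) : v x ∈ Metric.ball (0 : State n) ρ := by
  have := (R.solvable ε hε hερ _ _ (hv x)).2.1
  rwa [h.rightLim_eq hF] at this

/-- Where there is no jump the waves vanish, by `RiemannSolver.self`. Lists of break points may
therefore contain superfluous points without changing `V` and `Q`. -/
theorem RiemannSolver.mem_jumps (R : RiemannSolver P S ρ K) (hε : 0 < ε) (hερ : ε ≤ ρ)
    (hv : ∀ x, P.Solvable ε (Function.leftLim v x) (Function.rightLim v x))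
    {x : ℝ} (hx : P.waveSize ε v x ≠ 0) :
    x ∈ System.jumps v := by
  intro hcon
  have e := R.solvable ε hε hερ _ _ (hv x)
  refine hx (funext fun i => ?_)
  rw [System.waveSize, e.2.2, hcon, R.self _ e.2.1]

theorem StepOn.mem_of_mem_jumps (h : StepOn v F) (hF : F.Finite) {x : ℝ}
    (hx : x ∈ System.jumps v) : x ∈ F := by
  by_contra hcon
  exact hx (by rw [h.leftLim_eq_of_notMem hF hcon, h.rightLim_eq hF])

theorem RiemannSolver.V_eq (R : RiemannSolver P S ρ K) (hε : 0 < ε) (hερ : ε ≤ ρ)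
    (hv : ∀ x, P.Solvable ε (Function.leftLim v x) (Function.rightLim v x))
    {l : List ℝ} (hl : l.Pairwise (· < ·)) (h : StepOn v {p | p ∈ l}) :
    P.V ε v = listV (l.map (P.waveSize ε v)) := by
  have hF : {p | p ∈ l}.Finite := l.finite_toSet
  rw [System.V, finsum_mem_eq_sum_of_inter_support_eq (t := l.toFinset),
    List.sum_toFinset _ hl.nodup, listV, List.map_map]
  · rfl
  · ext x
    simp only [Set.mem_inter_iff, Function.mem_support, List.coe_toFinset, Set.mem_ofPred_eq]
    refine and_congr_left fun hx => ⟨fun hj => h.mem_of_mem_jumps hF hj, fun _ => ?_⟩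
    refine R.mem_jumps hε hερ hv fun hcon => hx ?_
    simp [hcon]

theorem RiemannSolver.Q_eq (R : RiemannSolver P S ρ K) (hε : 0 < ε) (hερ : ε ≤ ρ)
    (hv : ∀ x, P.Solvable ε (Function.leftLim v x) (Function.rightLim v x))
    {l : List ℝ} (hl : l.Pairwise (· < ·)) (h : StepOn v {p | p ∈ l}) :
    P.Q ε v = listQ (GenuinelyNonlinear P.Ω P.f) (l.map (P.waveSize ε v)) := by
  classical
  have hF : {p | p ∈ l}.Finite := l.finite_toSet
  rw [System.Q, finsum_mem_eq_sum_of_inter_support_eq (t :=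
    ((l.toFinset ×ˢ Finset.univ) ×ˢ (l.toFinset ×ˢ Finset.univ)).filter fun p =>
      p.1.1 < p.2.1 ∧ Approach (GenuinelyNonlinear P.Ω P.f) p.1.2 p.2.2
        (P.waveSize ε v p.1.1 p.1.2) (P.waveSize ε v p.2.1 p.2.2)), ← sum_ite_lt_eq_listQ _ _ hl,
    Finset.sum_filter, Finset.sum_product, Finset.sum_product, ← List.sum_toFinset _ hl.nodup]
  · refine Finset.sum_congr rfl fun x _ => ?_
    simp only [Finset.sum_product]
    rw [Finset.sum_comm, ← List.sum_toFinset _ hl.nodup]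
    refine Finset.sum_congr rfl fun y _ => ?_
    by_cases hxy : x < y
    · simp only [hxy, true_and, if_true]
      rfl
    · simp [hxy]
  · ext ⟨⟨x, i⟩, ⟨y, j⟩⟩
    simp only [Set.mem_inter_iff, Function.mem_support, Finset.coe_filter, Finset.mem_product,
      List.mem_toFinset, Finset.mem_univ, and_true, Set.mem_ofPred_eq, System.approaching]
    refine and_congr_left fun hx => ?_
    have hx1 : P.waveSize ε v x ≠ 0 := fun e => hx (by simp [e])
    have hy1 : P.waveSize ε v y ≠ 0 := fun e => hx (by simp [e])
    have jx := R.mem_jumps hε hερ hv hx1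
    have jy := R.mem_jumps hε hερ hv hy1
    have lx : x ∈ l := h.mem_of_mem_jumps hF jx
    have ly : y ∈ l := h.mem_of_mem_jumps hF jy
    simp only [jx, jy, lx, ly, true_and, Approach]

/-- The end states `0` in `glimm` are the values of `v` at a point `y` before all break points and
at a point `z` after them; `z` is added to the list. -/
theorem RiemannSolver.glimm_map (R : RiemannSolver P S ρ K) (hε : 0 < ε) (hερ : ε ≤ ρ)
    (hv : ∀ x, P.Solvable ε (Function.leftLim v x) (Function.rightLim v x))
    {l : List ℝ} (hl : l.Pairwise (· < ·)) (h : StepOn v {p | p ∈ l}) (α β : ℝ) :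
    glimm P S α β (l.map v) = α * P.V ε v + β * P.Q ε v := by
  obtain ⟨z, hz⟩ : ∃ z, ∀ p ∈ l, p < z := by
    obtain ⟨b, hb⟩ := l.finite_toSet.bddAbove
    exact ⟨b + 1, fun p hp => (hb hp).trans_lt (lt_add_one b)⟩
  obtain ⟨y, hy⟩ : ∃ y, ∀ p ∈ l ++ [z], y < p := by
    obtain ⟨b, hb⟩ := (l ++ [z]).finite_toSet.bddBelow
    exact ⟨b - 1, fun p hp => (sub_one_lt b).trans_le (hb hp)⟩
  have hl' : (l ++ [z]).Pairwise (· < ·) := by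
    refine List.pairwise_append.2 ⟨hl, List.pairwise_singleton _ _, fun p hp q hq => ?_⟩
    rw [List.mem_singleton.1 hq]
    exact hz p hp
  have h' : StepOn v {p | p ∈ l ++ [z]} := h.mono fun p hp => List.mem_append_left _ hp
  have e1 := h'.waves_map (S := S) (l ++ [z]) y (List.pairwise_cons.2 ⟨hy, hl'⟩)
    fun p hp _ => hp
  rw [h'.left y fun p hp => hy p hp, List.map_append, List.map_singleton,
    h.right z fun p hp => (hz p hp).le] at e1
  have e2 : (fun p => S (Function.leftLim v p, v p)) = P.waveSize ε v :=
    funext fun x => (R.waveSize_eq hε hερ hv (l.finite_toSet) h x).symm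
  rw [glimm, List.cons_append, e1, e2, ← R.V_eq hε hερ hv hl' h', ← R.Q_eq hε hερ hv hl' h']

theorem System.V_nonneg : 0 ≤ P.V ε v :=
  finsum_nonneg fun _ => finsum_nonneg fun _ => Finset.sum_nonneg fun _ _ => abs_nonneg _

theorem System.Q_nonneg : 0 ≤ P.Q ε v := finsum_nonneg fun _ => finsum_nonneg fun _ => abs_nonneg _

end Glimm

/-! ### Lower semicontinuity -/

namespace Glimm

variable {n : ℕ}

/-- The condition `min s t < 0` is discontinuous, but `|s t|` restricted to it equals `|s t| - s⁺
t⁺`. -/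
theorem continuous_interaction (N : Fin n → Prop) :
    Continuous fun p : (Fin n → ℝ) × (Fin n → ℝ) => interaction N p.1 p.2 := by
  classical
  have key : ∀ i j : Fin n, Continuous fun p : ℝ × ℝ =>
      if Approach N i j p.1 p.2 then |p.1 * p.2| else 0 := by
    intro i j
    by_cases hij : j < i
    · have : ∀ p : ℝ × ℝ, Approach N i j p.1 p.2 := fun p => Or.inl hij
      simp only [this, if_true]
      fun_prop
    · by_cases hN : i = j ∧ N i
      · have : (fun p : ℝ × ℝ => if Approach N i j p.1 p.2 then |p.1 * p.2| else 0) =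
            fun p => |p.1 * p.2| - max p.1 0 * max p.2 0 := by
          funext p
          have iff : Approach N i j p.1 p.2 ↔ min p.1 p.2 < 0 := by
            simp [Approach, hN.1, hN.1 ▸ hN.2]
          simp only [iff, min_lt_iff]
          split_ifs with h
          · rcases h with h | h
            · rw [max_eq_right h.le, zero_mul, sub_zero]
            · rw [max_eq_right h.le, mul_zero, sub_zero]
          · push Not at h
            rw [max_eq_left h.1, max_eq_left h.2, abs_of_nonneg (mul_nonneg h.1 h.2), sub_self]
        rw [this]
        fun_prop
      · have : ∀ p : ℝ × ℝ, ¬ Approach N i j p.1 p.2 := fun p h => by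
          rcases h with h | h
          · exact hij h
          · exact hN ⟨h.1, h.2.1⟩
        simp only [this, if_false]
        exact continuous_const
  refine continuous_finsetSum _ fun i _ => continuous_finsetSum _ fun j _ => ?_
  exact (key i j).comp (by fun_prop :
    Continuous fun p : (Fin n → ℝ) × (Fin n → ℝ) => (p.1 i, p.2 j))

theorem continuous_strength : Continuous (strength : (Fin n → ℝ) → ℝ) := by
  unfold strength
  fun_prop

variable {ι A : Type*} {𝓛 : Filter ι}

theorem tendsto_list_sum {f : ι → A → ℝ} {g : A → ℝ} {l : List A}
    (h : ∀ a ∈ l, Tendsto (fun i => f i a) 𝓛 (𝓝 (g a))) :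
    Tendsto (fun i => (l.map (f i)).sum) 𝓛 (𝓝 (l.map g).sum) := by
  induction l with
  | nil => exact tendsto_const_nhds
  | cons a l ih =>
    simp only [List.map_cons, List.sum_cons]
    exact (h a (by simp)).add (ih fun b hb => h b (by simp [hb]))

theorem tendsto_listV {s : ι → A → Fin n → ℝ} {s₀ : A → Fin n → ℝ} {l : List A}
    (h : ∀ a ∈ l, Tendsto (fun i => s i a) 𝓛 (𝓝 (s₀ a))) :
    Tendsto (fun i => listV (l.map (s i))) 𝓛 (𝓝 (listV (l.map s₀))) := by
  simp only [listV, List.map_map]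
  exact tendsto_list_sum fun a ha => (continuous_strength.tendsto _).comp (h a ha)

theorem tendsto_listQ {N : Fin n → Prop} {s : ι → A → Fin n → ℝ} {s₀ : A → Fin n → ℝ} {l : List A}
    (h : ∀ a ∈ l, Tendsto (fun i => s i a) 𝓛 (𝓝 (s₀ a))) :
    Tendsto (fun i => listQ N (l.map (s i))) 𝓛 (𝓝 (listQ N (l.map s₀))) := by
  induction l with
  | nil => exact tendsto_const_nhds
  | cons a l ih =>
    simp only [List.map_cons, listQ, List.map_map]
    refine Tendsto.add (tendsto_list_sum fun b hb => ?_) (ih fun b hb => h b (by simp [hb]))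
    have hab := (h a (by simp)).prodMk_nhds (h b (by simp [hb]))
    simpa only [Function.comp_def] using
      ((continuous_interaction N).tendsto (s₀ a, s₀ b)).comp hab

variable {S : State n × State n → Fin n → ℝ}

theorem waves_map_eq (t : A → State n) (l : List A) :
    waves S (l.map t) = (l.zip l.tail).map fun p => S (t p.1, t p.2) := by
  induction l with
  | nil => rfl
  | cons a l ih =>
    cases l with
    | nil => rfl
    | cons b l =>
      simp only [List.map_cons, waves_cons_cons, List.tail_cons, List.zip_cons_cons] at ih ⊢
      rw [ih]

variable {P : System n} {ρ K : ℝ}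

theorem RiemannSolver.tendsto_glimm (R : RiemannSolver P S ρ K) (α β : ℝ) {s : ι → A → State n}
    {s₀ : A → State n} {l : List A} (h : ∀ a ∈ l, Tendsto (fun i => s i a) 𝓛 (𝓝 (s₀ a)))
    (hs₀ : ∀ a ∈ l, s₀ a ∈ Metric.ball 0 ρ) :
    Tendsto (fun i => glimm P S α β (l.map (s i))) 𝓛 (𝓝 (glimm P S α β (l.map s₀))) := by
  -- The label `none` stands for the fixed end states, so that the whole sequence is the image of
  -- one list of labels.
  have e : ∀ t : A → State n, (0 :: l.map t ++ [0] : List (State n)) =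
      (none :: l.map some ++ [none]).map fun a : Option A => a.elim 0 t := by
    intro t
    simp [Function.comp_def]
  have hlim : ∀ a ∈ (none :: l.map some ++ [none]), Tendsto (fun i => a.elim 0 (s i)) 𝓛
      (𝓝 (a.elim 0 s₀)) ∧ a.elim 0 s₀ ∈ Metric.ball 0 ρ := by
    intro a ha
    cases a with
    | none => exact ⟨tendsto_const_nhds, Metric.mem_ball_self R.pos⟩
    | some a =>
      have : a ∈ l := by simpa using ha
      exact ⟨h a this, hs₀ a this⟩
  have hS : ∀ p ∈ ((none :: l.map some ++ [none]).zip (none :: l.map some ++ [none]).tail),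
      Tendsto (fun i => S (p.1.elim 0 (s i), p.2.elim 0 (s i))) 𝓛
        (𝓝 (S (p.1.elim 0 s₀, p.2.elim 0 s₀))) := by
    rintro ⟨a, b⟩ hp
    obtain ⟨h1, h2⟩ := List.of_mem_zip hp
    obtain ⟨h3, h4⟩ := hlim a h1
    obtain ⟨h5, h6⟩ := hlim b (List.mem_of_mem_tail h2)
    exact (R.continuousAt _ h4 _ h6).tendsto.comp (h3.prodMk_nhds h5)
  simp only [glimm, e, waves_map_eq]
  exact ((tendsto_listV hS).const_mul α).add ((tendsto_listQ hS).const_mul β)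

theorem RiemannSolver.exists_glimm_gt (R : RiemannSolver P S ρ K) (α β : ℝ) (u : A → State n)
    (l : List A) (hu : ∀ a ∈ l, u a ∈ Metric.ball 0 ρ) {κ : ℝ} (hκ : 0 < κ) :
    ∃ r > 0, ∀ s : A → State n, (∀ a ∈ l, ‖s a - u a‖ < r) →
      glimm P S α β (l.map u) - κ < glimm P S α β (l.map s) := by
  obtain ⟨g, hg⟩ : ∃ g : (A → State n) → ℝ, ∀ s, g s = (l.map fun a => ‖s a - u a‖).sum :=
    ⟨_, fun s => rfl⟩
  have h1 : ∀ a ∈ l, Tendsto (fun s : A → State n => s a) (comap g (𝓝 0)) (𝓝 (u a)) := by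
    intro a ha
    refine tendsto_iff_norm_sub_tendsto_zero.2 ?_
    refine squeeze_zero (fun s => norm_nonneg _) (fun s => ?_) tendsto_comap
    rw [hg]
    refine List.single_le_sum (fun x hx => ?_) _ (List.mem_map.2 ⟨a, ha, rfl⟩)
    obtain ⟨b, -, rfl⟩ := List.mem_map.1 hx
    exact norm_nonneg _
  have h2 := (R.tendsto_glimm α β h1 hu).eventually (lt_mem_nhds (sub_lt_self _ hκ))
  obtain ⟨r, hr, hr'⟩ := Metric.eventually_nhds_iff.1 (eventually_comap.1 h2)
  refine ⟨r / (l.length + 1), by positivity, fun s hs => hr' ?_ s rfl⟩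
  have h3 : g s ≤ l.length * (r / (l.length + 1)) := by
    rw [hg]
    refine (List.sum_le_card_nsmul _ (r / (l.length + 1)) fun x hx => ?_).trans (by simp)
    obtain ⟨b, hb, rfl⟩ := List.mem_map.1 hx
    exact (hs b hb).le
  have h4 : 0 ≤ g s := by
    rw [hg]
    refine List.sum_nonneg fun x hx => ?_
    obtain ⟨b, -, rfl⟩ := List.mem_map.1 hx
    exact norm_nonneg _
  rw [dist_zero_right, Real.norm_of_nonneg h4]
  refine h3.trans_lt ?_
  rw [← mul_div_assoc, div_lt_iff₀ (by positivity)]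
  nlinarith

/-- Chebyshev: if `‖w‖ ≥ r` on the whole interval, the `L¹` norm is at least `r (b - a)`. -/
theorem exists_norm_lt_of_eLpNorm_lt {w : ℝ → State n} {a b r : ℝ} (hr : 0 < r)
    (h : eLpNorm w 1 volume < ENNReal.ofReal (r * (b - a))) :
    ∃ y ∈ Set.Ico a b, ‖w y‖ < r := by
  by_contra hcon
  push Not at hcon
  refine h.not_ge ?_
  rw [eLpNorm_one_eq_lintegral_enorm, ENNReal.ofReal_mul hr.le, ← Real.volume_Ico,
    ← lintegral_indicator_const measurableSet_Ico]
  refine lintegral_mono fun y => ?_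
  by_cases hy : y ∈ Set.Ico a b
  · rw [Set.indicator_of_mem hy, ← ofReal_norm]
    exact ENNReal.ofReal_le_ofReal (hcon y hy)
  · rw [Set.indicator_of_notMem hy]
    exact zero_le

theorem IsPiecewiseConstant.exists_list {v : ℝ → State n} (hv : IsPiecewiseConstant v)
    (l : List ℝ) : ∃ m : List ℝ, m.Pairwise (· < ·) ∧ StepOn v {p | p ∈ m} ∧ l ⊆ m := by
  obtain ⟨N, x, a, -, rfl⟩ := hv
  have e : ∀ p, p ∈ (Finset.univ.image x ∪ l.toFinset).sort ↔ p ∈ Set.range x ∨ p ∈ l := by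
    intro p
    simp
  refine ⟨(Finset.univ.image x ∪ l.toFinset).sort, (Finset.sortedLT_sort _).pairwise, ?_, ?_⟩
  · exact (stepOn_sum_indicator x a).mono fun p hp => (e p).2 (Or.inl hp)
  · exact fun p hp => (e p).2 (Or.inr hp)

theorem exists_gap (l : List ℝ) : ∃ d > 0, ∀ p ∈ l, ∀ q ∈ l, p < q → p + d ≤ q := by
  have h : ∀ᶠ d in 𝓝[>] (0 : ℝ), ∀ p ∈ l, ∀ q ∈ l, p < q → p + d ≤ q := by
    refine (eventually_all_finite l.finite_toSet).2 fun p _ =>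
      (eventually_all_finite l.finite_toSet).2 fun q _ => ?_
    by_cases hpq : p < q
    · filter_upwards [nhdsWithin_le_nhds (eventually_lt_nhds (sub_pos.2 hpq))] with d hd _
      linarith
    · exact Eventually.of_forall fun d h => absurd h hpq
  obtain ⟨d, hd, hd0⟩ := (h.and self_mem_nhdsWithin).exists
  exact ⟨d, hd0, hd⟩

/-- The lower bound behind both limits: sample `v` near the break points of `u`, discard its other
values, and use continuity for the sampled sequence. -/
theorem RiemannSolver.exists_lt_of_mem_B (R : RiemannSolver P S ρ K) {ε C₀ δ α β κ : ℝ}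
    (hε : 0 < ε) (hερ : ε ≤ ρ) (hC₀ : 2 * K ≤ C₀) (hδ : K * δ ≤ 1 / 2) (hα : 0 ≤ α)
    (hβ : 2 * K * α ≤ β) (hκ : 0 < κ) {u : ℝ → State n} (hu : u ∈ P.Dstar ε C₀ δ) :
    ∃ η > 0, ∀ v ∈ P.B ε C₀ δ η u,
      α * P.V ε u + β * P.Q ε u - κ < α * P.V ε v + β * P.Q ε v := by
  obtain ⟨hu1, -, hu3, -⟩ := hu
  obtain ⟨l, hl, hlu, -⟩ := hu1.exists_list []
  obtain ⟨d, hd, hgap⟩ := exists_gap l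
  obtain ⟨r, hr, hr'⟩ := R.exists_glimm_gt α β u l
    (fun p _ => R.mem_ball hε hερ hu3 l.finite_toSet hlu p) hκ
  refine ⟨r * d, by positivity, fun v hv => ?_⟩
  obtain ⟨⟨hv1, -, hv3, hv4⟩, hvu⟩ := hv
  -- The gap `d` between break points keeps the samples in order, and `u (y p) = u p` for each break
  -- point `p`. The radius `η = r d` is the Chebyshev bound on an interval of length `d`.
  have hy : ∀ p, ∃ y ∈ Set.Ico p (p + d), ‖(v - u) y‖ < r := fun p =>
    exists_norm_lt_of_eLpNorm_lt hr (by rwa [add_sub_cancel_left])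
  choose y hyp hyr using hy
  have hym : (l.map y).Pairwise (· < ·) := by
    refine List.pairwise_map.2 (hl.imp_of_mem fun {p q} hp hq hpq => ?_)
    exact (hyp p).2.trans_le ((hgap p hp q hq hpq).trans (hyp q).1)
  have huy : ∀ p ∈ l, u (y p) = u p := by
    intro p hp
    refine (hlu.const p (y p) (hyp p).1 fun q hq hpq => ?_).symm
    exact (hgap p hp q hq hpq.1).not_gt (hpq.2.trans_lt (hyp p).2)
  -- The samples are added to the break points of `v`, so that the sampled values form a sublist of
  -- all its values.
  obtain ⟨m, hm, hmv, hlm⟩ := hv1.exists_list (l.map y)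
  have hsub : (l.map y).Sublist m :=
    List.sublist_of_subperm_of_pairwise (r := (· ≤ ·)) (List.subperm_of_subset hym.nodup hlm)
      (hym.imp le_of_lt) (hm.imp le_of_lt)
  have h1 := R.glimm_sublist_le (C₀ := C₀) hα hβ hδ hC₀ (hsub.map v)
    (fun x hx => by
      obtain ⟨p, -, rfl⟩ := List.mem_map.1 hx
      exact R.mem_ball hε hερ hv3 m.finite_toSet hmv p)
    (by rw [R.glimm_map hε hερ hv3 hm hmv, one_mul]; exact hv4)
  have h2 := hr' (fun p => v (y p)) fun p hp => by
    rw [← huy p hp]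
    exact hyr p
  rw [R.glimm_map hε hερ hv3 hm hmv, List.map_map] at h1
  rw [R.glimm_map hε hερ hu3 hl hlu] at h2
  exact h2.trans_le h1

theorem System.tendsto_infOn {ε C₀ δ : ℝ} {F : (ℝ → State n) → ℝ} {u : ℝ → State n}
    (hF : ∀ v, 0 ≤ F v) (hu : u ∈ P.Dstar ε C₀ δ)
    (h : ∀ κ > 0, ∃ η > 0, ∀ v ∈ P.B ε C₀ δ η u, F u - κ < F v) :
    Tendsto (P.infOn ε C₀ δ F u) (𝓝[>] 0) (𝓝 (F u)) := by
  have hmem : ∀ η > 0, u ∈ P.B ε C₀ δ η u := fun η hη => ⟨hu, by simpa using hη⟩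
  refine tendsto_order.2 ⟨fun c hc => ?_, fun c hc => ?_⟩
  · obtain ⟨η₀, hη₀, hlow⟩ := h ((F u - c) / 2) (by linarith)
    filter_upwards [Ioo_mem_nhdsGT hη₀] with η hη
    refine lt_of_lt_of_le (show c < F u - (F u - c) / 2 by linarith) ?_
    refine le_csInf ⟨F u, u, hmem η hη.1, rfl⟩ ?_
    rintro _ ⟨v, hv, rfl⟩
    exact (hlow v ⟨hv.1, hv.2.trans_le (ENNReal.ofReal_le_ofReal hη.2.le)⟩).le
  · filter_upwards [self_mem_nhdsWithin] with η hη
    refine lt_of_le_of_lt (csInf_le ⟨0, ?_⟩ ⟨u, hmem η hη, rfl⟩) hc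
    rintro _ ⟨v, -, rfl⟩
    exact hF v

end Glimm

/-! ### The main theorem. -/

theorem mainTheorem5 {n : ℕ} (P : Glimm.System n)
    (hΩ : IsOpen P.Ω) (h0 : (0 : Glimm.State n) ∈ P.Ω)
    (hF : Glimm.ConditionF P.Ω P.f)
    (hk : ∀ j, 0 < P.k j)
    (hr : Glimm.IsNormalizedFrame P.Ω P.f P.k P.r) :
    ∃ ε₀ > 0, ∃ Cbar > 0, ∀ ε : ℝ, 0 < ε → ε < ε₀ → ∀ C₀ : ℝ, Cbar ≤ C₀ →
      ∃ δ₀ > 0, ∀ δ : ℝ, 0 < δ → δ < δ₀ → ∀ u ∈ P.Dstar ε C₀ δ,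
        (Tendsto (P.infOn ε C₀ δ (P.Q ε) u) (𝓝[>] 0) (𝓝 (P.Q ε u)) ∧
          P.Qbar ε C₀ δ u = P.Q ε u) ∧
        (Tendsto (P.infOn ε C₀ δ (P.Upsilon ε C₀) u) (𝓝[>] 0) (𝓝 (P.Upsilon ε C₀ u)) ∧
          P.UpsilonBar ε C₀ δ u = P.Upsilon ε C₀ u) := by
  obtain ⟨b, ψ, H⟩ := Glimm.exists_laxCurves P hΩ h0 hF hk hr
  obtain ⟨S, ρ, K, R⟩ := Glimm.exists_riemannSolver_of_laxCurve H
  have hK := R.nonneg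
  -- Deleting states requires `C₀ ≥ 2 K` and `K δ ≤ 1 / 2`. The extra `1` in both constants covers
  -- the case `K = 0`.
  refine ⟨ρ, R.pos, 2 * K + 1, by positivity, fun ε hε hερ C₀ hC₀ =>
    ⟨1 / (2 * (K + 1)), by positivity, fun δ hδ hδ₀ u hu => ?_⟩⟩
  have hKδ : K * δ ≤ 1 / 2 := by
    rw [lt_div_iff₀ (by positivity)] at hδ₀
    nlinarith
  have hQ : Tendsto (P.infOn ε C₀ δ (P.Q ε) u) (𝓝[>] 0) (𝓝 (P.Q ε u)) := by
    refine Glimm.System.tendsto_infOn (fun v => Glimm.System.Q_nonneg) hu fun κ hκ => ?_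
    -- With `α = 0` the condition `2 K α ≤ β` is void, so `Q` alone is lower semicontinuous.
    have := R.exists_lt_of_mem_B (α := 0) (β := 1) hε hερ.le (by linarith) hKδ le_rfl
      (by simp) hκ hu
    simpa using this
  have hU : Tendsto (P.infOn ε C₀ δ (P.Upsilon ε C₀) u) (𝓝[>] 0) (𝓝 (P.Upsilon ε C₀ u)) := by
    refine Glimm.System.tendsto_infOn (fun v => ?_) hu fun κ hκ => ?_
    · exact add_nonneg Glimm.System.V_nonneg
        (mul_nonneg (by linarith) Glimm.System.Q_nonneg)
    · have := R.exists_lt_of_mem_B (α := 1) (β := C₀) hε hερ.le (by linarith) hKδ zero_le_one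
        (by linarith) hκ hu
      simpa only [one_mul, Glimm.System.Upsilon] using this
  exact ⟨⟨hQ, hQ.limUnder_eq⟩, hU, hU.limUnder_eq⟩
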